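/- Write $x^y=y^{-1}xy$, ${}^yx=yxy^{-1}$, $[x,y]=x^{-1}y^{-1}xy$. Let $\alpha\in\mathbb Z$ and $\gamma\geq 1$ with $\alpha^\gamma\neq 1$, and consider the Wamsley group and the Macdonald group $$W=\langle X,Y,Z\mid X^Z=X^\alpha,\ {}^ZY=Y^\alpha,\ Z^\gamma=[X,Y]\rangle,\qquad G=\langle A,B\mid A^{[A,B]}=A^{\alpha^\gamma},\ {}^{[A,B]}B=B^{\alpha^\gamma}\rangle,$$ and the homomorphism $\Omega:G\to W$, $A\mapsto X$, $B\mapsto Y$, with kernel $N$. Let $p$ be an odd prime such that $h=v_p(\alpha-1)>0$, and assume that $\alpha^\gamma\not\equiv 7\pmod 9$ if $p=3$. Put $m=v_p(\alpha^\gamma-1)$ and $\gamma=p^nk$ with $n\ge 0$, $p\nmid k$. Then $G$ and $W$ are finite, the Sylow $p$-subgroup $G_p$ of $G$ is normal and is a direct factor of $G$. Let $a,b\in G_p$ be the images of $A,B$ under the canonical projection $G\to G_p$, and put $c=[a,b]$, $q=|G/G_p|$, $N_p=N\cap G_p$. Let $Z(G_p)$ and $Z_3(G_p)$ be the first and third terms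 of the upper central series of $G_p$, and set $M_n=\{V\in Z_3(G_p): V^{p^n}\in Z(G_p)\}$, $L_{2n}=\{V\in Z_3(G_p): V^{p^{2n}}=1\}$. Let $a_0,b_0,c_0$ be the images of $a,b,c$ in $G_p/N_p$, and let $W_p$ be a Sylow $p$-subgroup of $W$. Then the following hold. 1. $$N_p=M_n\cap L_{2n}=\langle a^{p^{m+2h}},a^{p^{m+h}}b^{p^{m+h}},c^{p^{m+h}}\rangle=\langle b^{p^{m+2h}},a^{p^{m+h}}b^{p^{m+h}},c^{p^{m+h}}\rangle\cong C_{p^{2n}}\times C_{p^n}\times C_{p^n},$$ and $|N_p|=p^{4n}$, $|G_p/N_p|=p^{7h+3n}$, $|W_p|=p^{7h+4n}=p^{7m-3n}$. 2. $G_p/N_p$ is generated by $a_0,b_0,c_0$ subject to the defining relations $$c_0=[a_0,b_0],\quad a_0^{c_0}=a_0^{\alpha^\gamma},\quad {}^{c_0}b_0=b_0^{\alpha^\gamma},\qquad(\mathrm{i})$$ $$a_0^{p^{m+2h}}=1,\quad a_0^{p^{m+h}}b_0^{p^{m+h}}=1,\quad b_0^{p^{m+2h}}=1,\quad c_0^{p^{m+h}}=1,\qquad(\mathrm{ii})$$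 and every element of $G_p/N_p$ can be written in one and only one way in the form $a_0^{e_1}b_0^{e_2}c_0^{e_3}$ with $0\le e_1<p^{m+2h}$, $0\le e_2<p^{m+h}$, $0\le e_3<p^{m+h}$. 3. There are $w\in W$, an injective homomorphism $G_p/N_p\to W_p$, $gN_p\mapsto w\,\Omega(g)\,w^{-1}$, by which $G_p/N_p$ is regarded as a subgroup of $W_p$, and an element $d_0=wZ^{qk}w^{-1}\in W_p$, such that $W_p$ is generated by $a_0,b_0,c_0,d_0$ subject to the defining relations (i), (ii) and $$a_0^{d_0}=a_0^{\alpha^{qk}},\quad {}^{d_0}b_0=b_0^{\alpha^{qk}},\quad d_0^{p^n}=c_0^q,$$ and every element of $W_p$ can be written in one and only one way in the form $a_0^{e_1}b_0^{e_2}c_0^{e_3}d_0^{e_4}$ with $0\le e_1<p^{m+2h}$, $0\le e_2<p^{m+h}$, $0\le e_3<p^{m+h}$, $0\le e_4<p^n$. 4. $G_p$ has an automorphism $a\leftrightarrow b$, $c\leftrightarrow c^{-1}$. It induces an automorphism $a_0\leftrightarrow b_0$, $c_0\leftrightarrow c_0^{-1}$ of $G_p/N_p$, which extends to an automorphism of $W_p$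 via $d_0\leftrightarrow d_0^{-1}$. -/

import Mathlib

namespace Wamsley

/-- Right conjugation `x ^ y = y⁻¹ x y`. -/
def conjR {T : Type*} [Group T] (x y : T) : T := y⁻¹ * x * y

/-- Left conjugation `^y x = y x y⁻¹`. -/
def conjL {T : Type*} [Group T] (y x : T) : T := y * x * y⁻¹

/-- The commutator `[x, y] = x⁻¹ y⁻¹ x y` (Mathlib's `⁅x, y⁆` is `x y x⁻¹ y⁻¹`). -/
def comm {T : Type*} [Group T] (x y : T) : T := x⁻¹ * y⁻¹ * x * y

/-- Relators of the Wamsley group: `X ^ Z = X ^ α`, `^Z Y = Y ^ β`, `Z ^ γ = [X, Y]`. -/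
def wamsleyRels (α β : ℤ) (γ : ℕ) : Set (FreeGroup (Fin 3)) :=
  let X := FreeGroup.of (0 : Fin 3)
  let Y := FreeGroup.of (1 : Fin 3)
  let Z := FreeGroup.of (2 : Fin 3)
  {conjR X Z * (X ^ α)⁻¹, conjL Z Y * (Y ^ β)⁻¹, Z ^ γ * (comm X Y)⁻¹}

/-- The Wamsley group `⟨X, Y, Z | X ^ Z = X ^ α, ^Z Y = Y ^ β, Z ^ γ = [X, Y]⟩`. -/
abbrev WGroup (α β : ℤ) (γ : ℕ) : Type := PresentedGroup (wamsleyRels α β γ)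

/-- The generators `X`, `Y`, `Z` of the Wamsley group. -/
def WX (α β : ℤ) (γ : ℕ) : WGroup α β γ := PresentedGroup.of 0
def WY (α β : ℤ) (γ : ℕ) : WGroup α β γ := PresentedGroup.of 1
def WZ (α β : ℤ) (γ : ℕ) : WGroup α β γ := PresentedGroup.of 2

/-- Relators of the Macdonald group: `A ^ [A, B] = A ^ r`, `^[A, B] B = B ^ s`. -/
def macdonaldRels (r s : ℤ) : Set (FreeGroup (Fin 2)) :=
  let A := FreeGroup.of (0 : Fin 2)
  let B := FreeGroup.of (1 : Fin 2)
  {conjR A (comm A B) * (A ^ r)⁻¹, conjL (comm A B) B * (B ^ s)⁻¹}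

/-- The Macdonald group `⟨A, B | A ^ [A, B] = A ^ r, ^[A, B] B = B ^ s⟩`. -/
abbrev MGroup (r s : ℤ) : Type := PresentedGroup (macdonaldRels r s)

/-- The generators `A`, `B` of the Macdonald group. -/
def MA (r s : ℤ) : MGroup r s := PresentedGroup.of 0
def MB (r s : ℤ) : MGroup r s := PresentedGroup.of 1

theorem conjR_pow {T : Type*} [Group T] {x z : T} {α : ℤ} (hx : conjR x z = x ^ α) (i : ℕ) :
    conjR x (z ^ i) = x ^ (α ^ i) := by
  induction i with
  | zero => simp [conjR]
  | succ i ih =>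
    have h1 : conjR x (z ^ (i + 1)) = conjR (conjR x (z ^ i)) z := by
      simp only [conjR, pow_succ, mul_inv_rev, mul_assoc]
    have h2 : ∀ j : ℤ, conjR (x ^ j) z = conjR x z ^ j := fun j => by
      simpa [conjR] using (conj_zpow (i := j) (a := z⁻¹) (b := x)).symm
    rw [h1, ih, h2, hx, ← zpow_mul, pow_succ, mul_comm]

theorem conjL_pow {T : Type*} [Group T] {y z : T} {β : ℤ} (hy : conjL z y = y ^ β) (i : ℕ) :
    conjL (z ^ i) y = y ^ (β ^ i) := by
  have h := conjR_pow (x := y) (z := z⁻¹) (α := β) (by simpa [conjR, conjL] using hy) i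
  simpa [conjR, conjL] using h

theorem WX_rel (α β : ℤ) (γ : ℕ) : conjR (WX α β γ) (WZ α β γ) = WX α β γ ^ α := by
  have h := PresentedGroup.one_of_mem (rels := wamsleyRels α β γ) (Or.inl rfl)
  rw [map_mul, map_inv, mul_inv_eq_one, map_zpow] at h
  simp only [conjR, map_mul, map_inv] at h
  exact h

theorem WY_rel (α β : ℤ) (γ : ℕ) : conjL (WZ α β γ) (WY α β γ) = WY α β γ ^ β := by
  have h := PresentedGroup.one_of_mem (rels := wamsleyRels α β γ) (Or.inr (Or.inl rfl))
  rw [map_mul, map_inv, mul_inv_eq_one, map_zpow] at h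
  simp only [conjL, map_mul, map_inv] at h
  exact h

theorem WZ_rel (α β : ℤ) (γ : ℕ) : WZ α β γ ^ γ = comm (WX α β γ) (WY α β γ) := by
  have h := PresentedGroup.one_of_mem (rels := wamsleyRels α β γ) (Or.inr (Or.inr rfl))
  rw [map_mul, map_inv, mul_inv_eq_one, map_pow] at h
  simp only [comm, map_mul, map_inv] at h
  exact h

/-- The homomorphism from the Macdonald group with parameters `α ^ γ`, `β ^ γ` to the Wamsley
group that sends `A` to `X` and `B` to `Y`. -/
def Omega (α β : ℤ) (γ : ℕ) : MGroup (α ^ γ) (β ^ γ) →* WGroup α β γ :=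
  PresentedGroup.toGroup (f := ![WX α β γ, WY α β γ]) (by
    rintro r (rfl | rfl)
    · have h := conjR_pow (WX_rel α β γ) γ
      rw [WZ_rel] at h
      rw [map_mul, map_inv, mul_inv_eq_one, map_zpow]
      simpa [conjR, comm] using h
    · have h := conjL_pow (WY_rel α β γ) γ
      rw [WZ_rel] at h
      rw [map_mul, map_inv, mul_inv_eq_one, map_zpow]
      simpa [conjL, comm] using h)

/-- `N ∩ P` as a subgroup of `P`, where `N` is the kernel of `Omega`. -/
abbrev Np (α β : ℤ) (γ : ℕ) (P : Subgroup (MGroup (α ^ γ) (β ^ γ))) : Subgroup P :=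
  (Omega α β γ).ker.subgroupOf P

/-- The elements `V` of `Z₃(J)` with `V ^ (p ^ n)` central in `J`. -/
def Mset (J : Type*) [Group J] (p n : ℕ) : Set J :=
  {V | V ∈ Subgroup.upperCentralSeries J 3 ∧ V ^ p ^ n ∈ Subgroup.center J}

/-- The elements `V` of `Z₃(J)` with `V ^ (p ^ i) = 1`. -/
def Lset (J : Type*) [Group J] (p i : ℕ) : Set J :=
  {V | V ∈ Subgroup.upperCentralSeries J 3 ∧ V ^ p ^ i = 1}

/-- The relators
`c = [a, b]`, `a ^ c = a ^ r`, `^c b = b ^ r`,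
`a ^ (p ^ (m + 2h)) = 1`, `a ^ (p ^ (m + h)) b ^ (p ^ (m + h)) = 1`,
`b ^ (p ^ (m + 2h)) = 1`, `c ^ (p ^ (m + h)) = 1`. -/
def relsABC {F : Type*} [Group F] (p m h : ℕ) (r : ℤ) (a b c : F) : Set F :=
  {c * (comm a b)⁻¹, conjR a c * (a ^ r)⁻¹, conjL c b * (b ^ r)⁻¹,
    a ^ p ^ (m + 2 * h), a ^ p ^ (m + h) * b ^ p ^ (m + h),
    b ^ p ^ (m + 2 * h), c ^ p ^ (m + h)}

/-- The relators `a ^ d = a ^ s`, `^d b = b ^ s`, `d ^ (p ^ n) = c ^ q`. -/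
def relsD {F : Type*} [Group F] (p n q : ℕ) (s : ℤ) (a b c d : F) : Set F :=
  {conjR a d * (a ^ s)⁻¹, conjL d b * (b ^ s)⁻¹, d ^ p ^ n * (c ^ q)⁻¹}

/-- The group with generators `a₀, b₀, c₀` and relators `relsABC`. -/
abbrev PresABC (p m h : ℕ) (r : ℤ) : Type :=
  PresentedGroup (relsABC p m h r
    (FreeGroup.of (0 : Fin 3)) (FreeGroup.of 1) (FreeGroup.of 2))

/-- The group with generators `a₀, b₀, c₀, d₀` and relators `relsABC` and `relsD`. -/
abbrev PresABCD (p m h n q : ℕ) (r s : ℤ) : Type :=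
  PresentedGroup (
    relsABC p m h r (FreeGroup.of (0 : Fin 4)) (FreeGroup.of 1) (FreeGroup.of 2) ∪
    relsD p n q s (FreeGroup.of (0 : Fin 4)) (FreeGroup.of 1) (FreeGroup.of 2) (FreeGroup.of 3))

end Wamsley

/-! Everything rests on a single relation between powers of a and b. Let a, b, c satisfy the
Macdonald relations with exponent r, and let a' satisfy a'^s = a, [a', b^s] = c, and c⁻¹a'c = a'^r.
Computing the conjugate of b^s by a = a'^s in two ways shows that a'^E is conjugate, under c^s, to
b^(-E), where E = `linkExp r s` (`MacRel.link`). Since E = (r-1) Σ j r^j, its p-adic valuation is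
exactly m + h when r - 1 and s - 1 have valuations m and h; for p = 3 this is where r ≡ 7 mod 9 has
to be excluded (`linkExp_valuation`).

Inside G the element a' = c^i a c^(-i) with s = r^i can be used. It makes a nonzero power of a
central and gives a and b finite order, so G is finite by collecting words into the form a^i b^j
c^k. The same relation modulo a prime l shows that every prime dividing the order of a divides r -
1, and then G is nilpotent (`MacRel.isNilpotent`). Hence the Sylow p-subgroup is a direct factor and
the projection onto it is a power map g ↦ g^τ. In particular the images of a and b in W are powers
of X and Y, so Z acts on them by α-th powers and its inverse, and the image of c is a power of Z.

Upper bound: in a p-group where some z acts on a and b in this way and commutes with c, take a' = z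
a z⁻¹ and s ≡ α. The link relation then forces a^(p^(m+2h)) = 1, a^P b^P = 1 and c^P = 1, with P =
p^(m+h) (`MacRel.pow_relations`). With z = c, α = r and h = m this bounds G_p by p^(7m); with z = Z
it bounds the image of G_p by p^(3m+4h).

Lower bound: the normal form a^i z^(-k) b^j dictates how right multiplication by the generators must
act on exponent triples. Suitable congruences show that these maps are permutations satisfying the
Wamsley relations (`exists_model`), and the orbit of the base point under ⟨X, Y⟩ has p^(3m+4h)
points. So both bounds are sharp, normal forms are unique, and the exponents describing N_p can be
read off. The same unique normal form gives the first three terms of the upper central series of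
G_p, and m = h + n (lifting the exponent) identifies N_p with M_n ∩ L_2n.

For W_p, the element d = Z^(qk) normalizes the image of G_p and d^(p^n) = c^q. Up to conjugation a
Sylow subgroup contains both, an index count bounds its order from above, and a homomorphism from W
to ZMod γ killing X and Y separates the powers of d. In each presentation the presented group has at
most as many elements as there are normal forms, so its surjection onto the concrete group is an
isomorphism. The automorphisms all come from the symmetry a ↔ b, c ↔ c⁻¹, Z ↔ Z⁻¹ of the relations.
-/

namespace Wamsley
open Finset

/-! ### Macdonald relations and the link between powers of a and powers of b -/

/-- The relations of the Macdonald group for `a`, `b` with `c = [a, b]`. -/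
structure MacRel {T : Type*} [Group T] (r : ℤ) (a b c : T) : Prop where
  swap : a * b = b * a * c
  conj_a : c⁻¹ * a * c = a ^ r
  conj_b : c * b * c⁻¹ = b ^ r

/-- The geometric sum `r + r ^ 2 + ⋯ + r ^ n`. -/
def geo (r : ℤ) (n : ℕ) : ℤ := ∑ t ∈ Finset.range n, r ^ (t + 1)

theorem geo_zero (r : ℤ) : geo r 0 = 0 := by simp [geo]

theorem geo_succ (r : ℤ) (n : ℕ) : geo r (n + 1) = r * geo r n + r := by
  simp only [geo, Finset.sum_range_succ', Finset.mul_sum]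
  simp [pow_succ, mul_comm]

theorem geo_succ_right (r : ℤ) (n : ℕ) : geo r (n + 1) = geo r n + r ^ (n + 1) := by
  simp only [geo, Finset.sum_range_succ]

/-- The exponent `n r ^ n - (r + ⋯ + r ^ n)` that links the powers of `a` and `b`. -/
def linkExp (r : ℤ) (n : ℕ) : ℤ := n * r ^ n - geo r n

section
variable {T : Type*} [Group T] {r : ℤ} {a b c : T}

theorem comm_eq_iff {a b c : T} : c = comm a b ↔ a * b = b * a * c := by
  unfold comm
  constructor
  · rintro rfl; group
  · intro h
    have : c = (b * a)⁻¹ * (a * b) := by rw [h]; group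
    rw [this]; group

theorem conj_pow_zpow {x z : T} {s : ℤ} (h : z * x * z⁻¹ = x ^ s) (n : ℕ) (i : ℤ) :
    z ^ n * x ^ i * (z ^ n)⁻¹ = x ^ (s ^ n * i) := by
  induction n generalizing i with
  | zero => simp
  | succ n ih =>
    have : z ^ (n + 1) * x ^ i * (z ^ (n + 1))⁻¹ = z ^ n * (z * x ^ i * z⁻¹) * (z ^ n)⁻¹ := by
      rw [pow_succ]; group
    rw [this, ← conj_zpow, h, ← zpow_mul, ih, pow_succ, mul_assoc]

theorem conj_inv_pow_zpow {x z : T} {s : ℤ} (h : z⁻¹ * x * z = x ^ s) (n : ℕ) (i : ℤ) :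
    (z ^ n)⁻¹ * x ^ i * z ^ n = x ^ (s ^ n * i) := by
  have := conj_pow_zpow (z := z⁻¹) (by simpa using h) n i
  simpa using this

namespace MacRel

theorem symm (h : MacRel r a b c) : MacRel r b a c⁻¹ where
  swap := by rw [h.swap]; group
  conj_a := by simpa using h.conj_b
  conj_b := by simpa using h.conj_a

theorem c_eq (h : MacRel r a b c) : c = comm a b := comm_eq_iff.2 h.swap

theorem map {T' : Type*} [Group T'] (φ : T →* T') (h : MacRel r a b c) :
    MacRel r (φ a) (φ b) (φ c) where
  swap := by simpa using congrArg φ h.swap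
  conj_a := by simpa using congrArg φ h.conj_a
  conj_b := by simpa using congrArg φ h.conj_b

theorem conj_b_pow (h : MacRel r a b c) (n : ℕ) (i : ℤ) :
    c ^ n * b ^ i * (c ^ n)⁻¹ = b ^ (r ^ n * i) := conj_pow_zpow h.conj_b n i

theorem conj_a_pow (h : MacRel r a b c) (n : ℕ) (i : ℤ) :
    (c ^ n)⁻¹ * a ^ i * c ^ n = a ^ (r ^ n * i) := conj_inv_pow_zpow h.conj_a n i

/-- The conjugate of a power of `b` by `a`. -/
theorem conj_b_by_a (h : MacRel r a b c) (n : ℕ) :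
    a⁻¹ * b ^ n * a = (c ^ n)⁻¹ * b ^ geo r n := by
  have h1 : a⁻¹ * b * a = c⁻¹ * b ^ r := by
    rw [← h.conj_b]
    have := h.swap
    calc a⁻¹ * b * a = a⁻¹ * (b * a * c) * c⁻¹ := by group
      _ = _ := by rw [← this]; group
  have h2 : a⁻¹ * b ^ n * a = (a⁻¹ * b * a) ^ n := by
    simpa using (conj_pow (a := a⁻¹) (b := b) (i := n)).symm
  rw [h2, h1]
  clear h1 h2
  induction n with
  | zero => simp [geo_zero]
  | succ n ih =>
    rw [pow_succ, ih]
    have := h.conj_b_pow 1 (geo r n)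
    rw [pow_one, pow_one] at this
    calc (c ^ n)⁻¹ * b ^ geo r n * (c⁻¹ * b ^ r)
        = (c ^ (n + 1))⁻¹ * (c * b ^ geo r n * c⁻¹) * b ^ r := by rw [pow_succ']; group
      _ = _ := by rw [this, geo_succ, zpow_add, mul_assoc]

theorem conj_a_by_b (h : MacRel r a b c) (n : ℕ) :
    b⁻¹ * a ^ n * b = c ^ n * a ^ geo r n := by
  simpa using h.symm.conj_b_by_a n

theorem conj_c_by_a (h : MacRel r a b c) (n : ℕ) :
    a⁻¹ * c ^ n * a = c ^ n * a ^ (1 - r ^ n) := by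
  have := h.conj_a_pow n (-1)
  calc a⁻¹ * c ^ n * a = c ^ n * ((c ^ n)⁻¹ * a ^ (-1 : ℤ) * c ^ n) * a := by group
    _ = _ := by rw [this, mul_assoc]; congr 1; rw [← zpow_add_one]; congr 1; ring

/-- If `a' ^ s = a` and `[a', b ^ s] = c`, then a power of `a'` is conjugate to one of `b`. -/
theorem link (h : MacRel r a b c) {a' : T} {s : ℕ} (ha' : a' ^ s = a)
    (hsw : a' * b ^ s = b ^ s * a' * c) (hc : c⁻¹ * a' * c = a' ^ r) :
    c ^ s * a' ^ linkExp r s * (c ^ s)⁻¹ = b ^ (- linkExp r s) := by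
  -- Conjugate b^s by a' one factor at a time. For n = s this is conjugation by a itself, which
  -- `conj_b_by_a` evaluates differently; comparing the two gives the relation.
  have key : ∀ n : ℕ, (a' ^ n)⁻¹ * b ^ s * a' ^ n = b ^ s * a' ^ linkExp r n * (c ^ n)⁻¹ := by
    intro n
    induction n with
    | zero => simp [linkExp, geo_zero]
    | succ n ih =>
      have e1 : a'⁻¹ * b ^ s * a' = b ^ s * c⁻¹ := by
        calc a'⁻¹ * b ^ s * a' = a'⁻¹ * (b ^ s * a' * c) * c⁻¹ := by group
          _ = _ := by rw [← hsw]; group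
      have e2 : a'⁻¹ * c ^ n * a' = c ^ n * a' ^ (1 - r ^ n) := by
        have := conj_inv_pow_zpow hc n (-1)
        calc a'⁻¹ * c ^ n * a' = c ^ n * ((c ^ n)⁻¹ * a' ^ (-1 : ℤ) * c ^ n) * a' := by group
          _ = _ := by rw [this, mul_assoc]; congr 1; rw [← zpow_add_one]; congr 1; ring
      have e3 := conj_inv_pow_zpow hc 1 (linkExp r n - (1 - r ^ n))
      rw [pow_one, pow_one] at e3
      calc (a' ^ (n + 1))⁻¹ * b ^ s * a' ^ (n + 1)
          = a'⁻¹ * ((a' ^ n)⁻¹ * b ^ s * a' ^ n) * a' := by rw [pow_succ]; group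
        _ = (a'⁻¹ * b ^ s * a') * a' ^ linkExp r n * (a'⁻¹ * c ^ n * a')⁻¹ := by
            rw [ih]; group
        _ = b ^ s * (c⁻¹ * a' ^ (linkExp r n - (1 - r ^ n)) * c) * (c ^ (n + 1))⁻¹ := by
            rw [e1, e2, zpow_sub a' (linkExp r n), pow_succ]
            simp only [mul_inv_rev, mul_assoc, mul_inv_cancel_left]
        _ = _ := by
            rw [e3]; congr 3; simp only [linkExp, geo_succ]; push_cast; ring
  have e1 := key s
  rw [ha', h.conj_b_by_a s] at e1
  have e2 := h.conj_b_pow s s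
  have e3 : b ^ geo r s = b ^ (r ^ s * s) * (c ^ s * a' ^ linkExp r s * (c ^ s)⁻¹) := by
    rw [← e2, zpow_natCast]
    calc b ^ geo r s = c ^ s * ((c ^ s)⁻¹ * b ^ geo r s) := by group
      _ = _ := by rw [e1]; group
  have e4 : c ^ s * a' ^ linkExp r s * (c ^ s)⁻¹ = (b ^ (r ^ s * s))⁻¹ * b ^ geo r s := by
    rw [e3]; group
  rw [e4, ← zpow_neg, ← zpow_add]
  congr 1; simp only [linkExp]; ring

/-- The link relation with `a' = c ^ i a c ^ (-i)`, where `s = r ^ i`. -/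
theorem zpow_a_eq (h : MacRel r a b c) {s i : ℕ} (hs : (s : ℤ) = r ^ i) :
    a ^ linkExp r s = b ^ (-linkExp r s * r ^ (s + i)) := by
  -- Here a'^s = c^i a^(r^i) c^(-i) = a. Since b^s = c^i b c^(-i), the commutator [a', b^s] is the
  -- conjugate of c by a power of c, that is c.
  have h1 := h.link (a' := c ^ i * a * (c ^ i)⁻¹) (s := s)
    (by
      have := h.conj_a_pow i 1
      rw [conj_pow, ← zpow_natCast a s, hs]
      rw [zpow_one, mul_one] at this
      rw [← this]; group)
    (by
      have := h.conj_b_pow i 1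
      rw [zpow_one, mul_one, ← hs, zpow_natCast] at this
      rw [← this]
      calc _ = c ^ i * (a * b) * (c ^ i)⁻¹ := by group
        _ = _ := by rw [h.swap]; group)
    (by
      rw [conj_zpow, ← h.conj_a]; group)
  have h2 : c ^ (s + i) * a ^ linkExp r s * (c ^ (s + i))⁻¹ = b ^ (-linkExp r s) := by
    rw [← h1, conj_zpow, pow_add]; group
  have h3 := h.conj_a_pow (s + i) (linkExp r s)
  rw [zpow_mul, ← h2, conj_zpow, ← zpow_mul, mul_comm (linkExp r s), ← h3]
  group

/-- The element a^E with E = `linkExp r s` is also a power of b, so it commutes with a and b and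
therefore with c; but c conjugates it to its r-th power. -/
theorem zpow_a_eq_one (h : MacRel r a b c) {s i : ℕ} (hs : (s : ℤ) = r ^ i) :
    a ^ (linkExp r s * (r - 1)) = 1 := by
  have h1 := h.zpow_a_eq hs
  have hb : Commute (a ^ linkExp r s) b := by
    rw [h1]; exact Commute.zpow_left (Commute.refl b) _
  have ha : Commute (a ^ linkExp r s) a := Commute.zpow_left (Commute.refl a) _
  have hc : Commute (a ^ linkExp r s) c := by
    rw [h.c_eq]; unfold comm
    exact ((ha.inv_right.mul_right hb.inv_right).mul_right ha).mul_right hb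
  have h2 := h.conj_a_pow 1 (linkExp r s)
  rw [pow_one, pow_one, mul_assoc, hc.eq, inv_mul_cancel_left] at h2
  rw [mul_sub, mul_one, zpow_sub, mul_comm (linkExp r s), ← h2, mul_inv_cancel]

/-- Generation: if `a`, `b`, `c` have finite order, every element of `⟨a, b⟩` is a product
`a ^ i b ^ j c ^ k`. -/
theorem exists_normal_form (h : MacRel r a b c) (ha : IsOfFinOrder a) (hb : IsOfFinOrder b)
    (hc : IsOfFinOrder c) {g : T} (hg : g ∈ Subgroup.closure {a, b}) :
    ∃ i j k : ℕ, g = a ^ i * b ^ j * c ^ k := by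
  have fin : ∀ x : T, IsOfFinOrder x → ∀ i : ℤ, ∃ j : ℕ, x ^ i = x ^ j := fun x hx i => by
    have hpos : (0 : ℤ) < orderOf x := by exact_mod_cast hx.orderOf_pos
    refine ⟨(i % orderOf x).toNat, ?_⟩
    rw [← zpow_natCast, Int.toNat_of_nonneg (Int.emod_nonneg _ hpos.ne'), zpow_mod_orderOf]
  -- Products are collected in the order a, c, b, where right multiplication by b is free and right
  -- multiplication by a is governed by `conj_b_by_a`. Finite orders allow natural exponents, for
  -- which the conjugation formulas are available. The factors b and c are exchanged at the end.
  have step_b : ∀ g : T, (∃ i j k : ℤ, g = a ^ i * c ^ k * b ^ j) → ∀ l : ℤ,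
      ∃ i j k : ℤ, g * b ^ l = a ^ i * c ^ k * b ^ j := by
    rintro g ⟨i, j, k, rfl⟩ l
    exact ⟨i, j + l, k, by rw [zpow_add]; group⟩
  have step_a : ∀ g : T, (∃ i j k : ℤ, g = a ^ i * c ^ k * b ^ j) → ∀ l : ℕ,
      ∃ i j k : ℤ, g * a ^ l = a ^ i * c ^ k * b ^ j := by
    intro g hg l
    induction l with
    | zero => simpa using hg
    | succ l ih =>
      obtain ⟨i, j, k, hh⟩ := ih
      obtain ⟨j', hj'⟩ := fin b hb j
      obtain ⟨k', hk'⟩ := fin c hc (-k)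
      have e1 := h.conj_b_by_a j'
      have e2 := h.conj_a_pow k' 1
      rw [← hk', mul_one, zpow_one] at e2
      refine ⟨i + r ^ k', geo r j', k - j', ?_⟩
      rw [pow_succ, ← mul_assoc, hh, hj', zpow_add, ← e2]
      calc a ^ i * c ^ k * b ^ j' * a = a ^ i * c ^ k * a * (a⁻¹ * b ^ j' * a) := by group
        _ = _ := by rw [e1, zpow_sub]; group
  have main : ∃ i j k : ℤ, g = a ^ i * c ^ k * b ^ j := by
    induction hg using Subgroup.closure_induction_right with
    | one => exact ⟨0, 0, 0, by simp⟩
    | mul_right x hx y hy ih =>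
      rcases hy with rfl | rfl
      · simpa using step_a _ ih 1
      · simpa using step_b _ ih 1
    | mul_inv_cancel x hx y hy ih =>
      rcases hy with rfl | rfl
      · obtain ⟨l, hl⟩ := fin y ha (-1)
        rw [zpow_neg_one] at hl
        rw [hl]; exact step_a _ ih l
      · simpa using step_b _ ih (-1)
  obtain ⟨i, j, k, rfl⟩ := main
  obtain ⟨i', hi'⟩ := fin a ha i
  obtain ⟨k', hk'⟩ := fin c hc k
  obtain ⟨j', hj'⟩ := fin b hb (r ^ k' * j)
  refine ⟨i', j', k', ?_⟩
  rw [hi', hk', ← hj', ← h.conj_b_pow]; group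

end MacRel
end

/-! ### Valuations of link exponents and of geometric sums -/

theorem linkExp_eq (r : ℤ) (s : ℕ) :
    linkExp r s = (r - 1) * ∑ j ∈ range s, (j : ℤ) * r ^ j := by
  induction s with
  | zero => simp [linkExp, geo_zero]
  | succ n ih =>
    rw [sum_range_succ, mul_add, ← ih]
    simp only [linkExp, geo_succ_right]; push_cast; ring

theorem sub_one_mul_geo (r : ℤ) (n : ℕ) : (r - 1) * geo r n = r * (r ^ n - 1) := by
  induction n with
  | zero => simp [geo_zero]
  | succ n ih => rw [geo_succ_right, mul_add, ih]; ring

theorem geo_eq (r : ℤ) (n : ℕ) : geo r n = r * ∑ t ∈ range n, r ^ t := by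
  rw [geo, mul_sum]; exact sum_congr rfl fun t _ => by ring

theorem pow_expand_two (R : ℤ) (i : ℕ) : (R - 1) ^ 2 ∣ R ^ i - (1 + i * (R - 1)) := by
  induction i with
  | zero => simp
  | succ i ih =>
    have : R ^ (i + 1) - (1 + (i + 1 : ℕ) * (R - 1))
        = R * (R ^ i - (1 + i * (R - 1))) + i * (R - 1) ^ 2 := by push_cast; ring
    rw [this]; exact dvd_add (ih.mul_left _) (dvd_mul_left _ _)

theorem pow_expand_three (R : ℤ) (i : ℕ) :
    (R - 1) ^ 3 ∣ R ^ i - (1 + i * (R - 1) + (i.choose 2 : ℕ) * (R - 1) ^ 2) := by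
  induction i with
  | zero => simp
  | succ i ih =>
    have : R ^ (i + 1) - (1 + (i + 1 : ℕ) * (R - 1) + ((i + 1).choose 2 : ℕ) * (R - 1) ^ 2)
        = R * (R ^ i - (1 + i * (R - 1) + (i.choose 2 : ℕ) * (R - 1) ^ 2))
          + (i.choose 2 : ℕ) * (R - 1) ^ 3 := by
      rw [Nat.choose_succ_succ' i 1]; push_cast [Nat.choose_one_right]; ring
    rw [this]; exact dvd_add (ih.mul_left _) (dvd_mul_left _ _)

theorem six_sum_sq (s : ℕ) :
    6 * ∑ j ∈ range s, (j : ℤ) * j = (s - 1) * s * (2 * s - 1) := by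
  induction s with
  | zero => simp
  | succ n ih => rw [sum_range_succ, mul_add, ih]; push_cast; ring

theorem two_sum_id (s : ℕ) : 2 * ∑ j ∈ range s, (j : ℤ) = s * (s - 1) := by
  induction s with
  | zero => simp
  | succ n ih => rw [sum_range_succ, mul_add, ih]; push_cast; ring

/-- The exact power of `p` in `linkExp r s`. -/
theorem linkExp_valuation {p m h s : ℕ} {r u s' : ℤ} (hp : p.Prime) (hodd : Odd p)
    (hh : 0 < h) (hhm : h ≤ m) (hr : r = 1 + p ^ m * u) (hu : ¬ (p : ℤ) ∣ u)
    (hs : (s : ℤ) = 1 + p ^ h * s') (hs' : ¬ (p : ℤ) ∣ s')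
    (hp3 : p = 3 → ¬ r ≡ 7 [ZMOD 9]) :
    ∃ κ : ℤ, linkExp r s = p ^ (m + h) * κ ∧ ¬ (p : ℤ) ∣ κ := by
  have hpz : Prime (p : ℤ) := Nat.prime_iff_prime_int.1 hp
  have hp0 : (p : ℤ) ≠ 0 := hpz.ne_zero
  obtain ⟨m, rfl⟩ : ∃ m', m = m' + 1 := ⟨m - 1, by omega⟩
  obtain ⟨h, rfl⟩ : ∃ h', h = h' + 1 := ⟨h - 1, by omega⟩
  obtain ⟨e, rfl⟩ : ∃ e, m = h + e := ⟨m - h, by omega⟩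
  obtain ⟨K, hK⟩ : ∃ K : ℤ, ∑ j ∈ range s, (j : ℤ) * r ^ j
      = ∑ j ∈ range s, (j : ℤ) + (r - 1) * ∑ j ∈ range s, (j : ℤ) * j + (r - 1) ^ 2 * K := by
    have : (r - 1) ^ 2 ∣ ∑ j ∈ range s, (j : ℤ) * (r ^ j - (1 + j * (r - 1))) :=
      dvd_sum fun j _ => (pow_expand_two r j).mul_left _
    obtain ⟨K, hK⟩ := this
    refine ⟨K, ?_⟩
    rw [← hK, mul_sum, ← sum_add_distrib, ← sum_add_distrib]
    exact sum_congr rfl fun j _ => by ring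
  set Sg := ∑ j ∈ range s, (j : ℤ) * r ^ j
  -- The factor s - 1 carries p^h, while the factor r - 1 of `linkExp r s` carries p^m. It remains
  -- to see that the bracket loses nothing more than the 6 does.
  have h6 : 6 * Sg = s * (s - 1) * (3 + (r - 1) * (2 * s - 1)) + 6 * (r - 1) ^ 2 * K := by
    rw [hK, mul_add, mul_add]
    have e1 := six_sum_sq s
    have e2 := two_sum_id s
    linear_combination 3 * e2 + (r - 1) * e1
  have hs1 : ¬ (p : ℤ) ∣ s := by
    rintro ⟨w, hw⟩
    apply hpz.not_isUnit
    rw [hw] at hs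
    exact isUnit_of_dvd_one ⟨w - p ^ h * s', by rw [pow_succ] at hs; linear_combination -hs⟩
  have hr1 : r - 1 = p ^ (h + e + 1) * u := by rw [hr]; ring
  have hs2 : (s : ℤ) - 1 = p ^ (h + 1) * s' := by rw [hs]; ring
  suffices hS : ∃ κ : ℤ, Sg = p ^ (h + 1) * κ ∧ ¬ (p : ℤ) ∣ κ by
    obtain ⟨κ, h1, h2⟩ := hS
    refine ⟨u * κ, ?_, fun hd => (hpz.dvd_or_dvd hd).elim hu h2⟩
    rw [linkExp_eq]
    change (r - 1) * Sg = _
    rw [hr1, h1]; ring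
  have hp2 : ¬ (p : ℤ) ∣ 2 := by
    intro hd
    have := (Nat.prime_dvd_prime_iff_eq hp Nat.prime_two).1 (by exact_mod_cast hd)
    subst this; exact absurd hodd (by decide)
  -- For p = 3 the bracket is 3(1 + 3^(m-1) u (2s-1)) in the original m, and 2s - 1 ≡ 1 mod 3. Its 3
  -- cancels the one in 6 exactly, unless 3 divides 1 + 3^(m-1) u, which means r ≡ 7 mod 9. For p >
  -- 3 the bracket is prime to p.
  by_cases h3 : p = 3
  · subst h3
    obtain ⟨κ, hκ⟩ : ∃ κ : ℤ, 2 * Sg = (3 : ℤ) ^ (h + 1) * κ ∧ ¬ (3 : ℤ) ∣ κ := by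
      refine ⟨s * s' * (1 + 3 ^ (h + e) * u * (2 * s - 1))
        + 3 * (2 * 3 ^ (h + e + e) * u ^ 2 * K), ?_, ?_⟩
      · have : 3 * (2 * Sg) = 6 * Sg := by ring
        have h3 : (3 : ℤ) ≠ 0 := by norm_num
        apply mul_left_cancel₀ h3
        rw [this, h6, hs2, hr1]; push_cast; ring
      · rw [dvd_add_left (dvd_mul_right _ _)]
        intro hd
        rcases hpz.dvd_or_dvd hd with hd | hd
        · exact (hpz.dvd_or_dvd hd).elim hs1 hs'
        · push_cast at hd hs hr
          have h1 : (3 : ℤ) ∣ 1 + 3 ^ (h + e) * u := by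
            have : 1 + 3 ^ (h + e) * u * (2 * s - 1)
              = 1 + 3 ^ (h + e) * u + 3 * (3 ^ (h + e) * u * (2 * 3 ^ h * s')) := by
              rw [hs]; ring
            rw [this] at hd
            exact (dvd_add_left (dvd_mul_right _ _)).1 hd
          obtain ⟨w, hw⟩ := h1
          apply hp3 rfl
          have : r = 7 + 9 * (w - 1) := by
            rw [hr, pow_succ]; linear_combination 3 * hw
          rw [this]
          exact (Int.modEq_iff_dvd.2 ⟨-(w - 1), by ring⟩)
    obtain ⟨h1, h2⟩ := hκ
    have hd : (2 : ℤ) ∣ κ := by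
      have : (2 : ℤ) ∣ 3 ^ (h + 1) * κ := ⟨Sg, h1.symm⟩
      exact (Int.isCoprime_iff_gcd_eq_one.2 (by norm_num)).pow_right.dvd_of_dvd_mul_left this
    obtain ⟨κ', rfl⟩ := hd
    exact ⟨κ', by push_cast; linarith, fun hd => h2 (hd.mul_left _)⟩
  · have hp3' : ¬ (p : ℤ) ∣ 3 := by
      intro hd
      exact h3 ((Nat.prime_dvd_prime_iff_eq hp Nat.prime_three).1 (by exact_mod_cast hd))
    have hp6 : ¬ (p : ℤ) ∣ 6 := fun hd => by
      rw [show (6 : ℤ) = 2 * 3 by norm_num] at hd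
      exact (hpz.dvd_or_dvd hd).elim hp2 hp3'
    have h1 : 6 * Sg = p ^ (h + 1) * (s * s' * (3 + p ^ (h + e + 1) * u * (2 * s - 1))
        + p * (6 * p ^ (h + e + e) * u ^ 2 * K)) := by
      rw [h6, hs2, hr1]; ring
    have hd : (p : ℤ) ^ (h + 1) ∣ Sg := by
      have hco : IsCoprime ((p : ℤ) ^ (h + 1)) 6 :=
        ((Prime.coprime_iff_not_dvd hpz).2 hp6).pow_left
      exact hco.dvd_of_dvd_mul_left ⟨_, h1⟩
    obtain ⟨κ, hκ⟩ := hd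
    refine ⟨κ, hκ, fun hd => ?_⟩
    rw [hκ, mul_left_comm] at h1
    have h2 := mul_left_cancel₀ (pow_ne_zero _ hp0) h1
    have h4 : (p : ℤ) ∣ s * s' * (3 + p ^ (h + e + 1) * u * (2 * s - 1)) := by
      have := hd.mul_left 6
      rw [h2] at this
      exact (dvd_add_left (dvd_mul_right _ _)).1 this
    rcases hpz.dvd_or_dvd h4 with h5 | h5
    · exact (hpz.dvd_or_dvd h5).elim hs1 hs'
    · apply hp3'
      have : (p : ℤ) ^ (h + e + 1) * u * (2 * s - 1)
        = p * (p ^ (h + e) * u * (2 * s - 1)) := by ring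
      rw [this] at h5
      exact (dvd_add_left (dvd_mul_right _ _)).1 h5

/-- To first order in R - 1 the sum is p + (R-1) p(p-1)/2, and p divides p(p-1)/2 because p is odd.
-/
theorem sum_pow_prime {p m : ℕ} {R : ℤ} (hodd : Odd p) (hm : 0 < m)
    (hR : (p : ℤ) ^ m ∣ R - 1) : (p : ℤ) ^ (m + 1) ∣ ∑ i ∈ range p, R ^ i - p := by
  have h1 : (R - 1) ^ 2 ∣ ∑ i ∈ range p, (R ^ i - (1 + i * (R - 1))) :=
    dvd_sum fun i _ => pow_expand_two R i
  have h2 : (p : ℤ) ^ (m + 1) ∣ (R - 1) ^ 2 := by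
    refine dvd_trans (pow_dvd_pow _ (by omega : m + 1 ≤ m * 2)) ?_
    rw [pow_mul]; exact pow_dvd_pow_of_dvd hR 2
  have h3 : ∑ i ∈ range p, R ^ i - p = ∑ i ∈ range p, (R ^ i - (1 + i * (R - 1)))
      + (∑ i ∈ range p, (i : ℤ)) * (R - 1) := by
    rw [sum_sub_distrib, sum_add_distrib, sum_mul]
    simp only [sum_const, card_range, nsmul_eq_mul, mul_one]
    ring
  rw [h3]
  refine dvd_add (h2.trans h1) ?_
  rw [add_comm, pow_add, pow_one]
  refine mul_dvd_mul ?_ hR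
  obtain ⟨l, rfl⟩ := hodd
  refine ⟨l, ?_⟩
  have := two_sum_id (2 * l + 1)
  have h2 : (2 : ℤ) ≠ 0 := by norm_num
  apply mul_left_cancel₀ h2
  rw [this]; push_cast; ring

theorem sum_pow_mul (r : ℤ) (x y : ℕ) :
    ∑ t ∈ range (x * y), r ^ t = (∑ t ∈ range x, r ^ t) * ∑ i ∈ range y, (r ^ x) ^ i := by
  induction y with
  | zero => simp
  | succ y ih =>
    rw [Nat.mul_succ, sum_range_add, ih, sum_range_succ, mul_add]
    congr 1
    rw [sum_mul]
    exact sum_congr rfl fun i _ => by rw [← pow_mul, pow_add, mul_comm]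

theorem pow_sub_one_eq (r : ℤ) (n : ℕ) : r ^ n - 1 = (r - 1) * ∑ t ∈ range n, r ^ t :=
  (mul_geom_sum r n).symm

/-- Geometric sums with ratio close to `1`. -/
theorem sum_pow_close {p m : ℕ} {r : ℤ} (hodd : Odd p) (hm : 0 < m)
    (hr : (p : ℤ) ^ m ∣ r - 1) (e : ℕ) (x : ℕ) :
    (p : ℤ) ^ (m + e) ∣ ∑ t ∈ range (p ^ e * x), r ^ t - (p ^ e * x : ℕ) := by
  induction e with
  | zero =>
    have : ∑ t ∈ range (p ^ 0 * x), r ^ t - (p ^ 0 * x : ℕ) = ∑ t ∈ range x, (r ^ t - 1) := by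
      simp
    rw [this]
    exact dvd_sum fun t _ => hr.trans (sub_one_dvd_pow_sub_one r t)
  | succ e ih =>
    obtain ⟨A, hA⟩ := ih
    have h1 : (p : ℤ) ^ m ∣ r ^ (p ^ e * x) - 1 := hr.trans (sub_one_dvd_pow_sub_one r _)
    obtain ⟨D, hD⟩ := sum_pow_prime hodd hm h1
    rw [show p ^ (e + 1) * x = p ^ e * x * p by ring, sum_pow_mul, sub_eq_iff_eq_add.1 hA,
      sub_eq_iff_eq_add.1 hD]
    refine ⟨A * (p ^ m * D + 1) + x * D, ?_⟩
    push_cast; ring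

theorem geo_close {p m : ℕ} {r : ℤ} (hodd : Odd p) (hm : 0 < m)
    (hr : (p : ℤ) ^ m ∣ r - 1) {e x : ℕ} (hx : p ^ e ∣ x) :
    (p : ℤ) ^ (m + e) ∣ geo r x - x := by
  obtain ⟨y, rfl⟩ := hx
  have h1 := sum_pow_close hodd hm hr e y
  have : geo r (p ^ e * y) - (p ^ e * y : ℕ)
      = r * (∑ t ∈ range (p ^ e * y), r ^ t - (p ^ e * y : ℕ)) + (r - 1) * (p ^ e * y : ℕ) := by
    rw [geo_eq]; ring
  rw [this]
  refine dvd_add (h1.mul_left _) ?_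
  rw [pow_add]; push_cast
  exact mul_dvd_mul hr (dvd_mul_right _ _)

theorem pow_sub_one_close {p m : ℕ} {r : ℤ} (hodd : Odd p) (hm : 0 < m)
    (hr : (p : ℤ) ^ m ∣ r - 1) {e x : ℕ} (hx : p ^ e ∣ x) :
    (p : ℤ) ^ (m + e) ∣ r ^ x - 1 := by
  obtain ⟨y, rfl⟩ := hx
  have h1 := sum_pow_close hodd hm hr e y
  rw [pow_sub_one_eq, pow_add]
  refine mul_dvd_mul hr ?_
  rw [dvd_iff_dvd_of_dvd_sub (((pow_dvd_pow _ (by omega)).trans h1))]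
  push_cast; exact dvd_mul_right _ _

/-- Converse of `pow_sub_one_close` when the valuation of `r - 1` is exactly `m`. -/
theorem pow_dvd_of_pow_sub_one {p m : ℕ} {r u : ℤ} (hp : p.Prime) (hodd : Odd p) (hm : 0 < m)
    (hr : r = 1 + p ^ m * u) (hu : ¬ (p : ℤ) ∣ u) {e x : ℕ}
    (hx : (p : ℤ) ^ (m + e) ∣ r ^ x - 1) : p ^ e ∣ x := by
  have hpz : Prime (p : ℤ) := Nat.prime_iff_prime_int.1 hp
  have hp0 : (p : ℤ) ≠ 0 := hpz.ne_zero
  induction e with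
  | zero => simp
  | succ e ih =>
    obtain ⟨y, rfl⟩ := ih ((pow_dvd_pow _ (by omega)).trans hx)
    obtain ⟨A, hA⟩ := sum_pow_close hodd hm (r := r) ⟨u, by rw [hr]; ring⟩ e y
    obtain ⟨B, hB⟩ := hx
    obtain ⟨m, rfl⟩ : ∃ m', m = m' + 1 := ⟨m - 1, by omega⟩
    rw [pow_sub_one_eq, sub_eq_iff_eq_add.1 hA] at hB
    have h1 : (p : ℤ) ^ (m + 1 + e) * (p * B) = p ^ (m + 1 + e) * (u * (p * (p ^ m * A) + y)) := by
      calc (p : ℤ) ^ (m + 1 + e) * (p * B) = p ^ (m + 1 + (e + 1)) * B := by ring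
        _ = _ := by rw [← hB, hr]; push_cast; ring
    have h2 := mul_left_cancel₀ (pow_ne_zero _ hp0) h1
    have h3 : (p : ℤ) ∣ y :=
      (dvd_add_right (dvd_mul_right _ _)).1 ((hpz.dvd_or_dvd ⟨B, h2.symm⟩).resolve_left hu)
    rw [pow_succ]
    exact mul_dvd_mul_left _ (by exact_mod_cast h3)

/-! ### Finiteness and nilpotency of the Macdonald group -/

section
variable {T : Type*} [Group T] {r : ℤ} {a b c : T}

/-- The choice s = r² is a natural number even when r is negative. As p is odd, r² - 1 still has
valuation m, so the link exponent has finite valuation and cannot vanish. -/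
theorem linkExp_sq_ne_zero {p m : ℕ} {u : ℤ} (hp : p.Prime) (hodd : Odd p) (hm : 0 < m)
    (hr : r = 1 + p ^ m * u) (hu : ¬ (p : ℤ) ∣ u) (hp3 : p = 3 → ¬ r ≡ 7 [ZMOD 9]) :
    linkExp r (r ^ 2).toNat ≠ 0 := by
  have hpz : Prime (p : ℤ) := Nat.prime_iff_prime_int.1 hp
  have hs : ((r ^ 2).toNat : ℤ) = 1 + p ^ m * (u * (2 + p ^ m * u)) := by
    rw [Int.toNat_of_nonneg (sq_nonneg r), hr]; ring
  obtain ⟨κ, h1, h2⟩ := linkExp_valuation hp hodd hm le_rfl hr hu hs (by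
    intro hd
    rcases hpz.dvd_or_dvd hd with hd | hd
    · exact hu hd
    · have h2 : (p : ℤ) ∣ 2 := by
        refine (dvd_add_left ?_).1 hd
        exact (dvd_pow_self _ hm.ne').mul_right _
      have := (Nat.prime_dvd_prime_iff_eq hp Nat.prime_two).1 (by exact_mod_cast h2)
      subst this; exact absurd hodd (by decide)) hp3
  rw [h1]
  exact mul_ne_zero (pow_ne_zero _ hpz.ne_zero) (fun h => h2 (h ▸ dvd_zero _))

namespace MacRel

theorem isOfFinOrder_a (h : MacRel r a b c) (hE : linkExp r (r ^ 2).toNat ≠ 0) (hr : r ≠ 1) :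
    IsOfFinOrder a :=
  isOfFinOrder_iff_zpow_eq_one.2 ⟨_, mul_ne_zero hE (sub_ne_zero.2 hr),
    h.zpow_a_eq_one (i := 2) (Int.toNat_of_nonneg (sq_nonneg r))⟩

theorem c_pow_eq (h : MacRel r a b c) {x : ℕ} (hb : b ^ x = 1) : c ^ x = b ^ geo r x := by
  have := h.conj_b_by_a x
  rw [hb, mul_one, inv_mul_cancel] at this
  exact (mul_left_cancel (this.symm.trans (inv_mul_cancel _).symm)).symm

theorem isOfFinOrder_c (h : MacRel r a b c) (hb : IsOfFinOrder b) : IsOfFinOrder c := by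
  have h1 := h.c_pow_eq (pow_orderOf_eq_one b)
  refine isOfFinOrder_iff_pow_eq_one.2 ⟨orderOf b * orderOf b, mul_pos hb.orderOf_pos hb.orderOf_pos, ?_⟩
  rw [pow_mul, h1, ← zpow_natCast, zpow_comm, zpow_natCast, pow_orderOf_eq_one, one_zpow]

theorem finite_closure (h : MacRel r a b c) (ha : IsOfFinOrder a) (hb : IsOfFinOrder b) :
    Finite (Subgroup.closure {a, b}) := by
  have hc := h.isOfFinOrder_c hb
  have : (Subgroup.closure {a, b} : Set T) ⊆
      (fun x : ℕ × ℕ × ℕ => a ^ x.1 * b ^ x.2.1 * c ^ x.2.2) ''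
        (Set.Iio (orderOf a) ×ˢ Set.Iio (orderOf b) ×ˢ Set.Iio (orderOf c)) := by
    intro g hg
    obtain ⟨i, j, k, rfl⟩ := h.exists_normal_form ha hb hc hg
    refine ⟨(i % orderOf a, j % orderOf b, k % orderOf c), ⟨Nat.mod_lt _ ha.orderOf_pos,
      Nat.mod_lt _ hb.orderOf_pos, Nat.mod_lt _ hc.orderOf_pos⟩, ?_⟩
    simp only [pow_mod_orderOf]
  exact (((Set.finite_Iio _).prod ((Set.finite_Iio _).prod (Set.finite_Iio _))).image _).subset this

end MacRel

/-- Use (r-1) `linkExp r s` = (s-1) r^(s+1) - s r^s + r with s = r^i, and let t > 1 be the order of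
r modulo l. If r is prime to t, take i = φ(t): then r^s ≡ r and the expression is (r^i - 1) r (r -
1), nonzero since 0 < i < t. Otherwise take i = t: then s ≡ 1 mod l, and vanishing would give r^s ≡
r, so r^t ≡ 1 mod t, making r prime to t. -/
theorem exists_not_dvd_linkExp {r l : ℕ} (hl : l.Prime) (hr : ¬ l ∣ r)
    (hr1 : ¬ (l : ℤ) ∣ (r : ℤ) - 1) : ∃ i, ¬ (l : ℤ) ∣ linkExp r (r ^ i) := by
  have := Fact.mk hl
  set R : ZMod l := (r : ZMod l) with hR
  have hR0 : R ≠ 0 := by rwa [hR, Ne, ZMod.natCast_eq_zero_iff]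
  have hR1 : R ≠ 1 := by
    intro h
    apply hr1
    rw [← ZMod.intCast_zmod_eq_zero_iff_dvd]
    push_cast; rw [← hR, h, sub_self]
  have hfin : IsOfFinOrder R := by
    rw [isOfFinOrder_iff_pow_eq_one]
    exact ⟨l - 1, Nat.sub_pos_of_lt hl.one_lt, ZMod.pow_card_sub_one_eq_one hR0⟩
  set t := orderOf R with ht
  have ht0 : 0 < t := hfin.orderOf_pos
  have ht1 : 1 < t := by
    refine lt_of_le_of_ne ht0 (Ne.symm ?_)
    rw [ht, Ne, orderOf_eq_one_iff]; exact hR1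
  have key : ∀ s : ℕ, ((r : ℤ) - 1) * linkExp r s = (s - 1) * r ^ (s + 1) - s * r ^ s + r := by
    intro s
    rw [linkExp, mul_sub, sub_one_mul_geo]; ring
  have keyZ : ∀ s : ℕ, (l : ℤ) ∣ linkExp r s →
      ((s : ZMod l) - 1) * R ^ (s + 1) - s * R ^ s + R = 0 := by
    intro s hs
    have h1 : (l : ℤ) ∣ ((r : ℤ) - 1) * linkExp r s := hs.mul_left _
    rw [key, ← ZMod.intCast_zmod_eq_zero_iff_dvd] at h1
    push_cast at h1
    exact h1
  have hpow : ∀ s : ℕ, s ≡ 1 [MOD t] ↔ R ^ s = R := by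
    intro s
    rw [← hfin.pow_eq_pow_iff_modEq, pow_one]
  by_cases hco : Nat.Coprime r t
  · refine ⟨Nat.totient t, fun hd => ?_⟩
    have h1 := keyZ _ hd
    have h2 : R ^ (r ^ Nat.totient t) = R := (hpow _).1 (Nat.ModEq.pow_totient hco)
    rw [pow_succ, h2] at h1
    push_cast at h1
    have h3 : (R ^ Nat.totient t - 1) * (R * (R - 1)) = 0 := by
      rw [← h1]; ring
    have h4 : R ^ Nat.totient t ≠ 1 :=
      pow_ne_one_of_lt_orderOf (Nat.totient_pos.2 ht0).ne' (Nat.totient_lt t ht1)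
    exact mul_ne_zero (sub_ne_zero.2 h4) (mul_ne_zero hR0 (sub_ne_zero.2 hR1)) h3
  · refine ⟨t, fun hd => ?_⟩
    have h1 := keyZ _ hd
    push_cast at h1
    rw [← hR, pow_orderOf_eq_one R] at h1
    have h2 : R ^ (r ^ t) = R := by linear_combination -h1
    rw [← hpow] at h2
    apply hco
    have h3 : Nat.Coprime (r ^ t) t := by
      have := h2.gcd_eq
      rw [Nat.gcd_one_left] at this; exact this
    exact (Nat.coprime_pow_left_iff ht0 _ _).1 h3

/-- Conjugate elements have equal orders, so x^s has the full order of x. -/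
theorem coprime_of_conj {x z : T} {s : ℤ} (hx : IsOfFinOrder x) (h : z * x * z⁻¹ = x ^ s) :
    IsCoprime s (orderOf x) := by
  have h1 : orderOf (x ^ s) = orderOf x := by
    rw [← h]
    exact (MulAut.conj z).orderOf_eq x
  have h2 : orderOf (x ^ s.natAbs) = orderOf x := by
    rcases Int.natAbs_eq s with hs | hs
    · rw [← h1]; conv_rhs => rw [hs]
      rw [zpow_natCast]
    · rw [← h1]; conv_rhs => rw [hs]
      rw [zpow_neg, orderOf_inv, zpow_natCast]
  rw [hx.orderOf_pow] at h2
  have h3 : Nat.gcd (orderOf x) s.natAbs = 1 := by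
    have hpos := hx.orderOf_pos
    by_contra hne
    have h4 : 1 < Nat.gcd (orderOf x) s.natAbs :=
      lt_of_le_of_ne (Nat.gcd_pos_of_pos_left _ hpos) (Ne.symm hne)
    exact absurd h2 (Nat.div_lt_self hpos h4).ne
  rw [Int.isCoprime_iff_gcd_eq_one, Int.gcd_comm]
  simpa [Int.gcd] using h3

theorem mem_center_of_generators (hgen : Subgroup.closure {a, b} = ⊤) {x : T}
    (ha : Commute x a) (hb : Commute x b) : x ∈ Subgroup.center T := by
  rw [Subgroup.mem_center_iff]
  intro g
  have hg : g ∈ Subgroup.closure {a, b} := hgen ▸ Subgroup.mem_top g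
  have : Subgroup.closure {a, b} ≤ Subgroup.centralizer {x} := by
    rw [Subgroup.closure_le]
    rintro y (rfl | rfl)
    · exact Subgroup.mem_centralizer_singleton_iff.2 ha.symm
    · exact Subgroup.mem_centralizer_singleton_iff.2 hb.symm
  exact Subgroup.mem_centralizer_singleton_iff.1 (this hg)

/-- Split off one prime l at a time by `sum_pow_mul`: the new factor is a sum of l terms, each
congruent to 1 modulo l. -/
theorem dvd_sum_pow {r : ℤ} {x : ℕ} : (∀ l : ℕ, l.Prime → l ∣ x → (l : ℤ) ∣ r - 1) →
    (x : ℤ) ∣ ∑ t ∈ range x, r ^ t := by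
  induction x using induction_on_primes with
  | zero => simp
  | one => simp
  | prime_mul l x hl ih =>
    intro h
    rw [mul_comm l x, sum_pow_mul]
    push_cast
    refine mul_dvd_mul (ih fun q hq hqx => h q hq (hqx.mul_left _)) ?_
    have h1 : (l : ℤ) ∣ ∑ i ∈ range l, ((r ^ x) ^ i - 1) :=
      dvd_sum fun i _ => (h l hl (dvd_mul_right _ _)).trans
        ((sub_one_dvd_pow_sub_one r x).trans (sub_one_dvd_pow_sub_one _ i))
    rw [sum_sub_distrib] at h1
    simpa using dvd_add h1 (dvd_refl (l : ℤ))

namespace MacRel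

/-- Replace r by a natural residue modulo the product of the two orders. If l did not divide r - 1,
some link exponent would be prime to l by `exists_not_dvd_linkExp`, whereas `zpow_a_eq_one` makes
the order of a, hence l, divide that exponent times r - 1. -/
theorem prime_dvd (h : MacRel r a b c) (ha : IsOfFinOrder a) (hb : IsOfFinOrder b) {l : ℕ}
    (hl : l.Prime) (hla : l ∣ orderOf a) : (l : ℤ) ∣ r - 1 := by
  by_contra hr1
  set N : ℤ := orderOf a * orderOf b with hN
  have hNpos : 0 < N := mul_pos (by exact_mod_cast ha.orderOf_pos) (by exact_mod_cast hb.orderOf_pos)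
  obtain ⟨r', hr'⟩ : ∃ r' : ℕ, (r' : ℤ) = r % N :=
    ⟨(r % N).toNat, Int.toNat_of_nonneg (Int.emod_nonneg _ hNpos.ne')⟩
  have hdvd : N ∣ r - r' := by rw [hr']; exact Int.dvd_self_sub_emod
  have hra : a ^ r = a ^ (r' : ℤ) := by
    rw [zpow_eq_zpow_iff_modEq]
    exact (Int.modEq_iff_dvd.2 ((Dvd.intro _ rfl).trans hdvd)).symm
  have hrb : b ^ r = b ^ (r' : ℤ) := by
    rw [zpow_eq_zpow_iff_modEq]
    exact (Int.modEq_iff_dvd.2 ((Dvd.intro_left _ rfl).trans hdvd)).symm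
  have h' : MacRel (r' : ℤ) a b c := ⟨h.swap, hra ▸ h.conj_a, hrb ▸ h.conj_b⟩
  have hlz : Prime (l : ℤ) := Nat.prime_iff_prime_int.1 hl
  have hlN : (l : ℤ) ∣ N := (by exact_mod_cast hla : (l : ℤ) ∣ orderOf a).mul_right _
  have hr1' : ¬ (l : ℤ) ∣ (r' : ℤ) - 1 := fun hd => hr1 (by
    have : r - 1 = (r - r') + (r' - 1) := by ring
    rw [this]; exact dvd_add (hlN.trans hdvd) hd)
  have hco := coprime_of_conj (z := c⁻¹) (s := r') ha (by simpa using h'.conj_a)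
  have hlr : ¬ l ∣ r' := by
    intro hd
    have h1 : (l : ℤ) ∣ r' := by exact_mod_cast hd
    have h2 : (l : ℤ) ∣ orderOf a := by exact_mod_cast hla
    exact hlz.not_isUnit (hco.isUnit_of_dvd' h1 h2)
  obtain ⟨i, hi⟩ := exists_not_dvd_linkExp hl hlr hr1'
  have h1 := h'.zpow_a_eq_one (s := r' ^ i) (i := i) (by push_cast; rfl)
  rw [← orderOf_dvd_iff_zpow_eq_one] at h1
  have h2 : (l : ℤ) ∣ orderOf a := by exact_mod_cast hla
  exact (hlz.dvd_or_dvd (h2.trans h1)).elim hi hr1'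

/-- With c^y = 1, conjugation by b sends a^y to a^(geo r y), where geo r y = y w. For odd l one has
w ≡ 1 mod l, and a^(ly) = 1 finishes. For l = 2 an odd w works the same way, and an even w forces
a^y = 1. -/
theorem commute_a_pow {l y : ℕ} (hl : l.Prime) (hlr : (l : ℤ) ∣ r - 1)
    (hy : ∀ q : ℕ, q.Prime → q ∣ y → (q : ℤ) ∣ r - 1) (hy0 : 0 < y)
    (h : MacRel r a b c) (ha : a ^ (l * y) = 1) (hc : c ^ y = 1) : Commute (a ^ y) b := by
  have h1 := h.conj_a_by_b y
  rw [hc, one_mul] at h1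
  have hdy : (y : ℤ) ∣ geo r y := by rw [geo_eq]; exact (dvd_sum_pow hy).mul_left _
  suffices hs : a ^ geo r y = a ^ y by
    rw [hs] at h1
    calc a ^ y * b = b * (b⁻¹ * a ^ y * b) := by group
      _ = _ := by rw [h1]
  have hz : a ^ ((l : ℤ) * y) = 1 := by
    have : ((l : ℤ) * y) = ((l * y : ℕ) : ℤ) := by push_cast; rfl
    rw [this, zpow_natCast, ha]
  obtain ⟨w, hw⟩ := hdy
  rcases hl.eq_two_or_odd' with rfl | hodd
  · rcases Int.even_or_odd w with ⟨v, hv⟩ | ⟨v, hv⟩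
    · have h2 : a ^ geo r y = 1 := by
        rw [hw, hv, show (y : ℤ) * (v + v) = ((2 : ℕ) * y) * v by push_cast; ring, zpow_mul, hz,
          one_zpow]
      rw [h2] at h1 ⊢
      have : a ^ y = b * 1 * b⁻¹ := by rw [← h1]; group
      rw [this]; simp
    · rw [hw, hv, show (y : ℤ) * (2 * v + 1) = ((2 : ℕ) * y) * v + y by push_cast; ring, zpow_add,
        zpow_mul, hz, one_zpow, one_mul, zpow_natCast]
  · obtain ⟨e, y', hy', rfl⟩ := Nat.exists_eq_pow_mul_and_not_dvd hy0.ne' l hl.ne_one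
    have h2 := geo_close hodd one_pos (by simpa using hlr) (e := e) (dvd_mul_right (l ^ e) y')
    have h3 : (l : ℤ) ∣ w - 1 := by
      rw [hw] at h2
      have h4 : (l : ℤ) ^ e * l ∣ (l : ℤ) ^ e * (y' * (w - 1)) := by
        convert h2 using 1
        · ring
        · push_cast; ring
      have h5 := (mul_dvd_mul_iff_left (pow_ne_zero e (by exact_mod_cast hl.ne_zero))).1 h4
      refine ((Nat.prime_iff_prime_int.1 hl).dvd_or_dvd h5).resolve_left ?_
      exact_mod_cast hy'
    obtain ⟨v, hv⟩ := h3
    rw [hw, show w = l * v + 1 by linarith, mul_add, ← mul_assoc, mul_comm _ (l : ℤ), zpow_add,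
      zpow_mul, hz, one_zpow, one_mul, mul_one, zpow_natCast]

/-- Induction on a common exponent x = l y of a and b. Since r^y ≡ 1 mod ly, c^y is central. In the
quotient by the centre c^y = 1, so a^y and b^y become central there; in the second quotient by the
centre, a and b have exponent y. -/
theorem isNilpotent_aux (r : ℤ) (x : ℕ) : 0 < x →
    (∀ l : ℕ, l.Prime → l ∣ x → (l : ℤ) ∣ r - 1) →
    ∀ (T : Type*) [Group T] (a b c : T), MacRel r a b c → Subgroup.closure {a, b} = ⊤ →
      a ^ x = 1 → b ^ x = 1 → Group.IsNilpotent T := by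
  induction x using Nat.strong_induction_on with
  | _ x ih =>
  intro hx0 hx T _ a b c h hgen ha hb
  by_cases hx1 : x = 1
  · subst hx1
    rw [pow_one] at ha hb
    have : Subsingleton T := by
      have : Subgroup.closure {a, b} = (⊥ : Subgroup T) := by
        rw [ha, hb]; simp
      rw [hgen] at this
      exact Subgroup.subsingleton_iff.1 (subsingleton_of_bot_eq_top this.symm)
    infer_instance
  obtain ⟨l, hl, y, rfl⟩ := Nat.exists_prime_and_dvd hx1
  have hy0 : 0 < y := Nat.pos_of_mul_pos_left hx0
  have hlr : (l : ℤ) ∣ r - 1 := hx l hl (dvd_mul_right _ _)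
  have hy : ∀ q : ℕ, q.Prime → q ∣ y → (q : ℤ) ∣ r - 1 := fun q hq hqy => hx q hq (hqy.mul_left _)
  -- a power of `c` is central
  have hpow : ∀ z : T, z ^ (l * y) = 1 → z ^ (r ^ y) = z := by
    intro z hz
    have h1 : ((l * y : ℕ) : ℤ) ∣ r ^ y - 1 := by
      rw [pow_sub_one_eq]; push_cast
      exact mul_dvd_mul hlr (dvd_sum_pow hy)
    obtain ⟨w, hw⟩ := h1
    rw [sub_eq_iff_eq_add.1 hw, zpow_add, zpow_mul, zpow_natCast, hz, one_zpow, one_mul, zpow_one]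
  have hcy : c ^ y ∈ Subgroup.center T := by
    refine mem_center_of_generators hgen ?_ ?_
    · have := h.conj_a_pow y 1
      rw [mul_one, hpow a ha, zpow_one] at this
      rw [commute_iff_eq]
      calc c ^ y * a = c ^ y * ((c ^ y)⁻¹ * a * c ^ y) := by rw [this]
        _ = _ := by group
    · have := h.conj_b_pow y 1
      rw [mul_one, hpow b hb, zpow_one] at this
      rw [commute_iff_eq]
      calc c ^ y * b = (c ^ y * b * (c ^ y)⁻¹) * c ^ y := by group
        _ = _ := by rw [this]
  have hmap : ∀ {T T' : Type _} [Group T] [Group T'] (φ : T →* T') (_ : Function.Surjective φ)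
      (a b : T), Subgroup.closure {a, b} = ⊤ → Subgroup.closure {φ a, φ b} = ⊤ := by
    intro T T' _ _ φ hφ a b hg
    have := congrArg (Subgroup.map φ) hg
    rwa [MonoidHom.map_closure, Set.image_pair, Subgroup.map_top_of_surjective φ hφ] at this
  apply Group.of_quotient_center_nilpotent
  set φ := QuotientGroup.mk' (Subgroup.center T)
  have h1 := h.map φ
  have hc1 : φ c ^ y = 1 := by
    rw [← map_pow]; exact (QuotientGroup.eq_one_iff _).2 hcy
  have hg1 := hmap φ (QuotientGroup.mk'_surjective _) a b hgen
  have ha1 : φ a ^ (l * y) = 1 := by rw [← map_pow, ha, map_one]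
  have hb1 : φ b ^ (l * y) = 1 := by rw [← map_pow, hb, map_one]
  have hac : φ a ^ y ∈ Subgroup.center _ := mem_center_of_generators hg1
    ((Commute.refl _).pow_left _) (h1.commute_a_pow hl hlr hy hy0 ha1 hc1)
  have hbc : φ b ^ y ∈ Subgroup.center _ := mem_center_of_generators hg1
    (h1.symm.commute_a_pow hl hlr hy hy0 hb1 (by rw [inv_pow, hc1, inv_one]))
    ((Commute.refl _).pow_left _)
  apply Group.of_quotient_center_nilpotent
  set ψ := QuotientGroup.mk' (Subgroup.center (T ⧸ Subgroup.center T))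
  refine ih y ?_ hy0 hy _ (ψ (φ a)) (ψ (φ b)) (ψ (φ c)) (h1.map ψ)
    (hmap ψ (QuotientGroup.mk'_surjective _) _ _ hg1) ?_ ?_
  · exact (Nat.lt_mul_iff_one_lt_left hy0).2 hl.one_lt
  · rw [← map_pow]; exact (QuotientGroup.eq_one_iff _).2 hac
  · rw [← map_pow]; exact (QuotientGroup.eq_one_iff _).2 hbc

theorem isNilpotent (h : MacRel r a b c) (ha : IsOfFinOrder a) (hb : IsOfFinOrder b)
    (hgen : Subgroup.closure {a, b} = ⊤) : Group.IsNilpotent T := by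
  refine isNilpotent_aux r (orderOf a * orderOf b) (mul_pos ha.orderOf_pos hb.orderOf_pos) ?_ T
    a b c h hgen ?_ ?_
  · intro l hl hd
    rcases (Nat.Prime.dvd_mul hl).1 hd with hd | hd
    · exact h.prime_dvd ha hb hl hd
    · exact h.symm.prime_dvd hb ha hl hd
  · rw [pow_mul, pow_orderOf_eq_one, one_pow]
  · rw [mul_comm, pow_mul, pow_orderOf_eq_one, one_pow]

end MacRel
end

/-! ### Congruences for iterated geometric sums -/

theorem two_mul_choose (j : ℕ) : 2 * ((j + 1).choose 2 : ℤ) = j * (j + 1) := by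
  induction j with
  | zero => simp
  | succ j ih =>
    rw [Nat.choose_succ_succ' (j + 1) 1]
    push_cast [Nat.choose_one_right]
    linear_combination ih

theorem six_mul_choose (j : ℕ) : 6 * ((j + 1).choose 3 : ℤ) = j ^ 3 - j := by
  induction j with
  | zero => simp [Nat.choose]
  | succ j ih =>
    rw [Nat.choose_succ_succ' (j + 1) 2]
    push_cast
    linear_combination ih + 3 * two_mul_choose j

theorem two_mul_choose' (j : ℕ) : 2 * (j.choose 2 : ℤ) = j * (j - 1) := by
  cases j with
  | zero => simp
  | succ j => rw [two_mul_choose]; push_cast; ring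

theorem six_mul_choose' (j : ℕ) : 6 * (j.choose 3 : ℤ) = j * (j - 1) * (j - 2) := by
  cases j with
  | zero => simp
  | succ j => rw [six_mul_choose]; push_cast; ring

/-- Third order is the precision required: (r-1)^3 is divisible by p^(3m), hence by p^(m+2h) when h
≤ m. -/
theorem geo_expand (r : ℤ) (j : ℕ) : (r - 1) ^ 3 ∣
    geo r j - (j + (r - 1) * (j + 1).choose 2 + (r - 1) ^ 2 * (j + 1).choose 3) := by
  induction j with
  | zero => simp [geo_zero, Nat.choose]
  | succ j ih =>
    have h1 := pow_expand_three r (j + 1)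
    rw [geo_succ_right, Nat.choose_succ_succ' (j + 1) 1, Nat.choose_succ_succ' (j + 1) 2]
    push_cast [Nat.choose_one_right] at h1 ⊢
    obtain ⟨x, hx⟩ := ih
    obtain ⟨y, hy⟩ := h1
    exact ⟨x + y, by linear_combination hx + hy⟩

theorem dvd_of_dvd_two_mul {p e : ℕ} (hodd : Odd p) {x : ℤ} (h : (p : ℤ) ^ e ∣ 2 * x) :
    (p : ℤ) ^ e ∣ x := by
  refine (IsCoprime.pow_left ?_).dvd_of_dvd_mul_left h
  rw [Int.isCoprime_iff_gcd_eq_one]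
  exact (Nat.coprime_two_right).2 hodd

/-- Dividing by 6 could lose a factor 3 when p = 3. The right-hand side supplies it, either in the
coefficient 3A or in the additional p. -/
theorem dvd_of_six_mul {p e : ℕ} (hp : p.Prime) (hodd : Odd p) {x A B : ℤ}
    (h : 6 * x = p ^ e * (3 * A) + p ^ (e + 1) * B) : (p : ℤ) ^ e ∣ x := by
  by_cases h3 : p = 3
  · subst h3
    refine dvd_of_dvd_two_mul hodd ⟨A + B, ?_⟩
    have h0 : (3 : ℤ) ≠ 0 := by norm_num
    apply mul_left_cancel₀ h0
    linear_combination h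
  · have hd : (p : ℤ) ^ e ∣ 3 * x := dvd_of_dvd_two_mul hodd ⟨3 * A + p * B, by
      linear_combination h⟩
    refine (IsCoprime.pow_left ?_).dvd_of_dvd_mul_left hd
    rw [Int.isCoprime_iff_gcd_eq_one]
    exact (Nat.coprime_primes hp Nat.prime_three).2 h3

/-- The geometric sum `r + ⋯ + r ^ j` of natural numbers. -/
def geoN (r j : ℕ) : ℕ := ∑ t ∈ range j, r ^ (t + 1)

theorem geoN_cast (r j : ℕ) : (geoN r j : ℤ) = geo r j := by simp [geoN, geo]

theorem geoN_succ (r j : ℕ) : geoN r (j + 1) = r * (geoN r j + 1) := by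
  zify; rw [geoN_cast, geoN_cast, geo_succ]; ring

/-- The partial sums of the orbit of `j` under `geoN r`. -/
def orbSum (r j t : ℕ) : ℕ := ∑ l ∈ range t, (geoN r)^[l] j

section
variable {p m h r α : ℕ} {u v : ℤ}

/-- Each application of `geoN r` adds (r-1)·C(J+1, 2) modulo (r-1)², and the binomial coefficient of
the current value J is constant modulo p^m along the orbit. -/
theorem geoN_iterate (hodd : Odd p) (hr : (r : ℤ) = 1 + p ^ m * u) (j : ℕ) :
    ∃ w : ℕ → ℤ, ∀ t, (((geoN r)^[t] j : ℕ) : ℤ)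
      = j + t * (p ^ m * u) * (j + 1).choose 2 + p ^ (2 * m) * w t := by
  suffices H : ∀ t : ℕ, ∃ w : ℤ, (((geoN r)^[t] j : ℕ) : ℤ)
      = j + t * (p ^ m * u) * (j + 1).choose 2 + p ^ (2 * m) * w by
    choose w hw using H; exact ⟨w, hw⟩
  intro t
  induction t with
  | zero => exact ⟨0, by simp⟩
  | succ t ih =>
    obtain ⟨w, hw⟩ := ih
    rw [Function.iterate_succ_apply', geoN_cast]
    set J := (geoN r)^[t] j
    obtain ⟨B, hB⟩ := geo_expand r J
    have hG : (p : ℤ) ^ m ∣ (J + 1).choose 2 - (j + 1).choose 2 := by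
      apply dvd_of_dvd_two_mul hodd
      refine ⟨(t * u * (j + 1).choose 2 + p ^ m * w) * (J + j + 1), ?_⟩
      rw [mul_sub, two_mul_choose, two_mul_choose]
      linear_combination (J + j + 1 : ℤ) * hw
    obtain ⟨D, hD⟩ := hG
    have hr1 : (r : ℤ) - 1 = p ^ m * u := by rw [hr]; ring
    rw [hr1] at hB
    refine ⟨w + u * D + u ^ 2 * (J + 1).choose 3 + p ^ m * u ^ 3 * B, ?_⟩
    push_cast
    linear_combination hB + hw + (p ^ m * u) * hD

/-- The value of the `α`-th iterate of `geoN r`, when `α` is close to `1`. -/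
theorem geoN_iterate_close (hp : p.Prime) (hodd : Odd p) (hh : 0 < h) (hhm : h ≤ m)
    (hr : (r : ℤ) = 1 + p ^ m * u) (hα : (α : ℤ) = 1 + p ^ h * v) (j : ℕ) :
    (p : ℤ) ^ (m + 2 * h) ∣ ((geoN r)^[α] j : ℕ) - (j + α * (p ^ m * u) * (j + 1).choose 2
      + α * (p ^ m * u) ^ 2 * (j + 1).choose 3) := by
  obtain ⟨e, rfl⟩ : ∃ e, m = h + e := ⟨m - h, by omega⟩
  obtain ⟨h', rfl⟩ : ∃ h', h = h' + 1 := ⟨h - 1, by omega⟩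
  obtain ⟨w, hw⟩ := geoN_iterate hodd hr j
  set J : ℕ → ℕ := fun l => (geoN r)^[l] j with hJ
  have hr1 : (r : ℤ) - 1 = p ^ (h' + 1 + e) * u := by rw [hr]; ring
  set U : ℤ := p ^ (h' + 1 + e) * u with hU
  set g : ℤ := (((j + 1).choose 2 : ℕ) : ℤ) with hg
  set q : ℤ := (((j + 1).choose 3 : ℕ) : ℤ) with hq
  -- telescoping
  obtain ⟨B, hB⟩ : ∃ B : ℤ, (J α : ℤ) = j + U * ∑ l ∈ range α, ((J l + 1).choose 2 : ℤ)
      + U ^ 2 * ∑ l ∈ range α, ((J l + 1).choose 3 : ℤ) + U ^ 3 * B := by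
    have hstep : ∀ l : ℕ, ∃ B : ℤ, (J (l + 1) : ℤ) - J l = U * ((J l + 1).choose 2 : ℤ)
        + U ^ 2 * ((J l + 1).choose 3 : ℤ) + U ^ 3 * B := by
      intro l
      obtain ⟨B, hB⟩ := geo_expand r (J l)
      refine ⟨B, ?_⟩
      simp only [hJ, Function.iterate_succ_apply', geoN_cast] at hB ⊢
      rw [hr1] at hB
      linear_combination hB
    choose B hB using hstep
    refine ⟨∑ l ∈ range α, B l, ?_⟩
    have := sum_range_sub (fun l => (J l : ℤ)) α
    rw [sum_congr rfl fun l _ => hB l] at this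
    rw [sum_add_distrib, sum_add_distrib, ← mul_sum, ← mul_sum, ← mul_sum] at this
    have h0 : (J 0 : ℤ) = j := by simp [hJ]
    rw [h0] at this
    linear_combination -this
  have hJl : ∀ l, (J l : ℤ) = j + l * U * g + p ^ (2 * (h' + 1 + e)) * w l := hw
  have hid := two_sum_id α
  -- the quadratic part
  have h2 : (p : ℤ) ^ (h' + 1 + e + 2 * (h' + 1)) ∣
      U * ∑ l ∈ range α, ((J l + 1).choose 2 : ℤ) - α * U * g := by
    have h21 : ∀ l : ℕ, ∃ x : ℤ, 2 * ((J l + 1).choose 2 : ℤ)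
        = 2 * g + l * (U * g * (2 * j + 1)) + p ^ (2 * (h' + 1 + e)) * x := by
      intro l
      refine ⟨w l * (J l + j + 1 + l * U * g) + l ^ 2 * u ^ 2 * g ^ 2, ?_⟩
      rw [two_mul_choose, hg, two_mul_choose, ← hg]
      have h3 : (U * l * g) ^ 2 = p ^ (2 * (h' + 1 + e)) * (l ^ 2 * u ^ 2 * g ^ 2) := by
        rw [hU]; ring
      linear_combination (J l + j + 1 + l * U * g : ℤ) * hJl l + h3
    choose x hx using h21
    have h22 : 2 * ∑ l ∈ range α, ((J l + 1).choose 2 : ℤ)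
        = α * (2 * g) + (∑ l ∈ range α, (l : ℤ)) * (U * g * (2 * j + 1))
          + p ^ (2 * (h' + 1 + e)) * ∑ l ∈ range α, x l := by
      rw [mul_sum, sum_congr rfl fun l _ => hx l, sum_add_distrib, sum_add_distrib, mul_sum,
        sum_mul]
      simp
    apply dvd_of_dvd_two_mul hodd
    apply dvd_of_dvd_two_mul hodd
    -- The linear term in l sums to α(α-1)/2, and its factor α - 1 provides the missing p^h.
    refine ⟨p ^ e * u ^ 2 * α * v * g * (2 * j + 1)
      + 2 * (p ^ (2 * e) * u * ∑ l ∈ range α, x l), ?_⟩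
    have h23 : (α : ℤ) - 1 = p ^ (h' + 1) * v := by rw [hα]; ring
    rw [h23] at hid
    have h24 : 2 * (2 * (U * ∑ l ∈ range α, ((J l + 1).choose 2 : ℤ) - α * U * g))
        = U * (α * (p ^ (h' + 1) * v) * (U * g * (2 * j + 1))
          + 2 * (p ^ (2 * (h' + 1 + e)) * ∑ l ∈ range α, x l)) := by
      linear_combination 2 * U * h22 + U * (U * g * (2 * j + 1)) * hid
    rw [h24, hU]; ring
  -- the cubic part
  have h3 : (p : ℤ) ^ (h' + 1 + e + 2 * (h' + 1)) ∣
      U ^ 2 * ∑ l ∈ range α, ((J l + 1).choose 3 : ℤ) - α * U ^ 2 * q := by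
    have h31 : ∀ l : ℕ, ∃ x : ℤ, 6 * ((J l + 1).choose 3 : ℤ)
        = 6 * q + l * (U * g * (3 * j ^ 2 - 1)) + p ^ (2 * (h' + 1 + e)) * x := by
      intro l
      refine ⟨w l * ((J l) ^ 2 + J l * j + j ^ 2 - 1)
        + l * u * g * (l * u * g + p ^ (h' + 1 + e) * w l) * (J l + 2 * j), ?_⟩
      rw [six_mul_choose, hq, six_mul_choose]
      have e1 : (J l : ℤ) - j = l * U * g + p ^ (2 * (h' + 1 + e)) * w l := by
        rw [hJl l]; ring
      have e2 : l * U * g * ((J l : ℤ) - j) = p ^ (2 * (h' + 1 + e)) *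
          (l * u * g * (l * u * g + p ^ (h' + 1 + e) * w l)) := by
        rw [e1, hU]; ring
      linear_combination ((J l : ℤ) ^ 2 + J l * j + j ^ 2 - 1) * e1 + (J l + 2 * j : ℤ) * e2
    choose x hx using h31
    have h32 : 6 * ∑ l ∈ range α, ((J l + 1).choose 3 : ℤ)
        = α * (6 * q) + (∑ l ∈ range α, (l : ℤ)) * (U * g * (3 * j ^ 2 - 1))
          + p ^ (2 * (h' + 1 + e)) * ∑ l ∈ range α, x l := by
      rw [mul_sum, sum_congr rfl fun l _ => hx l, sum_add_distrib, sum_add_distrib, mul_sum,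
        sum_mul]
      simp
    apply dvd_of_dvd_two_mul hodd
    refine dvd_of_six_mul hp hodd (A := 0) (B := p ^ (h' + 2 * e) * u ^ 3 * α * v * g
      * (3 * j ^ 2 - 1) + 2 * (p ^ (h' + 3 * e) * u ^ 2 * ∑ l ∈ range α, x l)) ?_
    have h33 : (α : ℤ) - 1 = p ^ (h' + 1) * v := by rw [hα]; ring
    rw [h33] at hid
    have h34 : 6 * (2 * (U ^ 2 * ∑ l ∈ range α, ((J l + 1).choose 3 : ℤ) - α * U ^ 2 * q))
        = U ^ 2 * (α * (p ^ (h' + 1) * v) * (U * g * (3 * j ^ 2 - 1))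
          + 2 * (p ^ (2 * (h' + 1 + e)) * ∑ l ∈ range α, x l)) := by
      linear_combination 2 * U ^ 2 * h32 + U ^ 2 * (U * g * (3 * j ^ 2 - 1)) * hid
    rw [h34, hU]; ring
  have h4 : (p : ℤ) ^ (h' + 1 + e + 2 * (h' + 1)) ∣ U ^ 3 * B :=
    ⟨p ^ (2 * e) * u ^ 3 * B, by rw [hU]; ring⟩
  have : ((geoN r)^[α] j : ℤ) - (j + α * U * g + α * U ^ 2 * q)
      = (U * ∑ l ∈ range α, ((J l + 1).choose 2 : ℤ) - α * U * g)
        + (U ^ 2 * ∑ l ∈ range α, ((J l + 1).choose 3 : ℤ) - α * U ^ 2 * q) + U ^ 3 * B := by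
    change (J α : ℤ) - _ = _
    rw [hB]; ring
  rw [this]
  exact dvd_add (dvd_add h2 h3) h4

theorem orbSum_eq (hodd : Odd p) (hr : (r : ℤ) = 1 + p ^ m * u) (j : ℕ) :
    ∃ w : ℕ → ℤ, ∀ t, (orbSum r j t : ℤ)
      = t * j + t.choose 2 * (p ^ m * u) * (j + 1).choose 2 + p ^ (2 * m) * w t := by
  obtain ⟨w, hw⟩ := geoN_iterate hodd hr j
  refine ⟨fun t => ∑ l ∈ range t, w l, fun t => ?_⟩
  simp only [orbSum]
  induction t with
  | zero => simp
  | succ t ih =>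
    rw [sum_range_succ, sum_range_succ]
    push_cast at ih ⊢
    rw [ih, hw t, Nat.choose_succ_succ' t 1]
    push_cast [Nat.choose_one_right]
    ring

/-- The first correction to α j is C(α, 2)(r-1)C(j+1, 2); here α - 1 contributes p^h and r - 1
contributes p^m. -/
theorem orbSum_close (hodd : Odd p) (hhm : h ≤ m)
    (hr : (r : ℤ) = 1 + p ^ m * u) (hα : (α : ℤ) = 1 + p ^ h * v) (j : ℕ) :
    (p : ℤ) ^ (m + h) ∣ orbSum r j α - α * j := by
  obtain ⟨e, rfl⟩ : ∃ e, m = h + e := ⟨m - h, by omega⟩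
  obtain ⟨w, hw⟩ := orbSum_eq hodd hr j
  apply dvd_of_dvd_two_mul hodd
  refine ⟨α * v * u * (j + 1).choose 2 + 2 * p ^ e * w α, ?_⟩
  have h1 := two_mul_choose' α
  have h2 : (α : ℤ) - 1 = p ^ h * v := by rw [hα]; ring
  rw [h2] at h1
  rw [hw α]
  linear_combination (p ^ (h + e) * u * (j + 1).choose 2 : ℤ) * h1

/-- The sum of the powers of `r` along the orbit sums. -/
theorem sum_pow_orbSum (hodd : Odd p) (hhm : h ≤ m)
    (hr : (r : ℤ) = 1 + p ^ m * u) (hα : (α : ℤ) = 1 + p ^ h * v) (j : ℕ) :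
    (p : ℤ) ^ (m + 2 * h) ∣ 2 * (α - ∑ t ∈ range α, (r : ℤ) ^ orbSum r j t)
      + (p ^ m * u) * α * (p ^ h * v) * j + (p ^ m * u) ^ 2 * (2 * α.choose 3 * (j + 1).choose 2
        + j ^ 2 * ∑ t ∈ range α, (t : ℤ) * t) := by
  obtain ⟨e, rfl⟩ : ∃ e, m = h + e := ⟨m - h, by omega⟩
  obtain ⟨w, hw⟩ := orbSum_eq hodd hr j
  have hr1 : (r : ℤ) - 1 = p ^ (h + e) * u := by rw [hr]; ring
  set U : ℤ := p ^ (h + e) * u with hU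
  set g : ℤ := (((j + 1).choose 2 : ℕ) : ℤ) with hg
  have h1 : ∀ t : ℕ, ∃ x : ℤ, 2 * (r : ℤ) ^ orbSum r j t = 2 + 2 * U * (t * j)
      + 2 * U ^ 2 * g * t.choose 2 + U ^ 2 * j ^ 2 * (t * t) - U ^ 2 * j * t
      + p ^ (h + e + 2 * h) * x := by
    intro t
    obtain ⟨B, hB⟩ := pow_expand_three r (orbSum r j t)
    rw [hr1] at hB
    set S : ℤ := (orbSum r j t : ℤ) with hS
    have hSw : S = t * j + t.choose 2 * U * g + p ^ (2 * (h + e)) * w t := hw t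
    have h2 := two_mul_choose' (orbSum r j t)
    rw [← hS] at h2
    refine ⟨p ^ (2 * e) * (2 * u * w t + u ^ 2 * (t.choose 2 * u * g + p ^ (h + e) * w t)
      * (S + t * j - 1) + 2 * u ^ 3 * B), ?_⟩
    have h3 : U ^ 2 * (S - t * j) = p ^ (h + e + 2 * h) * (p ^ (2 * e) * u ^ 2 *
        (t.choose 2 * u * g + p ^ (h + e) * w t)) := by
      rw [hSw, hU]; ring
    have h4 : U * p ^ (2 * (h + e)) * w t = p ^ (h + e + 2 * h) * (p ^ (2 * e) * u * w t) := by
      rw [hU]; ring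
    have h5 : U ^ 3 * B = p ^ (h + e + 2 * h) * (p ^ (2 * e) * u ^ 3 * B) := by
      rw [hU]; ring
    linear_combination 2 * hB + U ^ 2 * h2 + (S + t * j - 1) * h3 + 2 * U * hSw + 2 * h4 + 2 * h5
  choose x hx using h1
  have hc2 : ∀ n : ℕ, ∑ t ∈ range n, (t : ℤ) = n.choose 2 := by
    intro n
    have := two_sum_id n
    have := two_mul_choose' n
    linarith
  have hc3 : ∀ n : ℕ, ∑ t ∈ range n, (t.choose 2 : ℤ) = n.choose 3 := by
    intro n
    induction n with
    | zero => simp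
    | succ n ih => rw [sum_range_succ, ih, Nat.choose_succ_succ' n 2]; push_cast; ring
  have hsum : 2 * ∑ t ∈ range α, (r : ℤ) ^ orbSum r j t = 2 * α + 2 * U * (α.choose 2 * j)
      + 2 * U ^ 2 * g * α.choose 3 + U ^ 2 * j ^ 2 * ∑ t ∈ range α, (t : ℤ) * t
      - U ^ 2 * j * α.choose 2 + p ^ (h + e + 2 * h) * ∑ t ∈ range α, x t := by
    rw [mul_sum, sum_congr rfl fun t _ => hx t]
    simp only [sum_add_distrib, sum_sub_distrib, ← mul_sum, ← sum_mul, hc2, hc3]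
    simp only [sum_const, card_range, nsmul_eq_mul]
    ring
  have h2 := two_mul_choose' α
  have h3 : (α : ℤ) - 1 = p ^ h * v := by rw [hα]; ring
  rw [h3] at h2
  apply dvd_of_dvd_two_mul hodd
  refine ⟨p ^ e * u ^ 2 * j * α * v - 2 * ∑ t ∈ range α, x t, ?_⟩
  have h4 : U ^ 2 * j * (α * (p ^ h * v)) = p ^ (h + e + 2 * h) * (p ^ e * u ^ 2 * j * α * v) := by
    rw [hU]; ring
  linear_combination -2 * hsum + (U ^ 2 * j - 2 * U * j) * h2 + h4

/-- The congruences behind the conjugation relation in the model. -/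
theorem model_congruence (hp : p.Prime) (hodd : Odd p) (hh : 0 < h) (hhm : h ≤ m)
    (hr : (r : ℤ) = 1 + p ^ m * u) (hα : (α : ℤ) = 1 + p ^ h * v) (j : ℕ) :
    (p : ℤ) ^ (m + h) ∣ α - ∑ t ∈ range α, (r : ℤ) ^ orbSum r j t ∧
    (p : ℤ) ^ (m + 2 * h) ∣ (geoN r (α * j) - α * ((geoN r)^[α] j : ℕ))
      - (α - ∑ t ∈ range α, (r : ℤ) ^ orbSum r j t) := by
  have hA := geoN_iterate_close hp hodd hh hhm hr hα j
  have hB := sum_pow_orbSum hodd hhm hr hα j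
  obtain ⟨F, hF⟩ := geo_expand r (α * j)
  rw [← geoN_cast] at hF
  have hr1 : (r : ℤ) - 1 = p ^ m * u := by rw [hr]; ring
  have hα1 : (α : ℤ) - 1 = p ^ h * v := by rw [hα]; ring
  rw [hr1] at hF
  obtain ⟨e, rfl⟩ : ∃ e, m = h + e := ⟨m - h, by omega⟩
  obtain ⟨h', rfl⟩ : ∃ h', h = h' + 1 := ⟨h - 1, by omega⟩
  set U : ℤ := p ^ (h' + 1 + e) * u with hU
  set V : ℤ := p ^ (h' + 1) * v with hV
  set g : ℤ := (((j + 1).choose 2 : ℕ) : ℤ) with hg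
  set q : ℤ := (((j + 1).choose 3 : ℕ) : ℤ) with hq
  set Sg : ℤ := ∑ t ∈ range α, (r : ℤ) ^ orbSum r j t with hSg
  set H : ℤ := 2 * α.choose 3 * g + j ^ 2 * ∑ t ∈ range α, (t : ℤ) * t with hH
  have hg2 : 2 * g = j * (j + 1) := two_mul_choose j
  have hq6 : 6 * q = j ^ 3 - j := six_mul_choose j
  have hH6 : 6 * H = α * V * (3 * V * j ^ 2 + V * j - j) := by
    have e1 := six_mul_choose' α
    have e2 := six_sum_sq α
    rw [hα1] at e1 e2
    rw [hH]
    have e3 : (α : ℤ) = V + 1 := by linarith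
    linear_combination 2 * g * e1 + j ^ 2 * e2 + α * V * (α - 2) * hg2
      + α * V * (j * (j + 1) + 2 * j ^ 2) * e3
  have hF2 : 2 * ((α * j + 1).choose 2 : ℤ) = α * j * (α * j + 1) := by
    have := two_mul_choose (α * j); push_cast at this; exact this
  have hF6 : 6 * ((α * j + 1).choose 3 : ℤ) = (α * j) ^ 3 - α * j := by
    have := six_mul_choose (α * j); push_cast at this; exact this
  constructor
  · apply dvd_of_dvd_two_mul hodd
    have h1 : (p : ℤ) ^ (h' + 1 + e + (h' + 1)) ∣ U * α * V * j :=
      ⟨u * α * v * j, by rw [hU, hV]; ring⟩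
    have h2 : (p : ℤ) ^ (h' + 1 + e + (h' + 1)) ∣ U ^ 2 * H := by
      refine dvd_of_six_mul hp hodd (A := 0)
        (B := p ^ (h' + e) * u ^ 2 * α * v * (3 * V * j ^ 2 + V * j - j)) ?_
      rw [mul_left_comm, hH6, hU]; nth_rewrite 1 [hV]; ring
    have h3 := (pow_dvd_pow (p : ℤ) (by omega : h' + 1 + e + (h' + 1) ≤
      h' + 1 + e + 2 * (h' + 1))).trans hB
    obtain ⟨x, hx⟩ := dvd_sub (dvd_sub h3 h2) h1
    exact ⟨x, by rw [← hx]; ring⟩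
  · apply dvd_of_dvd_two_mul hodd
    set D : ℤ := (α * j + 1).choose 3 - α ^ 2 * q with hD
    have hD6 : 6 * D = α * V * j * (α * j ^ 2 + 1) := by
      rw [hD]; linear_combination hF6 - α ^ 2 * hq6 + α * j * (α * j ^ 2 + 1) * hα1
    -- To first order in V, 6(2D + H) is αV(2j³ + j), and 2j³ + j = 3(4q + j). This divisibility by
    -- 3 is what makes p = 3 work; the remainder has another factor V, divisible by p.
    have h1 : (p : ℤ) ^ (h' + 1 + e + 2 * (h' + 1)) ∣ U ^ 2 * (2 * D + H) := by
      refine dvd_of_six_mul hp hodd (A := p ^ e * u ^ 2 * α * v * (4 * q + j))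
        (B := p ^ (h' + e) * u ^ 2 * α * v ^ 2 * (2 * j ^ 3 + 3 * j ^ 2 + j)) ?_
      have e1 : 6 * (U ^ 2 * (2 * D + H)) = U ^ 2 * α * V * (3 * (4 * q + j))
          + U ^ 2 * α * V ^ 2 * (2 * j ^ 3 + 3 * j ^ 2 + j) := by
        linear_combination 2 * U ^ 2 * hD6 + U ^ 2 * hH6 - 2 * U ^ 2 * α * V * hq6
          + U ^ 2 * α * V * 2 * j ^ 3 * hα1
      rw [e1, hU, hV]; ring
    have h2 : (p : ℤ) ^ (h' + 1 + e + 2 * (h' + 1)) ∣ U ^ 3 * F :=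
      ⟨p ^ (2 * e) * u ^ 3 * F, by rw [hU]; ring⟩
    obtain ⟨x, hx⟩ := dvd_add (dvd_add (dvd_sub h1 hB) (h2.mul_left 2)) (hA.mul_left (-2 * α))
    refine ⟨x, ?_⟩
    rw [← hx]
    push_cast at hF
    have hg' : U * (2 * ((α * j + 1).choose 2 : ℤ) - 2 * α ^ 2 * g) = - U * α * V * j := by
      linear_combination U * hF2 - U * α ^ 2 * hg2 - U * α * j * hα1
    linear_combination 2 * hF + hg' - 2 * U ^ 2 * hD

end

/-! ### The permutation model -/

theorem geoN_add (r a b : ℕ) : geoN r (a + b) = geoN r a + r ^ a * geoN r b := by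
  simp only [geoN, sum_range_add, mul_sum]
  congr 1
  exact sum_congr rfl fun t _ => by ring

section
variable {p m h r α γ : ℕ}

/-- Needed for right multiplication by the first generator to be well defined: a state knows j only
modulo p^(m+h), but its first coordinate involves j modulo p^(m+2h). -/
theorem geoN_periodic (hodd : Odd p) (hm : 0 < m) (hhm : h ≤ m) (hr : (p : ℤ) ^ m ∣ (r : ℤ) - 1)
    {j j' : ℕ} (hj : (p : ℤ) ^ (m + h) ∣ (j : ℤ) - j') :
    (p : ℤ) ^ (m + 2 * h) ∣ ((geoN r j : ℤ) - j) - (geoN r j' - j') := by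
  wlog hle : j' ≤ j generalizing j j'
  · rw [← dvd_neg]
    have := this (by rw [← dvd_neg]; simpa using hj) (le_of_not_ge hle)
    simpa using this
  obtain ⟨d, rfl⟩ := Nat.exists_eq_add_of_le hle
  have hd : p ^ (m + h) ∣ d := by
    have : ((j' + d : ℕ) : ℤ) - j' = d := by push_cast; ring
    rw [this] at hj; exact_mod_cast hj
  have h1 := geo_close hodd hm hr hd
  have h2 : (p : ℤ) ^ (m + 2 * h) ∣ ((r : ℤ) ^ j' - 1) * d := by
    refine (pow_dvd_pow _ (by omega : m + 2 * h ≤ m + (m + h))).trans ?_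
    rw [pow_add]
    exact mul_dvd_mul (hr.trans (sub_one_dvd_pow_sub_one _ _)) (by exact_mod_cast hd)
  have h3 : (p : ℤ) ^ (m + 2 * h) ∣ geo r d - d :=
    (pow_dvd_pow _ (by omega : m + 2 * h ≤ m + (m + h))).trans h1
  rw [geoN_add]
  push_cast
  rw [geoN_cast r d]
  obtain ⟨x, hx⟩ := dvd_add h2 (h3.mul_left ((r : ℤ) ^ j'))
  exact ⟨x, by rw [← hx]; ring⟩

/-- The difference of two values is a unit modulo p times geo r d, with d the difference of the
arguments. Since geo r d ≡ d to higher precision, divisibility of geo r d passes to d one power of p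
at a time. -/
theorem geoN_injective_mod (hodd : Odd p) (hm : 0 < m) (hr : (p : ℤ) ^ m ∣ (r : ℤ) - 1)
    (e : ℕ) {j j' : ℕ} (hj : (p : ℤ) ^ e ∣ (geoN r j : ℤ) - geoN r j') :
    (p : ℤ) ^ e ∣ (j : ℤ) - j' := by
  wlog hle : j' ≤ j generalizing j j'
  · rw [← dvd_neg]
    have := this (by rw [← dvd_neg]; simpa using hj) (le_of_not_ge hle)
    simpa using this
  obtain ⟨d, rfl⟩ := Nat.exists_eq_add_of_le hle
  have h1 : ((j' + d : ℕ) : ℤ) - j' = d := by push_cast; ring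
  rw [h1]
  have hco : IsCoprime ((p : ℤ) ^ e) ((r : ℤ) ^ j') := by
    refine IsCoprime.pow ?_
    obtain ⟨w, hw⟩ := (dvd_pow_self (p : ℤ) hm.ne').trans hr
    exact ⟨-w, 1, by linear_combination hw⟩
  have h2 : (p : ℤ) ^ e ∣ geo r d := by
    refine hco.dvd_of_dvd_mul_left ?_
    rw [geoN_add] at hj
    push_cast at hj
    rw [geoN_cast r d] at hj
    simpa using hj
  clear hj hco h1
  have : p ^ e ∣ d := by
    induction e with
    | zero => simp
    | succ e ih =>
      have h3 := geo_close hodd hm hr (ih ((pow_dvd_pow _ (by omega)).trans h2))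
      have h4 := dvd_sub h2 ((pow_dvd_pow (p : ℤ) (by omega : e + 1 ≤ m + e)).trans h3)
      rw [sub_sub_cancel] at h4
      exact_mod_cast h4
  exact_mod_cast this

/-- States of the model: a triple `(i, k, j)` stands for `a ^ i z ^ (-k) b ^ j`. -/
abbrev State (p m h γ : ℕ) : Type :=
  ZMod (p ^ (m + 2 * h)) × ZMod (γ * p ^ (m + h)) × ZMod (p ^ (m + h))

/-- The state of a triple of exponents. -/
def State.mk (p m h γ : ℕ) (x : ℕ × ℕ × ℕ) : State p m h γ :=
  ((x.1 : ZMod (p ^ (m + 2 * h))) - (x.2.2 : ZMod (p ^ (m + 2 * h))), (x.2.1 : _), (x.2.2 : _))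

/-- The coordinate i - j, rather than i, reflects a^P b^P = 1 for P = p^(m+h): raising i and j
together by P does not change the modelled element. -/
theorem State.mk_eq_iff (x y : ℕ × ℕ × ℕ) : State.mk p m h γ x = State.mk p m h γ y ↔
    (p : ℤ) ^ (m + 2 * h) ∣ ((x.1 : ℤ) - y.1) - (x.2.2 - y.2.2) ∧
    ((γ * p ^ (m + h) : ℕ) : ℤ) ∣ (x.2.1 : ℤ) - y.2.1 ∧
    (p : ℤ) ^ (m + h) ∣ (x.2.2 : ℤ) - y.2.2 := by
  simp only [State.mk, Prod.mk.injEq]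
  refine and_congr ?_ (and_congr ?_ ?_)
  · have : ((p : ℤ) ^ (m + 2 * h)) = ((p ^ (m + 2 * h) : ℕ) : ℤ) := by push_cast; rfl
    rw [this, ← ZMod.intCast_zmod_eq_zero_iff_dvd]
    push_cast
    rw [← sub_eq_zero]
    constructor <;> intro h <;> linear_combination h
  · rw [← ZMod.intCast_zmod_eq_zero_iff_dvd]
    push_cast
    rw [sub_eq_zero]
  · have : ((p : ℤ) ^ (m + h)) = ((p ^ (m + h) : ℕ) : ℤ) := by push_cast; rfl
    rw [this, ← ZMod.intCast_zmod_eq_zero_iff_dvd]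
    push_cast
    rw [sub_eq_zero]

theorem State.mk_surjective (hp : 0 < p) (hγ : 0 < γ) :
    Function.Surjective (State.mk p m h γ) := by
  rintro ⟨i, k, j⟩
  have : NeZero (p ^ (m + 2 * h)) := ⟨(pow_pos hp _).ne'⟩
  have : NeZero (p ^ (m + h)) := ⟨(pow_pos hp _).ne'⟩
  have : NeZero (γ * p ^ (m + h)) := ⟨(mul_pos hγ (pow_pos hp _)).ne'⟩
  refine ⟨((i + (j.val : ZMod _)).val, k.val, j.val), ?_⟩
  simp [State.mk]

/-- A permutation of the quotient of `V` by the kernel of `π` that is induced by a map of `V`. -/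
theorem exists_perm_of_map {V S : Type*} [Finite S] {π : V → S} (hπ : Function.Surjective π)
    (F : V → V) (hF : ∀ x y, π x = π y ↔ π (F x) = π (F y)) :
    ∃ σ : Equiv.Perm S, ∀ x, σ (π x) = π (F x) := by
  let f : S → S := fun s => π (F (Function.surjInv hπ s))
  have hf : ∀ x, f (π x) = π (F x) := fun x => (hF _ _).1 (Function.surjInv_eq hπ _)
  have hinj : Function.Injective f := by
    intro s t hst
    obtain ⟨x, rfl⟩ := hπ s
    obtain ⟨y, rfl⟩ := hπ t
    rw [hf, hf] at hst
    exact (hF _ _).2 hst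
  exact ⟨Equiv.ofBijective f (Finite.injective_iff_bijective.1 hinj), hf⟩

theorem perm_pow_apply {V S : Type*} {π : V → S} {F : V → V} {σ : Equiv.Perm S}
    (h : ∀ x, σ (π x) = π (F x)) (n : ℕ) (x : V) : (σ ^ n) (π x) = π (F^[n] x) := by
  induction n generalizing x with
  | zero => simp
  | succ n ih => rw [pow_succ, Equiv.Perm.mul_apply, h, ih, Function.iterate_succ_apply]

/-- Right multiplication by the first generator on exponents. -/
def stepX (α γ : ℕ) (x : ℕ × ℕ × ℕ) : ℕ × ℕ × ℕ :=
  (x.1 + α ^ x.2.1, x.2.1 + γ * x.2.2, geoN (α ^ γ) x.2.2)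

/-- Right multiplication by the second generator on exponents. -/
def stepY (x : ℕ × ℕ × ℕ) : ℕ × ℕ × ℕ := (x.1, x.2.1, x.2.2 + 1)

/-- Right multiplication by the inverse of the third generator on exponents. -/
def stepV (α : ℕ) (x : ℕ × ℕ × ℕ) : ℕ × ℕ × ℕ := (x.1, x.2.1 + 1, α * x.2.2)

/-- The step rule encodes b^j a = a c^(-j) b^(geo r j), z^(-k) a = a^(α^k) z^(-k) and c = z^γ. In
the iteration the exponents of c⁻¹ accumulate to `orbSum`. -/
theorem stepX_iterate (t : ℕ) (i k j : ℕ) : (stepX α γ)^[t] (i, k, j) =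
    (i + α ^ k * ∑ l ∈ range t, (α ^ γ) ^ orbSum (α ^ γ) j l, k + γ * orbSum (α ^ γ) j t,
      (geoN (α ^ γ))^[t] j) := by
  induction t with
  | zero => simp [orbSum]
  | succ t ih =>
    rw [Function.iterate_succ_apply', ih, Function.iterate_succ_apply', stepX]
    simp only [orbSum, sum_range_succ, Prod.mk.injEq]
    refine ⟨?_, by ring, trivial⟩
    rw [pow_add, pow_mul]; ring

theorem stepY_iterate (t : ℕ) (i k j : ℕ) : stepY^[t] (i, k, j) = (i, k, j + t) := by
  induction t with
  | zero => simp
  | succ t ih => rw [Function.iterate_succ_apply', ih, stepY, add_assoc]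

theorem stepV_iterate (t : ℕ) (i k j : ℕ) : (stepV α)^[t] (i, k, j) = (i, k + t, α ^ t * j) := by
  induction t with
  | zero => simp
  | succ t ih =>
    rw [Function.iterate_succ_apply', ih, stepV]
    simp only [Prod.mk.injEq]
    exact ⟨trivial, by ring, by ring⟩

theorem pow_congr_of_dvd (hodd : Odd p) (hm : 0 < m) (hhm : h ≤ m)
    (hr : (p : ℤ) ^ m ∣ ((α ^ γ : ℕ) : ℤ) - 1) {k k' : ℕ}
    (hk : ((γ * p ^ (m + h) : ℕ) : ℤ) ∣ (k : ℤ) - k') :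
    (p : ℤ) ^ (m + 2 * h) ∣ (α : ℤ) ^ k - α ^ k' := by
  wlog hle : k' ≤ k generalizing k k'
  · rw [← dvd_neg]
    have := this (by rw [← dvd_neg]; simpa using hk) (le_of_not_ge hle)
    simpa using this
  obtain ⟨d, rfl⟩ := Nat.exists_eq_add_of_le hle
  have hd : γ * p ^ (m + h) ∣ d := by
    have : ((k' + d : ℕ) : ℤ) - k' = d := by push_cast; ring
    rw [this] at hk; exact_mod_cast hk
  obtain ⟨w, rfl⟩ := hd
  have h1 := pow_sub_one_close hodd hm hr (dvd_mul_right (p ^ (m + h)) w)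
  have h2 := (pow_dvd_pow (p : ℤ) (by omega : m + 2 * h ≤ m + (m + h))).trans h1
  obtain ⟨x, hx⟩ := h2
  refine ⟨α ^ k' * x, ?_⟩
  rw [mul_left_comm, ← hx]
  push_cast
  rw [pow_add, mul_assoc, pow_mul]; ring

/-- One direction makes the step well defined on states, the other makes it injective;
`exists_perm_of_map` requires both. -/
theorem stepX_mk_iff (hodd : Odd p) (hm : 0 < m) (hhm : h ≤ m)
    (hr : (p : ℤ) ^ m ∣ ((α ^ γ : ℕ) : ℤ) - 1) (x y : ℕ × ℕ × ℕ) :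
    State.mk p m h γ x = State.mk p m h γ y ↔
      State.mk p m h γ (stepX α γ x) = State.mk p m h γ (stepX α γ y) := by
  obtain ⟨i, k, j⟩ := x
  obtain ⟨i', k', j'⟩ := y
  simp only [State.mk_eq_iff, stepX]
  have hj2 : (p : ℤ) ^ (m + h) ∣ (geoN (α ^ γ) j : ℤ) - geoN (α ^ γ) j' →
      (p : ℤ) ^ (m + h) ∣ (j : ℤ) - j' := geoN_injective_mod hodd hm hr _
  have aux : (p : ℤ) ^ (m + h) ∣ (j : ℤ) - j' → (((γ * p ^ (m + h) : ℕ) : ℤ) ∣ (k : ℤ) - k' ↔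
      ((γ * p ^ (m + h) : ℕ) : ℤ) ∣ ((k + γ * j : ℕ) : ℤ) - (k' + γ * j' : ℕ)) := by
    intro hj
    have h1 : ((γ * p ^ (m + h) : ℕ) : ℤ) ∣ γ * ((j : ℤ) - j') := by
      push_cast; exact mul_dvd_mul_left _ hj
    rw [show ((k + γ * j : ℕ) : ℤ) - (k' + γ * j' : ℕ) = (k - k') + γ * ((j : ℤ) - j') by
      push_cast; ring, dvd_add_left h1]
  have aux2 : (p : ℤ) ^ (m + h) ∣ (j : ℤ) - j' → ((γ * p ^ (m + h) : ℕ) : ℤ) ∣ (k : ℤ) - k' →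
      ((p : ℤ) ^ (m + 2 * h) ∣ ((i : ℤ) - i') - (j - j') ↔
       (p : ℤ) ^ (m + 2 * h) ∣ (((i + α ^ k : ℕ) : ℤ) - (i' + α ^ k' : ℕ)) -
        ((geoN (α ^ γ) j : ℤ) - geoN (α ^ γ) j')) := by
    intro hj hk
    have h1 := pow_congr_of_dvd hodd hm hhm hr hk
    have h2 := geoN_periodic hodd hm hhm hr hj
    have h3 := dvd_sub h1 h2
    rw [← dvd_add_left h3]
    push_cast
    constructor <;> intro h <;> exact h.trans (dvd_of_eq (by ring))
  constructor
  · rintro ⟨h1, h2, h3⟩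
    refine ⟨(aux2 h3 h2).1 h1, (aux h3).1 h2, ?_⟩
    have h4 := (pow_dvd_pow (p : ℤ) (by omega : m + h ≤ m + 2 * h)).trans
      (geoN_periodic hodd hm hhm hr h3)
    exact (dvd_add h4 h3).trans (dvd_of_eq (by ring))
  · rintro ⟨h1, h2, h3⟩
    have h4 := hj2 h3
    have h5 := (aux h4).2 h2
    exact ⟨(aux2 h4 h5).2 h1, h5, h4⟩

theorem stepY_mk_iff (x y : ℕ × ℕ × ℕ) :
    State.mk p m h γ x = State.mk p m h γ y ↔
      State.mk p m h γ (stepY x) = State.mk p m h γ (stepY y) := by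
  simp only [State.mk_eq_iff, stepY]
  push_cast
  simp only [add_sub_add_right_eq_sub]

theorem stepV_mk_iff (hh : 0 < h) (hα : (p : ℤ) ^ h ∣ (α : ℤ) - 1) (x y : ℕ × ℕ × ℕ) :
    State.mk p m h γ x = State.mk p m h γ y ↔
      State.mk p m h γ (stepV α x) = State.mk p m h γ (stepV α y) := by
  obtain ⟨i, k, j⟩ := x
  obtain ⟨i', k', j'⟩ := y
  simp only [State.mk_eq_iff, stepV]
  push_cast
  rw [add_sub_add_right_eq_sub, ← mul_sub]
  have hco : IsCoprime ((p : ℤ) ^ (m + h)) (α : ℤ) := by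
    refine IsCoprime.pow_left ?_
    obtain ⟨w, hw⟩ := (dvd_pow_self (p : ℤ) hh.ne').trans hα
    exact ⟨-w, 1, by linear_combination hw⟩
  have h1 : (p : ℤ) ^ (m + h) ∣ (j : ℤ) - j' ↔ (p : ℤ) ^ (m + h) ∣ α * ((j : ℤ) - j') :=
    ⟨fun h => h.mul_left _, fun h => hco.dvd_of_dvd_mul_left h⟩
  have h2 : (p : ℤ) ^ (m + h) ∣ (j : ℤ) - j' →
      ((p : ℤ) ^ (m + 2 * h) ∣ ((i : ℤ) - i') - (j - j') ↔
       (p : ℤ) ^ (m + 2 * h) ∣ ((i : ℤ) - i') - α * (j - j')) := by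
    intro hj
    have h3 : (p : ℤ) ^ (m + 2 * h) ∣ ((α : ℤ) - 1) * ((j : ℤ) - j') := by
      rw [show m + 2 * h = h + (m + h) by ring, pow_add]
      exact mul_dvd_mul hα hj
    rw [← dvd_sub_left h3]
    constructor <;> intro h <;> exact h.trans (dvd_of_eq (by ring))
  constructor
  · rintro ⟨a1, a2, a3⟩
    exact ⟨(h2 a3).1 a1, a2, h1.1 a3⟩
  · rintro ⟨a1, a2, a3⟩
    exact ⟨(h2 (h1.2 a3)).2 a1, a2, h1.2 a3⟩

/-- This is the conjugation relation of the first generator, the only relation that is not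
immediate. In the first coordinate the discrepancy α^k(α - S) differs from α - S by (α^k - 1)(α -
S), divisible by p^h · p^(m+h), and the rest is `model_congruence`. -/
theorem stepXV_mk (hp : p.Prime) (hodd : Odd p) (hh : 0 < h) (hhm : h ≤ m)
    (hα : (p : ℤ) ^ h ∣ (α : ℤ) - 1) (hr : (p : ℤ) ^ m ∣ ((α ^ γ : ℕ) : ℤ) - 1)
    (x : ℕ × ℕ × ℕ) : State.mk p m h γ (stepX α γ (stepV α x))
      = State.mk p m h γ (stepV α ((stepX α γ)^[α] x)) := by
  obtain ⟨i, k, j⟩ := x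
  obtain ⟨u, hu⟩ := hr
  obtain ⟨v, hv⟩ := hα
  have hu' : ((α ^ γ : ℕ) : ℤ) = 1 + p ^ m * u := by linarith
  have hv' : (α : ℤ) = 1 + p ^ h * v := by linarith
  obtain ⟨h1, h2⟩ := model_congruence hp hodd hh hhm hu' hv' j
  have h3 := orbSum_close hodd hhm hu' hv' j
  rw [stepX_iterate, State.mk_eq_iff]
  simp only [stepX, stepV]
  set S : ℤ := ∑ t ∈ range α, ((α ^ γ : ℕ) : ℤ) ^ orbSum (α ^ γ) j t with hS
  have hScast : ((∑ l ∈ range α, (α ^ γ) ^ orbSum (α ^ γ) j l : ℕ) : ℤ) = S := by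
    rw [hS]; push_cast; rfl
  have h4 : (p : ℤ) ^ (m + 2 * h) ∣ ((α : ℤ) ^ k - 1) * (α - S) := by
    rw [show m + 2 * h = h + (m + h) by ring, pow_add]
    exact mul_dvd_mul (Dvd.dvd.trans ⟨v, hv⟩ (sub_one_dvd_pow_sub_one _ _)) h1
  refine ⟨?_, ?_, ?_⟩
  · obtain ⟨y, hy⟩ := dvd_sub h4 h2
    refine ⟨y, ?_⟩
    rw [← hy]
    have e1 : ((i + α ^ k * ∑ l ∈ range α, (α ^ γ) ^ orbSum (α ^ γ) j l : ℕ) : ℤ)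
      = i + α ^ k * S := by rw [← hScast]; push_cast; ring
    rw [e1]
    push_cast
    ring
  · obtain ⟨y, hy⟩ := h3
    refine ⟨-y, ?_⟩
    push_cast
    linear_combination -γ * hy
  · obtain ⟨y, hy⟩ := dvd_add ((pow_dvd_pow (p : ℤ) (by omega : m + h ≤ m + 2 * h)).trans h2) h1
    refine ⟨y, ?_⟩
    rw [← hy]; push_cast; ring

end

/-- A finite group of permutations in which the Wamsley relations hold and the first two
generators generate a large subgroup: the case of a natural number `α`. -/
theorem exists_model_nat {p m h γ α : ℕ} (hp : p.Prime) (hodd : Odd p) (hh : 0 < h) (hhm : h ≤ m)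
    (hγ : 0 < γ) (hα : (p : ℤ) ^ h ∣ (α : ℤ) - 1) (hr : (p : ℤ) ^ m ∣ ((α ^ γ : ℕ) : ℤ) - 1) :
    ∃ X Y Z : Equiv.Perm (State p m h γ), Z⁻¹ * X * Z = X ^ α ∧ Z * Y * Z⁻¹ = Y ^ α ∧
      X * Y = Y * X * Z ^ γ ∧ p ^ (3 * m + 4 * h) ∣ Nat.card (Subgroup.closure {X, Y}) := by
  have hm : 0 < m := by omega
  have : NeZero (p ^ (m + 2 * h)) := ⟨(pow_pos hp.pos _).ne'⟩
  have : NeZero (p ^ (m + h)) := ⟨(pow_pos hp.pos _).ne'⟩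
  have : NeZero (γ * p ^ (m + h)) := ⟨(mul_pos hγ (pow_pos hp.pos _)).ne'⟩
  have hsurj := State.mk_surjective (p := p) (m := m) (h := h) hp.pos hγ
  obtain ⟨X, hX⟩ := exists_perm_of_map hsurj (stepX α γ) (stepX_mk_iff hodd hm hhm hr)
  obtain ⟨Y, hY⟩ := exists_perm_of_map hsurj stepY stepY_mk_iff
  obtain ⟨V, hV⟩ := exists_perm_of_map hsurj (stepV α) (stepV_mk_iff hh hα)
  have h1 : X * V = V * X ^ α := by
    ext1 s
    obtain ⟨x, rfl⟩ := hsurj s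
    rw [Equiv.Perm.mul_apply, Equiv.Perm.mul_apply, hV, hX, perm_pow_apply hX, hV,
      stepXV_mk hp hodd hh hhm hα hr]
  have h2 : V * Y = Y ^ α * V := by
    ext1 s
    obtain ⟨⟨i, k, j⟩, rfl⟩ := hsurj s
    rw [Equiv.Perm.mul_apply, Equiv.Perm.mul_apply, hV, hY, perm_pow_apply hY, hV, stepV,
      stepY_iterate]
    simp [stepV, stepY, mul_add]
  have h3 : X * Y = V ^ γ * Y * X := by
    ext1 s
    obtain ⟨⟨i, k, j⟩, rfl⟩ := hsurj s
    rw [Equiv.Perm.mul_apply, Equiv.Perm.mul_apply, Equiv.Perm.mul_apply, hX, hY, hX, hY,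
      perm_pow_apply hV]
    simp only [stepX, stepY, stepV_iterate, geoN_succ]
    congr 2
    ring_nf
  -- Right multiplications compose in reverse order, so the relations hold for right multiplications
  -- by inverses. V already is right multiplication by the inverse of the third generator.
  refine ⟨X⁻¹, Y⁻¹, V, ?_, ?_, ?_, ?_⟩
  · rw [inv_pow, eq_inv_iff_mul_eq_one]
    calc V⁻¹ * X⁻¹ * V * X ^ α = V⁻¹ * X⁻¹ * (V * X ^ α) := by group
      _ = 1 := by rw [← h1]; group
  · rw [inv_pow, eq_inv_iff_mul_eq_one]
    calc V * Y⁻¹ * V⁻¹ * Y ^ α = V * Y⁻¹ * V⁻¹ * (Y ^ α * V) * V⁻¹ := by group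
      _ = 1 := by rw [← h2]; group
  · calc X⁻¹ * Y⁻¹ = Y⁻¹ * X⁻¹ * (X * Y) * X⁻¹ * Y⁻¹ := by group
      _ = _ := by rw [h3]; group
  -- the orbit of the base point
  set H := Subgroup.closure {X⁻¹, Y⁻¹} with hH
  have hXH : X ∈ H := by
    rw [← inv_mem_iff]; exact Subgroup.subset_closure (by simp)
  have hYH : Y ∈ H := by
    rw [← inv_mem_iff]; exact Subgroup.subset_closure (by simp)
  have hVH : V ^ γ ∈ H := by
    have : V ^ γ = X * Y * X⁻¹ * Y⁻¹ := by rw [h3]; group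
    rw [this]
    exact H.mul_mem (H.mul_mem (H.mul_mem hXH hYH) (H.inv_mem hXH)) (H.inv_mem hYH)
  let F : Fin (p ^ (m + 2 * h)) × Fin (p ^ (m + h)) × Fin (p ^ (m + h)) → State p m h γ :=
    fun x => State.mk p m h γ (x.1, γ * x.2.1, x.2.2)
  have hF : Function.Injective F := by
    rintro ⟨i, k, j⟩ ⟨i', k', j'⟩ he
    obtain ⟨e1, e2, e3⟩ := (State.mk_eq_iff _ _).1 he
    simp only at e1 e2 e3
    have fin_eq : ∀ {n : ℕ} (a b : Fin n), (n : ℤ) ∣ (a : ℤ) - b → a = b := by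
      intro n a b hd
      have := (Nat.modEq_iff_dvd.2 hd).symm
      rw [Nat.ModEq, Nat.mod_eq_of_lt a.2, Nat.mod_eq_of_lt b.2] at this
      exact Fin.ext this
    have hj : j = j' := fin_eq _ _ (by exact_mod_cast e3)
    have hk : k = k' := by
      apply fin_eq
      push_cast at e2
      rw [← mul_sub] at e2
      have := (mul_dvd_mul_iff_left (by exact_mod_cast hγ.ne' : (γ : ℤ) ≠ 0)).1 e2
      push_cast
      exact this
    subst hj
    have hi : i = i' := fin_eq _ _ (by push_cast; simpa using e1)
    rw [hi, hk]
  -- The middle coordinate modulo γ is invariant under X and Y, so the orbit of the base point stays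
  -- among the states with k divisible by γ.
  let κ : State p m h γ → ZMod γ := fun s => ZMod.castHom (dvd_mul_right γ _) (ZMod γ) s.2.1
  have hκ : ∀ x : ℕ × ℕ × ℕ, κ (State.mk p m h γ x) = (x.2.1 : ZMod γ) := by
    intro x; simp [κ, State.mk]
  have hinv : ∀ g ∈ H, ∀ s, κ (g s) = κ s := by
    intro g hg
    induction hg using Subgroup.closure_induction with
    | mem g hg =>
      intro s
      rcases hg with rfl | rfl
      · obtain ⟨t, rfl⟩ := X.surjective s
        obtain ⟨x, rfl⟩ := hsurj t
        rw [show X⁻¹ (X _) = _ from X.symm_apply_apply _, hX, hκ, hκ]; simp [stepX]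
      · obtain ⟨t, rfl⟩ := Y.surjective s
        obtain ⟨x, rfl⟩ := hsurj t
        rw [show Y⁻¹ (Y _) = _ from Y.symm_apply_apply _, hY, hκ, hκ]; simp [stepY]
    | one => simp
    | mul g g' _ _ ih ih' => intro s; rw [Equiv.Perm.mul_apply, ih, ih']
    | inv g _ ih =>
      intro s
      obtain ⟨t, rfl⟩ := g.surjective s
      rw [show g⁻¹ (g t) = t from g.symm_apply_apply _, ih]
  set s₀ := State.mk p m h γ (0, 0, 0) with hs₀
  have horb : MulAction.orbit H s₀ = Set.range F := by
    apply Set.Subset.antisymm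
    · rintro s ⟨g, rfl⟩
      have h4 := hinv g g.2 s₀
      rw [hs₀, hκ] at h4
      change κ ((g : Equiv.Perm _) s₀) = _ at h4
      change (g : Equiv.Perm _) s₀ ∈ _
      obtain ⟨⟨i, k, j⟩, hx⟩ := hsurj ((g : Equiv.Perm _) s₀)
      rw [← hx, hκ] at h4
      simp only [Nat.cast_zero] at h4
      obtain ⟨k', rfl⟩ := (ZMod.natCast_eq_zero_iff _ _).1 h4
      rw [← hx]
      refine ⟨(⟨((i : ZMod (p ^ (m + 2 * h))) - j + (j % p ^ (m + h) : ℕ)).val, ZMod.val_lt _⟩,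
        ⟨k' % p ^ (m + h), Nat.mod_lt _ (pow_pos hp.pos _)⟩,
        ⟨j % p ^ (m + h), Nat.mod_lt _ (pow_pos hp.pos _)⟩), ?_⟩
      simp only [F, State.mk, Prod.mk.injEq]
      refine ⟨?_, ?_, ZMod.natCast_mod _ _⟩
      · rw [ZMod.natCast_zmod_val, add_sub_cancel_right]
      · rw [ZMod.natCast_eq_natCast_iff]
        exact (Nat.mod_modEq _ _).mul_left' _
    · rintro s ⟨⟨i, k, j⟩, rfl⟩
      -- Act by X first: as long as j = 0 and k = 0, it only raises i by 1. Then V^γ raises k by γ,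
      -- and finally Y sets j.
      refine ⟨⟨Y ^ (j : ℕ) * (V ^ γ) ^ (k : ℕ) * X ^ (i : ℕ), H.mul_mem (H.mul_mem
        (H.pow_mem hYH _) (H.pow_mem hVH _)) (H.pow_mem hXH _)⟩, ?_⟩
      change (Y ^ (j : ℕ) * (V ^ γ) ^ (k : ℕ) * X ^ (i : ℕ)) s₀ = _
      have hgeo0 : ∀ t, (geoN (α ^ γ))^[t] 0 = 0 := fun t =>
        Function.iterate_fixed (by simp [geoN]) t
      have horb0 : ∀ t, orbSum (α ^ γ) 0 t = 0 := fun t => by simp [orbSum, hgeo0]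
      rw [← pow_mul, Equiv.Perm.mul_apply, Equiv.Perm.mul_apply, hs₀, perm_pow_apply hX,
        perm_pow_apply hV, perm_pow_apply hY, stepX_iterate, stepV_iterate, stepY_iterate]
      simp [F, hgeo0, horb0]
  have h5 : Nat.card (MulAction.orbit H s₀) = p ^ (3 * m + 4 * h) := by
    rw [horb, Nat.card_range_of_injective hF]
    simp only [Nat.card_prod, Nat.card_fin]
    ring
  have h6 := MulAction.index_stabilizer H s₀
  rw [← Nat.card_coe_set_eq, h5] at h6
  rw [← h6]
  exact Subgroup.index_dvd_card _

/-- A finite group in which the Wamsley relations hold and the first two generators generate a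
large subgroup. -/
theorem exists_model {p m h γ : ℕ} {α : ℤ} (hp : p.Prime) (hodd : Odd p) (hh : 0 < h)
    (hhm : h ≤ m) (hγ : 0 < γ) (hα : (p : ℤ) ^ h ∣ α - 1) (hr : (p : ℤ) ^ m ∣ α ^ γ - 1) :
    ∃ X Y Z : Equiv.Perm (State p m h γ), Z⁻¹ * X * Z = X ^ α ∧ Z * Y * Z⁻¹ = Y ^ α ∧
      X * Y = Y * X * Z ^ γ ∧ p ^ (3 * m + 4 * h) ∣ Nat.card (Subgroup.closure {X, Y}) := by
  have : NeZero (p ^ (m + 2 * h)) := ⟨(pow_pos hp.pos _).ne'⟩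
  have : NeZero (p ^ (m + h)) := ⟨(pow_pos hp.pos _).ne'⟩
  have : NeZero (γ * p ^ (m + h)) := ⟨(mul_pos hγ (pow_pos hp.pos _)).ne'⟩
  -- Reducing α modulo M gives a natural number with the same congruences, because of the power of
  -- p, and with the same powers of permutations, because of the group order.
  set M : ℕ := p ^ (m + 2 * h) * Nat.card (Equiv.Perm (State p m h γ)) with hM
  have hMpos : (0 : ℤ) < M := by
    exact_mod_cast mul_pos (pow_pos hp.pos _) Nat.card_pos
  obtain ⟨α', hα'⟩ : ∃ α' : ℕ, (α' : ℤ) = α % M :=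
    ⟨(α % M).toNat, Int.toNat_of_nonneg (Int.emod_nonneg _ hMpos.ne')⟩
  have hdvd : (M : ℤ) ∣ α' - α := by
    rw [hα', ← dvd_neg, neg_sub]; exact Int.dvd_self_sub_emod
  have hpM : (p : ℤ) ^ (m + 2 * h) ∣ α' - α :=
    Dvd.dvd.trans ⟨Nat.card (Equiv.Perm (State p m h γ)), by rw [hM]; push_cast; ring⟩ hdvd
  have h1 : (p : ℤ) ^ h ∣ (α' : ℤ) - 1 :=
    (dvd_add ((pow_dvd_pow _ (by omega)).trans hpM) hα).trans (dvd_of_eq (by ring))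
  have h2 : (p : ℤ) ^ m ∣ ((α' ^ γ : ℕ) : ℤ) - 1 := by
    push_cast
    have := ((pow_dvd_pow (p : ℤ) (by omega : m ≤ m + 2 * h)).trans hpM).trans
      (sub_dvd_pow_sub_pow (α' : ℤ) α γ)
    exact (dvd_add this hr).trans (dvd_of_eq (by ring))
  obtain ⟨X, Y, Z, e1, e2, e3, e4⟩ := exists_model_nat hp hodd hh hhm hγ h1 h2
  have hpow : ∀ W : Equiv.Perm (State p m h γ), W ^ α' = W ^ α := by
    intro W
    obtain ⟨w, hw⟩ := hdvd
    rw [← zpow_natCast, sub_eq_iff_eq_add.1 hw, zpow_add, zpow_mul, zpow_natCast, hM, mul_comm (p ^ _),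
      pow_mul, pow_card_eq_one', one_pow, one_zpow, one_mul]
  exact ⟨X, Y, Z, by rw [e1, hpow], by rw [e2, hpow], e3, e4⟩

/-! ### Power relations in p-groups: the upper bound -/

section
variable {T : Type*} [Group T] {r : ℤ} {a b c : T}

/-- If conjugation by `z⁻¹` raises `x` to a power, so does conjugation by `z`. -/
theorem exists_conj_eq_zpow {x z : T} {s : ℤ} (hx : IsOfFinOrder x) (h : z⁻¹ * x * z = x ^ s) :
    ∃ β : ℤ, z * x * z⁻¹ = x ^ β := by
  obtain ⟨β, t, ht⟩ := coprime_of_conj (z := z⁻¹) (s := s) hx (by simpa using h)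
  refine ⟨β, ?_⟩
  have h1 : x = (x ^ s) ^ β := by
    rw [← zpow_mul, show s * β = 1 - orderOf x * t by linear_combination ht, zpow_sub, zpow_mul,
      zpow_natCast, pow_orderOf_eq_one, one_zpow, zpow_one, inv_one, mul_one]
  calc z * x * z⁻¹ = z * (x ^ s) ^ β * z⁻¹ := by rw [← h1]
    _ = (z * (z⁻¹ * x * z) * z⁻¹) ^ β := by rw [h, conj_zpow]
    _ = x ^ β := by group

theorem zpow_eq_one_of_coprime {p e : ℕ} (hp : p.Prime) {x : T} (hx : x ^ p ^ e = 1) {N κ : ℤ}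
    (hκ : ¬ (p : ℤ) ∣ κ) (h : x ^ (N * κ) = 1) : x ^ N = 1 := by
  have hco : IsCoprime κ ((p : ℤ) ^ e) :=
    (((Prime.coprime_iff_not_dvd (Nat.prime_iff_prime_int.1 hp)).2 hκ).symm).pow_right
  obtain ⟨s, t, ht⟩ := hco
  have : N = (N * κ) * s + ((p ^ e : ℕ) : ℤ) * (t * N) := by
    push_cast; linear_combination -N * ht
  rw [this, zpow_add, zpow_mul, h, one_zpow, one_mul, zpow_mul, zpow_natCast, hx, one_zpow]

theorem isOfFinOrder_of_pow_prime_pow {p e : ℕ} (hp : p.Prime) {x : T} (hx : x ^ p ^ e = 1) :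
    IsOfFinOrder x := isOfFinOrder_iff_pow_eq_one.2 ⟨_, pow_pos hp.pos _, hx⟩

namespace MacRel

section
variable {p m h e : ℕ} {α u v : ℤ}

/-- The link relation with a' = z a z⁻¹: one has a'^α = a, and [a', b^α] is the conjugate of c by z,
that is c. The exponent α is replaced by a natural s congruent to it modulo p^(e+h+1), which
preserves both the e-torsion powers, that is the powers of elements killed by p^e, and the valuation
h of s - 1. -/
theorem exists_pow_eq (hp : p.Prime) (hodd : Odd p) (hh : 0 < h) (hhm : h ≤ m)
    (hr : r = 1 + p ^ m * u) (hu : ¬ (p : ℤ) ∣ u) (hα : α = 1 + p ^ h * v) (hv : ¬ (p : ℤ) ∣ v)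
    (hp3 : p = 3 → ¬ r ≡ 7 [ZMOD 9]) (H : MacRel r a b c) {z : T}
    (hza : z⁻¹ * a * z = a ^ α) (hzb : z * b * z⁻¹ = b ^ α) (hzc : Commute z c)
    (ha : a ^ p ^ e = 1) (hb : b ^ p ^ e = 1) :
    ∃ (s : ℕ) (κ : ℤ), ¬ (p : ℤ) ∣ κ ∧ c ^ s * (z * a * z⁻¹) ^ ((p : ℤ) ^ (m + h) * κ) * (c ^ s)⁻¹
      = b ^ (-((p : ℤ) ^ (m + h) * κ)) ∧
      ∃ θ : ℤ, b ^ p ^ (m + h) = a ^ (((p ^ (m + h) : ℕ) : ℤ) * θ) := by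
  have hpz : Prime (p : ℤ) := Nat.prime_iff_prime_int.1 hp
  have hMpos : (0 : ℤ) < (p : ℤ) ^ (e + h + 1) := pow_pos (by exact_mod_cast hp.pos) _
  obtain ⟨s, hs⟩ : ∃ s : ℕ, (s : ℤ) = α % (p : ℤ) ^ (e + h + 1) :=
    ⟨_, Int.toNat_of_nonneg (Int.emod_nonneg _ hMpos.ne')⟩
  obtain ⟨w, hw⟩ : (p : ℤ) ^ (e + h + 1) ∣ α - s := by rw [hs]; exact Int.dvd_self_sub_emod
  have hpow : ∀ x : T, x ^ p ^ e = 1 → x ^ s = x ^ α := by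
    intro x hx
    have : α = s + ((p ^ e : ℕ) : ℤ) * (p ^ (h + 1) * w) := by
      push_cast; rw [sub_eq_iff_eq_add.1 hw]; ring
    rw [this, zpow_add, zpow_mul, zpow_natCast, zpow_natCast, hx, one_zpow, mul_one]
  have hs1 : (s : ℤ) = 1 + p ^ h * (v - p ^ (e + 1) * w) := by
    rw [hα] at hw; linear_combination -hw
  obtain ⟨κ, hκ, hκp⟩ := linkExp_valuation hp hodd hh hhm hr hu hs1 (by
    intro hd
    exact hv (by
      have := dvd_add hd (dvd_mul_right (p : ℤ) (p ^ e * w))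
      exact this.trans (dvd_of_eq (by ring)))) hp3
  have hlink := H.link (a' := z * a * z⁻¹) (s := s)
    (by rw [conj_pow, hpow a ha, ← hza]; group)
    (by
      rw [hpow b hb, ← hzb]
      calc _ = z * (a * b) * z⁻¹ := by group
        _ = z * b * a * (c * z⁻¹) := by rw [H.swap]; group
        _ = _ := by rw [← hzc.inv_left.eq]; group)
    (by
      rw [conj_zpow, ← H.conj_a]
      calc _ = c⁻¹ * z * a * (z⁻¹ * c) := by group
        _ = z * c⁻¹ * a * (c * z⁻¹) := by rw [hzc.inv_right.eq, hzc.inv_left.eq]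
        _ = _ := by group)
  rw [hκ] at hlink
  refine ⟨s, κ, hκp, hlink, ?_⟩
  have hfa := isOfFinOrder_of_pow_prime_pow hp ha
  obtain ⟨β, hβ⟩ := exists_conj_eq_zpow hfa hza
  obtain ⟨δ, hδ⟩ := exists_conj_eq_zpow (z := c ^ s) (s := r ^ s) hfa
    (by have := H.conj_a_pow s 1; rwa [mul_one, zpow_one] at this)
  have h1 : b ^ (-((p : ℤ) ^ (m + h) * κ)) = a ^ (δ * (β * ((p : ℤ) ^ (m + h) * κ))) := by
    rw [← hlink, hβ, ← zpow_mul, ← conj_zpow, hδ, ← zpow_mul]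
  have hco : IsCoprime κ ((p : ℤ) ^ e) :=
    (((Prime.coprime_iff_not_dvd hpz).2 hκp).symm).pow_right
  obtain ⟨x, t, ht⟩ := hco
  refine ⟨-(δ * β * κ * x), ?_⟩
  have h2 : ((p ^ (m + h) : ℕ) : ℤ) = (-((p : ℤ) ^ (m + h) * κ)) * (-x)
      + ((p ^ e : ℕ) : ℤ) * (t * p ^ (m + h)) := by
    push_cast; linear_combination -(p : ℤ) ^ (m + h) * ht
  have h3 : b ^ (((p ^ e : ℕ) : ℤ) * (t * p ^ (m + h))) = 1 := by
    rw [zpow_mul, zpow_natCast, hb, one_zpow]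
  rw [← zpow_natCast b]
  nth_rewrite 1 [h2]
  rw [zpow_add, h3, mul_one, zpow_mul, h1, ← zpow_mul]
  congr 1
  push_cast
  ring

/-- Being a power of both a and b, a^N is raised to the power α by conjugation with z and also with
z⁻¹. Hence its (α² - 1)-th power is trivial, and α² - 1 is p^h times a number prime to the odd prime
p. -/
theorem zpow_sub_one_eq_one (hp : p.Prime) (hodd : Odd p) (hh : 0 < h)
    (hα : α = 1 + p ^ h * v) (hv : ¬ (p : ℤ) ∣ v) {z : T}
    (hza : z⁻¹ * a * z = a ^ α) (hzb : z * b * z⁻¹ = b ^ α)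
    (ha : a ^ p ^ e = 1) {N : ℕ} {θ : ℤ} (hab : a ^ N = b ^ ((N : ℤ) * θ)) :
    a ^ (N * p ^ h) = 1 := by
  have hpz : Prime (p : ℤ) := Nat.prime_iff_prime_int.1 hp
  have h1 : z * a ^ N * z⁻¹ = (a ^ N) ^ α := by
    rw [hab, ← conj_zpow, hzb, ← zpow_mul, ← zpow_mul, mul_comm]
  have h2 : z⁻¹ * a ^ N * z = (a ^ N) ^ α := by
    have := conj_inv_pow_zpow hza 1 N
    simp only [pow_one, zpow_natCast] at this
    rw [this, mul_comm, zpow_mul, zpow_natCast]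
  have h3 : a ^ N = (a ^ N) ^ (α * α) := by
    calc a ^ N = z⁻¹ * (z * a ^ N * z⁻¹) * z := by group
      _ = (z⁻¹ * a ^ N * z) ^ α := by
          rw [h1]
          have := conj_zpow (a := z⁻¹) (b := a ^ N) (i := α)
          rw [inv_inv] at this; exact this.symm
      _ = _ := by rw [h2, ← zpow_mul]
  have h4 : (a ^ N) ^ ((p : ℤ) ^ h * (v * (2 + p ^ h * v))) = 1 := by
    have : (p : ℤ) ^ h * (v * (2 + p ^ h * v)) = α * α - 1 := by rw [hα]; ring
    rw [this, zpow_sub, ← h3, zpow_one, mul_inv_cancel]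
  have h5 := zpow_eq_one_of_coprime (e := e) hp
    (by rw [← pow_mul, mul_comm, pow_mul, ha, one_pow]) (by
      intro hd
      rcases hpz.dvd_or_dvd hd with hd | hd
      · exact hv hd
      · have h2 : (p : ℤ) ∣ 2 := (dvd_add_left ((dvd_pow_self _ hh.ne').mul_right _)).1 hd
        have := (Nat.prime_dvd_prime_iff_eq hp Nat.prime_two).1 (by exact_mod_cast h2)
        subst this; exact absurd hodd (by decide)) h4
  rw [pow_mul]
  exact_mod_cast h5

/-- The relations that hold in a `p`-group with the Wamsley relations. -/
theorem pow_relations (hp : p.Prime) (hodd : Odd p) (hh : 0 < h) (hhm : h ≤ m)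
    (hr : r = 1 + p ^ m * u) (hu : ¬ (p : ℤ) ∣ u) (hα : α = 1 + p ^ h * v) (hv : ¬ (p : ℤ) ∣ v)
    (hp3 : p = 3 → ¬ r ≡ 7 [ZMOD 9]) (H : MacRel r a b c) {z : T}
    (hza : z⁻¹ * a * z = a ^ α) (hzb : z * b * z⁻¹ = b ^ α) (hzc : Commute z c)
    (ha : a ^ p ^ e = 1) (hb : b ^ p ^ e = 1) :
    a ^ p ^ (m + 2 * h) = 1 ∧ b ^ p ^ (m + 2 * h) = 1 ∧
      a ^ p ^ (m + h) * b ^ p ^ (m + h) = 1 ∧ c ^ p ^ (m + h) = 1 := by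
  -- Using the statement for (a, b, z) and for (b, a, z⁻¹) shows that each of a^(p^(m+h)),
  -- b^(p^(m+h)) is a power of the other generator, so both commute with a and b.
  obtain ⟨s, κ, hκ, hlink, θ, hθ⟩ :=
    H.exists_pow_eq hp hodd hh hhm hr hu hα hv hp3 hza hzb hzc ha hb
  obtain ⟨_, _, _, _, θ', hθ'⟩ :=
    H.symm.exists_pow_eq hp hodd hh hhm hr hu hα hv hp3 (z := z⁻¹) (by simpa using hzb)
      (by simpa using hza) hzc.inv_inv hb ha
  have ha1 := zpow_sub_one_eq_one hp hodd hh hα hv hza hzb ha hθ'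
  have hb1 := zpow_sub_one_eq_one hp hodd hh hα hv (z := z⁻¹) (by simpa using hzb)
      (by simpa using hza) hb hθ
  rw [← pow_add, show m + h + h = m + 2 * h by ring] at ha1 hb1
  have hca : Commute (a ^ p ^ (m + h)) b := by rw [hθ']; exact (Commute.refl b).zpow_left _
  have hcb : Commute (b ^ p ^ (m + h)) a := by rw [hθ]; exact (Commute.refl a).zpow_left _
  have hcc : Commute (a ^ p ^ (m + h)) c := by
    have haa : Commute (a ^ p ^ (m + h)) a := (Commute.refl a).pow_left _
    rw [H.c_eq]; unfold comm
    exact ((haa.inv_right.mul_right hca.inv_right).mul_right haa).mul_right hca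
  refine ⟨ha1, hb1, ?_, ?_⟩
  -- Since a^(p^(m+2h)) = 1, z centralizes a^P, and so does c. Thus the conjugations in the link
  -- relation disappear, leaving (a^P b^P)^κ = 1 with κ prime to p.
  · set P : ℕ := p ^ (m + h) with hP
    have hPz : (p : ℤ) ^ (m + h) = (P : ℤ) := by rw [hP]; push_cast; rfl
    rw [hPz, zpow_mul, zpow_natCast, conj_pow] at hlink
    have h1 : z * a ^ P * z⁻¹ = a ^ P := by
      have h2 : z⁻¹ * a ^ P * z = a ^ P := by
        have := conj_inv_pow_zpow hza 1 P
        simp only [pow_one, zpow_natCast] at this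
        rw [this, hα, show (1 + (p : ℤ) ^ h * v) * P = P + ((p ^ (m + 2 * h) : ℕ) : ℤ) * v by
          rw [hP]; push_cast; ring, zpow_add, zpow_mul, zpow_natCast, zpow_natCast, ha1, one_zpow,
          mul_one]
      calc z * a ^ P * z⁻¹ = z * (z⁻¹ * a ^ P * z) * z⁻¹ := by rw [h2]
        _ = a ^ P := by group
    have h2 : (a ^ P) ^ κ = (b ^ P) ^ (-κ) := by
      rw [h1, ((hcc.symm.pow_left s).zpow_right κ).eq, mul_inv_cancel_right] at hlink
      rw [hlink, ← mul_neg, zpow_mul, zpow_natCast]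
    have hcomm : Commute (a ^ P) (b ^ P) := hca.pow_right _
    have h3 : (a ^ P * b ^ P) ^ ((1 : ℤ) * κ) = 1 := by
      rw [one_mul, hcomm.mul_zpow, h2, ← zpow_add, neg_add_cancel, zpow_zero]
    have h4 := zpow_eq_one_of_coprime (e := e) hp (by
      rw [hcomm.mul_pow, ← pow_mul, ← pow_mul, mul_comm P, pow_mul, pow_mul, ha, hb]
      simp) hκ h3
    simpa using h4
  -- As b^P commutes with a, the formula for its conjugate by a reads c^P = b^(geo r P - P), and
  -- that exponent is divisible by p^(m+2h).
  · have h1 := H.conj_b_by_a (p ^ (m + h))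
    rw [mul_assoc, hcb.eq, inv_mul_cancel_left] at h1
    have h2 : c ^ p ^ (m + h) = b ^ (geo r (p ^ (m + h)) - (p ^ (m + h) : ℕ)) := by
      rw [zpow_sub, zpow_natCast, eq_mul_inv_iff_mul_eq, h1]; group
    obtain ⟨w, hw⟩ := (pow_dvd_pow (p : ℤ) (by omega : m + 2 * h ≤ m + (m + h))).trans
      (geo_close (r := r) hodd (by omega : 0 < m) ⟨u, by rw [hr]; ring⟩ (dvd_refl (p ^ (m + h))))
    rw [h2, hw, zpow_mul]
    have : b ^ ((p : ℤ) ^ (m + 2 * h)) = 1 := by exact_mod_cast hb1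
    rw [this, one_zpow]

end

/-- Bounded normal form from the power relations. -/
theorem exists_bounded_normal_form {N P : ℕ} (hP0 : 0 < P) (hN0 : 0 < N) (H : MacRel r a b c)
    (ha : a ^ N = 1) (hab : a ^ P * b ^ P = 1) (hc : c ^ P = 1) {g : T}
    (hg : g ∈ Subgroup.closure {a, b}) :
    ∃ x : Fin N × Fin P × Fin P, g = a ^ (x.1 : ℕ) * b ^ (x.2.1 : ℕ) * c ^ (x.2.2 : ℕ) := by
  have hbP : b ^ P = (a ^ P)⁻¹ := (inv_eq_of_mul_eq_one_right hab).symm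
  have hfa : IsOfFinOrder a := isOfFinOrder_iff_pow_eq_one.2 ⟨N, hN0, ha⟩
  have hfb : IsOfFinOrder b := isOfFinOrder_iff_pow_eq_one.2 ⟨P * N, mul_pos hP0 hN0, by
    rw [pow_mul, hbP, inv_pow, ← pow_mul, mul_comm, pow_mul, ha, one_pow, inv_one]⟩
  have hfc : IsOfFinOrder c := isOfFinOrder_iff_pow_eq_one.2 ⟨P, hP0, hc⟩
  obtain ⟨i, j, k, rfl⟩ := H.exists_normal_form hfa hfb hfc hg
  have hN : (0 : ℤ) < N := by exact_mod_cast hN0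
  have hi := Int.emod_nonneg ((i : ℤ) - P * (j / P : ℕ)) hN.ne'
  have hi' := Int.emod_lt_of_pos ((i : ℤ) - P * (j / P : ℕ)) hN
  refine ⟨(⟨(((i : ℤ) - P * (j / P : ℕ)) % N).toNat, by omega⟩, ⟨j % P, Nat.mod_lt _ hP0⟩,
    ⟨k % P, Nat.mod_lt _ hP0⟩), ?_⟩
  simp only
  have e1 : c ^ k = c ^ (k % P) := by
    conv_lhs => rw [← Nat.mod_add_div k P, pow_add, pow_mul, hc, one_pow, mul_one]
  have e2 : b ^ j = (a ^ (P * (j / P)))⁻¹ * b ^ (j % P) := by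
    conv_lhs => rw [← Nat.div_add_mod j P, pow_add, pow_mul, hbP, inv_pow, ← pow_mul]
  have e3 : a ^ (((i : ℤ) - P * (j / P : ℕ)) % N).toNat = a ^ i * (a ^ (P * (j / P)))⁻¹ := by
    rw [← zpow_natCast a, Int.toNat_of_nonneg hi]
    have : a ^ (((i : ℤ) - P * (j / P : ℕ)) % N) = a ^ ((i : ℤ) - P * (j / P : ℕ)) := by
      conv_rhs => rw [← Int.emod_add_mul_ediv ((i : ℤ) - P * (j / P : ℕ)) N, zpow_add, zpow_mul,
        zpow_natCast, ha, one_zpow, mul_one]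
    rw [this, zpow_sub, zpow_natCast]
    congr 2
    exact_mod_cast rfl
  rw [e3, e1, e2]; group

end MacRel
end

/-! ### Uniqueness of normal forms and tests for the upper central series -/

section
variable {T : Type*} [Group T] {r : ℤ} {a b c : T}

/-- The normal form is unique when the group is as large as possible. -/
theorem MacRel.normal_form_eq_one_iff {N P : ℕ} (hP0 : 0 < P) (hN0 : 0 < N) (H : MacRel r a b c)
    (ha : a ^ N = 1) (hab : a ^ P * b ^ P = 1) (hc : c ^ P = 1)
    (hcard : Nat.card (Subgroup.closure {a, b}) = N * P * P) (i j k : ℤ) :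
    a ^ i * b ^ j * c ^ k = 1 ↔ (N : ℤ) ∣ i - j ∧ (P : ℤ) ∣ j ∧ (P : ℤ) ∣ k := by
  have hbP : b ^ P = (a ^ P)⁻¹ := (inv_eq_of_mul_eq_one_right hab).symm
  have hbPz : ∀ t : ℤ, b ^ ((P : ℤ) * t) = a ^ (-((P : ℤ) * t)) := fun t => by
    rw [zpow_mul, zpow_natCast, hbP, inv_zpow, ← zpow_natCast, ← zpow_mul, zpow_neg]
  have haNz : ∀ t : ℤ, a ^ ((N : ℤ) * t) = 1 := fun t => by
    rw [zpow_mul, zpow_natCast, ha, one_zpow]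
  have hcPz : ∀ t : ℤ, c ^ ((P : ℤ) * t) = 1 := fun t => by
    rw [zpow_mul, zpow_natCast, hc, one_zpow]
  constructor
  · intro h
    have ha_mem : a ∈ Subgroup.closure {a, b} := Subgroup.subset_closure (by simp)
    have hb_mem : b ∈ Subgroup.closure {a, b} := Subgroup.subset_closure (by simp)
    have hc_mem : c ∈ Subgroup.closure {a, b} := by
      rw [H.c_eq]; unfold comm
      exact mul_mem (mul_mem (mul_mem (inv_mem ha_mem) (inv_mem hb_mem)) ha_mem) hb_mem
    let F : Fin N × Fin P × Fin P → Subgroup.closure {a, b} := fun x =>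
      ⟨a ^ (x.1 : ℕ) * b ^ (x.2.1 : ℕ) * c ^ (x.2.2 : ℕ),
        mul_mem (mul_mem (pow_mem ha_mem _) (pow_mem hb_mem _)) (pow_mem hc_mem _)⟩
    have hsurj : Function.Surjective F := by
      rintro ⟨g, hg⟩
      obtain ⟨x, hx⟩ := H.exists_bounded_normal_form hP0 hN0 ha hab hc hg
      exact ⟨x, Subtype.ext hx.symm⟩
    have hinj : Function.Injective F := by
      refine ((Nat.bijective_iff_surjective_and_card F).2 ⟨hsurj, ?_⟩).1
      rw [hcard]; simp [mul_assoc]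
    have hPz : (0 : ℤ) < P := by exact_mod_cast hP0
    have hNz : (0 : ℤ) < N := by exact_mod_cast hN0
    -- Reducing j modulo P moves a multiple of P from b to a, with opposite sign, because b^P =
    -- a^(-P).
    set i' := i - (j - j % P) with hi'
    have h1 := Int.emod_nonneg i' hNz.ne'
    have h2 := Int.emod_lt_of_pos i' hNz
    have h3 := Int.emod_nonneg j hPz.ne'
    have h4 := Int.emod_lt_of_pos j hPz
    have h5 := Int.emod_nonneg k hPz.ne'
    have h6 := Int.emod_lt_of_pos k hPz
    have hF : F (⟨(i' % N).toNat, by omega⟩, ⟨(j % P).toNat, by omega⟩, ⟨(k % P).toNat, by omega⟩)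
        = F (⟨0, hN0⟩, ⟨0, hP0⟩, ⟨0, hP0⟩) := by
      apply Subtype.ext
      simp only [F, pow_zero, mul_one]
      rw [← zpow_natCast a, ← zpow_natCast b, ← zpow_natCast c, Int.toNat_of_nonneg h1,
        Int.toNat_of_nonneg h3, Int.toNat_of_nonneg h5, ← h]
      have e1 : a ^ (i' % N) = a ^ i' := by
        conv_rhs => rw [← Int.emod_add_mul_ediv i' N, zpow_add, haNz, mul_one]
      have e2 : c ^ (k % P) = c ^ k := by
        conv_rhs => rw [← Int.emod_add_mul_ediv k P, zpow_add, hcPz, mul_one]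
      have e3 : b ^ j = a ^ (-(j - j % P)) * b ^ (j % P) := by
        conv_lhs => rw [← Int.mul_ediv_add_emod j P, zpow_add, hbPz]
        congr 2
        have := Int.mul_ediv_add_emod j P
        linarith
      rw [e1, e2, e3, hi', ← mul_assoc (a ^ i), ← zpow_add, sub_eq_add_neg]
    have := hinj hF
    simp only [Prod.mk.injEq, Fin.mk.injEq] at this
    obtain ⟨t1, t2, t3⟩ := this
    have hj0 : j % P = 0 := by omega
    refine ⟨?_, Int.dvd_of_emod_eq_zero hj0, Int.dvd_of_emod_eq_zero (by omega)⟩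
    rw [hj0, sub_zero] at hi'
    rw [← hi']
    exact Int.dvd_of_emod_eq_zero (by omega)
  · rintro ⟨⟨x, hx⟩, ⟨y, rfl⟩, ⟨z, rfl⟩⟩
    rw [hbPz, hcPz, mul_one, ← zpow_add, ← sub_eq_add_neg, hx, haNz]

theorem commute_mk_iff {K : Subgroup T} [K.Normal] {x y : T} :
    Commute (QuotientGroup.mk x : T ⧸ K) (QuotientGroup.mk y) ↔ x⁻¹ * y⁻¹ * x * y ∈ K := by
  rw [commute_iff_eq, eq_comm, ← QuotientGroup.mk_mul, ← QuotientGroup.mk_mul, QuotientGroup.eq]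
  simp [mul_assoc]

/-- Membership in the next term of the upper central series can be tested on generators. -/
theorem mem_upperCentralSeries_succ_of_generators (hgen : Subgroup.closure {a, b} = ⊤) {n : ℕ}
    {x : T} (ha : x⁻¹ * a⁻¹ * x * a ∈ Subgroup.upperCentralSeries T n)
    (hb : x⁻¹ * b⁻¹ * x * b ∈ Subgroup.upperCentralSeries T n) :
    x ∈ Subgroup.upperCentralSeries T (n + 1) := by
  change x ∈ Subgroup.upperCentralSeriesStep (Subgroup.upperCentralSeries T n)
  rw [Subgroup.upperCentralSeriesStep_eq_comap_center, Subgroup.mem_comap]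
  refine mem_center_of_generators (a := QuotientGroup.mk' (Subgroup.upperCentralSeries T n) a)
    (b := QuotientGroup.mk' (Subgroup.upperCentralSeries T n) b) ?_ (commute_mk_iff.2 ha)
    (commute_mk_iff.2 hb)
  have := congrArg (Subgroup.map (QuotientGroup.mk' (Subgroup.upperCentralSeries T n))) hgen
  rwa [MonoidHom.map_closure, Set.image_pair,
    Subgroup.map_top_of_surjective _ (QuotientGroup.mk'_surjective _)] at this

theorem commutator_mem_of_mem_succ {n : ℕ} {x : T}
    (hx : x ∈ Subgroup.upperCentralSeries T (n + 1)) (y : T) :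
    x⁻¹ * y⁻¹ * x * y ∈ Subgroup.upperCentralSeries T n := by
  change x ∈ Subgroup.upperCentralSeriesStep (Subgroup.upperCentralSeries T n) at hx
  rw [Subgroup.upperCentralSeriesStep_eq_comap_center, Subgroup.mem_comap,
    Subgroup.mem_center_iff] at hx
  exact commute_mk_iff.1 (hx (QuotientGroup.mk y)).symm

theorem mem_rotate {K : Subgroup T} [hK : K.Normal] {x y : T} (h : x * y ∈ K) : y * x ∈ K :=
  (hK.mem_comm_iff).1 h

/-- Conjugates of an element by powers of another one, in a class two situation. -/
theorem conj_pow_class_two {x y z z₁ z₂ : T} (h1 : y⁻¹ * x * y = x * z * z₁)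
    (h2 : y⁻¹ * z * y = z * z₂) (hz1 : z₁ ∈ Subgroup.center T) (hz2 : z₂ ∈ Subgroup.center T)
    (t : ℕ) : (y ^ t)⁻¹ * x * y ^ t = x * z ^ t * z₁ ^ t * z₂ ^ t.choose 2 := by
  rw [Subgroup.mem_center_iff] at hz1 hz2
  have c1 : ∀ g, Commute z₁ g := fun g => (hz1 g).symm
  have c2 : ∀ g, Commute z₂ g := fun g => (hz2 g).symm
  induction t with
  | zero => simp
  | succ t ih =>
    have e1 : y⁻¹ * z ^ t * y = z ^ t * z₂ ^ t := by
      have := conj_pow (a := y⁻¹) (b := z) (i := t)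
      rw [inv_inv] at this
      rw [← this, h2, ((c2 z).symm).mul_pow]
    calc (y ^ (t + 1))⁻¹ * x * y ^ (t + 1) = y⁻¹ * ((y ^ t)⁻¹ * x * y ^ t) * y := by
          rw [pow_succ]; group
      _ = (y⁻¹ * x * y) * (y⁻¹ * z ^ t * y) * (y⁻¹ * z₁ ^ t * y) * (y⁻¹ * z₂ ^ t.choose 2 * y) := by
          rw [ih]; group
      _ = x * z * z₁ * (z ^ t * z₂ ^ t) * z₁ ^ t * z₂ ^ t.choose 2 := by
          rw [h1, e1, mul_assoc y⁻¹ (z₁ ^ t) y, ((c1 y).pow_left t).eq, inv_mul_cancel_left,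
            mul_assoc y⁻¹ (z₂ ^ _) y, ((c2 y).pow_left _).eq, inv_mul_cancel_left]
      _ = x * z ^ (t + 1) * z₁ ^ (t + 1) * z₂ ^ (t + 1).choose 2 := by
          rw [Nat.choose_succ_succ' t 1, Nat.choose_one_right, pow_add z₂, pow_succ' z, pow_succ' z₁]
          have e2 : z₁ * (z ^ t * z₂ ^ t) = z ^ t * z₁ * z₂ ^ t := by
            rw [← mul_assoc, (c1 (z ^ t)).eq]
          have e3 : z₂ ^ t * z₁ ^ t = z₁ ^ t * z₂ ^ t := ((c2 (z₁ ^ t)).pow_left t).eq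
          simp only [mul_assoc]
          rw [← mul_assoc z₁ (z ^ t), (c1 (z ^ t)).eq, mul_assoc, ← mul_assoc (z₂ ^ t) (z₁ ^ t), e3]
          simp only [mul_assoc]

end

/-! ### Upper central series of the Sylow subgroup of the Macdonald group -/

/-- A `p`-group generated by `a`, `b` with the Macdonald relations and of the largest order. -/
structure MaxMac {J : Type*} [Group J] (p m : ℕ) (r u : ℤ) (a b c : J) : Prop where
  hp : p.Prime
  hodd : Odd p
  hm : 0 < m
  hr : r = 1 + p ^ m * u
  hu : ¬ (p : ℤ) ∣ u
  H : MacRel r a b c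
  gen : Subgroup.closure {a, b} = ⊤
  uniq : ∀ i j k : ℤ, a ^ i * b ^ j * c ^ k = 1 ↔
    (p : ℤ) ^ (3 * m) ∣ i - j ∧ (p : ℤ) ^ (2 * m) ∣ j ∧ (p : ℤ) ^ (2 * m) ∣ k
  nf : ∀ V : J, ∃ i j k : ℕ, V = a ^ i * b ^ j * c ^ k

namespace MaxMac

variable {J : Type*} [Group J] {p m : ℕ} {r u : ℤ} {a b c : J}

theorem zpow_a (M : MaxMac p m r u a b c) {i : ℤ} : a ^ i = 1 ↔ (p : ℤ) ^ (3 * m) ∣ i := by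
  simpa using M.uniq i 0 0

theorem zpow_c (M : MaxMac p m r u a b c) {i : ℤ} : c ^ i = 1 ↔ (p : ℤ) ^ (2 * m) ∣ i := by
  simpa using M.uniq 0 0 i

theorem zpow_b_eq (M : MaxMac p m r u a b c) {j : ℤ} (hj : (p : ℤ) ^ (2 * m) ∣ j) :
    b ^ j = a ^ (-j) := by
  have := (M.uniq j j 0).2 ⟨by simp, hj, by simp⟩
  rw [zpow_zero, mul_one] at this
  rw [zpow_neg]; exact (inv_eq_of_mul_eq_one_right this).symm

theorem zpow_b_eq_one (M : MaxMac p m r u a b c) {j : ℤ} (hj : (p : ℤ) ^ (3 * m) ∣ j) :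
    b ^ j = 1 := by
  rw [M.zpow_b_eq ((pow_dvd_pow _ (by have := M.hm; omega)).trans hj), M.zpow_a, dvd_neg]
  exact hj

theorem pm_dvd (M : MaxMac p m r u a b c) : (p : ℤ) ^ m ∣ r - 1 := ⟨u, by rw [M.hr]; ring⟩

theorem zpow_a_mem_center (M : MaxMac p m r u a b c) {i : ℤ} (hi : (p : ℤ) ^ (2 * m) ∣ i) :
    a ^ i ∈ Subgroup.center J := by
  refine mem_center_of_generators M.gen ((Commute.refl a).zpow_left _) ?_
  have := M.zpow_b_eq ((dvd_neg).2 hi)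
  rw [neg_neg] at this
  rw [← this]; exact (Commute.refl b).zpow_left _

theorem zpow_b_mem_center (M : MaxMac p m r u a b c) {i : ℤ} (hi : (p : ℤ) ^ (2 * m) ∣ i) :
    b ^ i ∈ Subgroup.center J := by
  rw [M.zpow_b_eq hi]; exact M.zpow_a_mem_center ((dvd_neg).2 hi)

/-- The commutators of c^k with a and b are, up to inversion, the powers of a and b with exponent 1
- r^k. This is divisible by p^(2m) when p^m divides k, so they are central. -/
theorem c_pow_mem_two (M : MaxMac p m r u a b c) {k : ℕ} (hk : p ^ m ∣ k) :
    c ^ k ∈ Subgroup.upperCentralSeries J 2 := by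
  have hd : (p : ℤ) ^ (2 * m) ∣ 1 - r ^ k := by
    rw [← dvd_neg, neg_sub, two_mul]
    exact pow_sub_one_close M.hodd M.hm M.pm_dvd hk
  refine mem_upperCentralSeries_succ_of_generators M.gen ?_ ?_
  · rw [Subgroup.upperCentralSeries_one, mul_assoc, mul_assoc, ← mul_assoc a⁻¹, M.H.conj_c_by_a,
      inv_mul_cancel_left]
    exact M.zpow_a_mem_center hd
  · have h1 := M.H.symm.conj_c_by_a k
    have h2 := M.zpow_b_mem_center hd
    rw [Subgroup.upperCentralSeries_one, ← commute_mk_iff]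
    rw [← Commute.inv_left_iff, ← QuotientGroup.mk_inv, commute_mk_iff, mul_assoc, mul_assoc,
      ← mul_assoc b⁻¹, ← inv_pow, h1, inv_mul_cancel_left]
    exact h2

theorem center_le_two : Subgroup.center J ≤ Subgroup.upperCentralSeries J 2 := by
  rw [← Subgroup.upperCentralSeries_one]
  exact Subgroup.upperCentralSeries_mono J (by norm_num)

theorem geo_sub_dvd (M : MaxMac p m r u a b c) {i e : ℕ} (hi : p ^ e ∣ i) :
    (p : ℤ) ^ (m + e) ∣ geo r i - i := geo_close M.hodd M.hm M.pm_dvd hi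

/-- Up to conjugation the commutator of a^i with b is c^i a^(geo r i - i), where c^i lies in Z₂ and
the exponent of a is divisible by p^(2m). -/
theorem a_pow_mem_three (M : MaxMac p m r u a b c) {i : ℕ} (hi : p ^ m ∣ i) :
    a ^ i ∈ Subgroup.upperCentralSeries J 3 := by
  refine mem_upperCentralSeries_succ_of_generators M.gen ?_ ?_
  · have : (a ^ i)⁻¹ * a⁻¹ * a ^ i * a = 1 := by group
    rw [this]; exact one_mem _
  · rw [mul_assoc, mul_assoc, ← mul_assoc b⁻¹, M.H.conj_a_by_b]
    apply mem_rotate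
    rw [mul_assoc, ← zpow_natCast a, ← zpow_neg, ← zpow_add, ← sub_eq_add_neg]
    refine mul_mem (M.c_pow_mem_two hi) (center_le_two (M.zpow_a_mem_center ?_))
    rw [two_mul]; exact M.geo_sub_dvd hi

theorem b_pow_mem_three (M : MaxMac p m r u a b c) {i : ℕ} (hi : p ^ m ∣ i) :
    b ^ i ∈ Subgroup.upperCentralSeries J 3 := by
  refine mem_upperCentralSeries_succ_of_generators M.gen ?_ ?_
  · rw [mul_assoc, mul_assoc, ← mul_assoc a⁻¹, M.H.conj_b_by_a]
    apply mem_rotate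
    rw [mul_assoc, ← zpow_natCast b, ← zpow_neg, ← zpow_add, ← sub_eq_add_neg]
    refine mul_mem (inv_mem (M.c_pow_mem_two hi)) (center_le_two (M.zpow_b_mem_center ?_))
    rw [two_mul]; exact M.geo_sub_dvd hi
  · have : (b ^ i)⁻¹ * b⁻¹ * b ^ i * b = 1 := by group
    rw [this]; exact one_mem _

theorem exists_inv (M : MaxMac p m r u a b c) : ∃ r' t : ℤ, r * r' = 1 + p ^ (3 * m) * t := by
  have hco : IsCoprime r ((p : ℤ) ^ (3 * m)) := by
    refine IsCoprime.pow_right ?_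
    obtain ⟨w, hw⟩ := (dvd_pow_self (p : ℤ) M.hm.ne').trans M.pm_dvd
    exact ⟨1, -w, by linear_combination hw⟩
  obtain ⟨x, y, hxy⟩ := hco
  exact ⟨x, -y, by linear_combination hxy⟩

/-- Consequences of a commutator with `c` lying in a normal subgroup `K`. -/
theorem comm_c (M : MaxMac p m r u a b c) {K : Subgroup J} [K.Normal] {i j k : ℕ}
    (hV : (a ^ i * b ^ j * c ^ k)⁻¹ * c⁻¹ * (a ^ i * b ^ j * c ^ k) * c ∈ K) :
    ∃ w : ℤ, ¬ (p : ℤ) ∣ w ∧ a ^ ((p : ℤ) ^ m * (u * i)) * b ^ ((p : ℤ) ^ m * (w * j)) ∈ K := by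
  obtain ⟨r', t, ht⟩ := M.exists_inv
  have hpz : Prime (p : ℤ) := Nat.prime_iff_prime_int.1 M.hp
  have hb : c⁻¹ * b ^ j * c = b ^ (r' * j) := by
    have h1 := M.H.conj_b_pow 1 (r' * j)
    rw [pow_one, pow_one, ← mul_assoc, ht, add_mul, one_mul, zpow_add, mul_assoc ((p : ℤ) ^ _),
      M.zpow_b_eq_one (dvd_mul_right _ _), mul_one, zpow_natCast] at h1
    rw [← h1]; group
  have ha : c⁻¹ * a ^ i * c = a ^ (r * i) := by
    have h1 := M.H.conj_a_pow 1 i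
    simpa using h1
  have h1 : (a ^ i * b ^ j * c ^ k)⁻¹ * c⁻¹ * (a ^ i * b ^ j * c ^ k) * c
      = (c ^ k)⁻¹ * ((b ^ j)⁻¹ * (a ^ i)⁻¹ * a ^ (r * i) * b ^ (r' * j) * c ^ k) := by
    rw [← ha, ← hb]; group
  rw [h1] at hV
  have h2 := mem_rotate hV
  rw [mul_assoc, mul_inv_cancel, mul_one, mul_assoc, mul_assoc] at h2
  have h3 := mem_rotate h2
  refine ⟨-(r' * u) + p ^ (2 * m) * t, ?_, ?_⟩
  · intro hd
    rw [dvd_add_left ((dvd_pow_self _ (by have := M.hm; omega)).mul_right _), dvd_neg] at hd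
    rcases hpz.dvd_or_dvd hd with hd | hd
    · apply hpz.not_isUnit
      have h4 : (p : ℤ) ∣ 1 + p ^ (3 * m) * t := ht ▸ hd.mul_left r
      exact isUnit_of_dvd_one ((dvd_add_left ((dvd_pow_self _
        (by have := M.hm; omega)).mul_right _)).1 h4)
    · exact M.hu hd
  · convert h3 using 1
    have e1 : (a ^ i)⁻¹ * a ^ (r * i) = a ^ ((p : ℤ) ^ m * (u * i)) := by
      rw [← zpow_natCast, ← zpow_neg, ← zpow_add, M.hr]; congr 1; ring
    have e2 : b ^ (r' * j) * (b ^ j)⁻¹ = b ^ ((p : ℤ) ^ m * ((-(r' * u) + p ^ (2 * m) * t) * j)) := by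
      rw [← zpow_natCast, ← zpow_neg, ← zpow_add]
      congr 1
      have : r' = 1 + p ^ (3 * m) * t - p ^ m * u * r' := by
        rw [← ht, M.hr]; ring
      nth_rewrite 1 [this]
      ring
    rw [← e1, ← e2]; simp only [mul_assoc]

/-- Consequences of a commutator with `a` lying in a normal subgroup `K`. -/
theorem comm_a (M : MaxMac p m r u a b c) {K : Subgroup J} [K.Normal] {i j k : ℕ}
    (hV : (a ^ i * b ^ j * c ^ k)⁻¹ * a⁻¹ * (a ^ i * b ^ j * c ^ k) * a ∈ K) :
    ∃ w x : ℤ, ¬ (p : ℤ) ∣ w ∧ (∀ e, p ^ e ∣ j → (p : ℤ) ^ (m + e) ∣ x) ∧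
      a ^ ((1 - r ^ k) * w) * b ^ x * c ^ (-(j : ℤ)) ∈ K := by
  obtain ⟨r', t, ht⟩ := M.exists_inv
  have hpz : Prime (p : ℤ) := Nat.prime_iff_prime_int.1 M.hp
  have hr'1 : (p : ℤ) ^ m ∣ r' - 1 := by
    refine ⟨-(u * r') + p ^ (2 * m) * t, ?_⟩
    have : r' = 1 + p ^ (3 * m) * t - p ^ m * u * r' := by rw [← ht, M.hr]; ring
    nth_rewrite 1 [this]; ring
  have hpr' : ¬ (p : ℤ) ∣ r' := by
    intro hd
    apply hpz.not_isUnit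
    have h4 : (p : ℤ) ∣ 1 + p ^ (3 * m) * t := ht ▸ hd.mul_left r
    exact isUnit_of_dvd_one ((dvd_add_left ((dvd_pow_self _
      (by have := M.hm; omega)).mul_right _)).1 h4)
  have haP : ∀ y : ℤ, a ^ ((p : ℤ) ^ (3 * m) * y) = 1 := fun y => M.zpow_a.2 (dvd_mul_right _ _)
  have hac : c * a * c⁻¹ = a ^ r' := by
    have h1 := M.H.conj_a_pow 1 r'
    rw [pow_one, pow_one, ht, zpow_add, haP, mul_one, zpow_one] at h1
    nth_rewrite 1 [← h1]; group
  have hbc : c⁻¹ * b * c = b ^ r' := by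
    have h1 := M.H.conj_b_pow 1 r'
    rw [pow_one, pow_one, ht, zpow_add, M.zpow_b_eq_one (dvd_mul_right _ _), mul_one, zpow_one] at h1
    nth_rewrite 1 [← h1]; group
  have h1 : (a ^ i * b ^ j * c ^ k)⁻¹ * a⁻¹ * (a ^ i * b ^ j * c ^ k) * a
      = (c ^ k)⁻¹ * ((b ^ j)⁻¹ * (a⁻¹ * b ^ j * a) * (a⁻¹ * c ^ k * a)) := by group
  rw [h1, M.H.conj_b_by_a, M.H.conj_c_by_a] at hV
  have h2 := mem_rotate hV
  have e1 := conj_pow_zpow hac k (1 - r ^ k)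
  have e2 := conj_inv_pow_zpow hbc j (geo r j)
  have h3 : (b ^ j)⁻¹ * ((c ^ j)⁻¹ * b ^ geo r j) * (c ^ k * a ^ (1 - r ^ k)) * (c ^ k)⁻¹
      = (b ^ (r' ^ j * geo r j - j) * c ^ (-(j : ℤ))) * a ^ ((1 - r ^ k) * r' ^ k) := by
    have e3 : b ^ (r' ^ j * geo r j - j) = (b ^ j)⁻¹ * b ^ (r' ^ j * geo r j) := by
      rw [← zpow_natCast b j, ← zpow_neg, ← zpow_add]; congr 1; ring
    rw [mul_comm (1 - r ^ k), ← e1, e3, ← e2, zpow_neg, zpow_natCast]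
    simp only [mul_assoc, mul_inv_cancel_left]
  rw [h3] at h2
  -- Here r' inverts r modulo p^(3m), hence describes conjugation by c in the opposite direction.
  -- The exponent of b is small because geo r j ≡ j modulo p^(m+e) and r' ≡ 1 modulo p^m.
  refine ⟨r' ^ k, r' ^ j * geo r j - j, fun hd => hpr' (hpz.dvd_of_dvd_pow hd), ?_, ?_⟩
  · intro e he
    have h4 := M.geo_sub_dvd he
    have h5 : (p : ℤ) ^ (m + e) ∣ (r' ^ j - 1) * j := by
      rw [pow_add]
      exact mul_dvd_mul (hr'1.trans (sub_one_dvd_pow_sub_one _ _)) (by exact_mod_cast he)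
    exact (dvd_add (h4.mul_left (r' ^ j)) h5).trans (dvd_of_eq (by ring))
  · rw [mul_assoc]; exact mem_rotate h2

theorem dvd_of_mul_left (M : MaxMac p m r u a b c) {w x : ℤ} {e f : ℕ} (hw : ¬ (p : ℤ) ∣ w)
    (h : (p : ℤ) ^ (e + f) ∣ p ^ e * (w * x)) : (p : ℤ) ^ f ∣ x := by
  have hpz : Prime (p : ℤ) := Nat.prime_iff_prime_int.1 M.hp
  rw [pow_add, mul_dvd_mul_iff_left (pow_ne_zero _ hpz.ne_zero)] at h
  exact (((Prime.coprime_iff_not_dvd hpz).2 hw).pow_left).dvd_of_dvd_mul_left h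

theorem dvd_of_comm_c (M : MaxMac p m r u a b c) {i j : ℕ} {w x y : ℤ} (hw : ¬ (p : ℤ) ∣ w)
    (h : a ^ ((p : ℤ) ^ m * (u * i)) * b ^ ((p : ℤ) ^ m * (w * j))
      = a ^ ((p : ℤ) ^ (2 * m) * x) * c ^ ((p : ℤ) ^ m * y)) : p ^ m ∣ i ∧ p ^ m ∣ j := by
  have h1 : a ^ ((p : ℤ) ^ m * (u * i) - p ^ (2 * m) * x) * b ^ ((p : ℤ) ^ m * (w * j))
      * c ^ (-((p : ℤ) ^ m * y)) = 1 := by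
    rw [sub_eq_add_neg, add_comm, zpow_add, mul_assoc (a ^ _) (a ^ _) (b ^ _), h, zpow_neg, zpow_neg]
    group
  obtain ⟨h2, h3, _⟩ := (M.uniq _ _ _).1 h1
  have h4 : (p : ℤ) ^ m ∣ j := M.dvd_of_mul_left hw (by rwa [two_mul] at h3)
  refine ⟨?_, by exact_mod_cast h4⟩
  have h5 : (p : ℤ) ^ m ∣ i := by
    refine M.dvd_of_mul_left (e := m) M.hu ?_
    rw [← two_mul]
    have h6 := (pow_dvd_pow (p : ℤ) (by omega : 2 * m ≤ 3 * m)).trans h2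
    exact (dvd_add (dvd_add h6 h3) (dvd_mul_right _ x)).trans (dvd_of_eq (by ring))
  exact_mod_cast h5

theorem exists_a_c (M : MaxMac p m r u a b c) {i j : ℕ} (hj : (p : ℤ) ^ (2 * m) ∣ j) (k : ℕ) :
    ∃ i' : ℕ, a ^ i * b ^ j * c ^ k = a ^ i' * c ^ k := by
  have hp0 : (p : ℤ) ^ (3 * m) ≠ 0 := pow_ne_zero _ (by exact_mod_cast M.hp.ne_zero)
  refine ⟨(((i : ℤ) - j) % p ^ (3 * m)).toNat, ?_⟩
  have h1 : a ^ (((i : ℤ) - j) % p ^ (3 * m)) = a ^ ((i : ℤ) - j) := by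
    conv_rhs => rw [← Int.emod_add_mul_ediv ((i : ℤ) - j) (p ^ (3 * m)), zpow_add,
      M.zpow_a.2 (dvd_mul_right _ _), mul_one]
  rw [← zpow_natCast a (Int.toNat _), Int.toNat_of_nonneg (Int.emod_nonneg _ hp0), h1,
    ← zpow_natCast b, M.zpow_b_eq hj, ← zpow_natCast a i, ← zpow_add, sub_eq_add_neg]

/-- Up to conjugation the commutator of a^i with b is a power of a times c^i. If it is again a power
of a, uniqueness of the normal form forces c^i = 1. -/
theorem dvd_of_a_pow_mem (M : MaxMac p m r u a b c) {n i : ℕ}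
    (hi : a ^ i ∈ Subgroup.upperCentralSeries J (n + 1))
    (hZ : ∀ V ∈ Subgroup.upperCentralSeries J n, ∃ x : ℤ, V = a ^ ((p : ℤ) ^ (2 * m) * x)) :
    (p : ℤ) ^ (2 * m) ∣ i := by
  have h1 := commutator_mem_of_mem_succ hi b
  rw [mul_assoc, mul_assoc, ← mul_assoc b⁻¹, M.H.conj_a_by_b, ← mul_assoc] at h1
  have h2 := mem_rotate h1
  rw [← mul_assoc, ← zpow_natCast a, ← zpow_neg, ← zpow_add] at h2
  obtain ⟨x, hx⟩ := hZ _ h2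
  have h3 : a ^ (geo r i + -(i : ℤ) - p ^ (2 * m) * x) * b ^ (0 : ℤ) * c ^ (i : ℤ) = 1 := by
    rw [sub_eq_add_neg, add_comm _ (-((p : ℤ) ^ (2 * m) * x)), zpow_add, zpow_zero, mul_one,
      mul_assoc, zpow_natCast c, hx, zpow_neg, inv_mul_cancel]
  exact ((M.uniq _ _ _).1 h3).2.2

theorem dvd_k (M : MaxMac p m r u a b c) {k : ℕ} {w : ℤ} (hw : ¬ (p : ℤ) ∣ w) {e : ℕ}
    (h : (p : ℤ) ^ (m + e) ∣ (1 - r ^ k) * w) : p ^ e ∣ k := by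
  have hpz : Prime (p : ℤ) := Nat.prime_iff_prime_int.1 M.hp
  have h1 := (((Prime.coprime_iff_not_dvd hpz).2 hw).pow_left).dvd_of_dvd_mul_right h
  refine pow_dvd_of_pow_sub_one M.hp M.hodd M.hm M.hr M.hu ?_
  rw [← dvd_neg, neg_sub]; exact h1

/-- Commuting with a forces p^(2m) to divide first j and then k. So c^k disappears, b^j turns into a
power of a, and commuting with b restricts the resulting power. -/
theorem mem_center_iff (M : MaxMac p m r u a b c) {V : J} :
    V ∈ Subgroup.center J ↔ ∃ x : ℤ, V = a ^ ((p : ℤ) ^ (2 * m) * x) := by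
  constructor
  · intro hV
    rw [← Subgroup.upperCentralSeries_one] at hV
    obtain ⟨i, j, k, rfl⟩ := M.nf V
    have h0 : ∀ V ∈ Subgroup.upperCentralSeries J 0,
        ∃ x : ℤ, V = a ^ ((p : ℤ) ^ (2 * m) * x) := by
      intro V hV
      exact ⟨0, by simpa using hV⟩
    obtain ⟨w, x, hw, hx, h1⟩ := M.comm_a (commutator_mem_of_mem_succ hV a)
    rw [Subgroup.upperCentralSeries_zero, Subgroup.mem_bot] at h1
    obtain ⟨h2, _, h3⟩ := (M.uniq _ _ _).1 h1
    rw [dvd_neg] at h3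
    have hx' := hx (2 * m) (by exact_mod_cast h3)
    rw [show m + 2 * m = 3 * m by ring] at hx'
    have hk : p ^ (2 * m) ∣ k := by
      refine M.dvd_k hw ?_
      rw [show m + 2 * m = 3 * m by ring]
      exact (dvd_add h2 hx').trans (dvd_of_eq (by ring))
    have hck : c ^ k = 1 := by
      rw [← zpow_natCast, M.zpow_c]; exact_mod_cast hk
    obtain ⟨i', hi'⟩ := M.exists_a_c (i := i) h3 k
    rw [hi', hck, mul_one] at hV ⊢
    obtain ⟨y, hy⟩ := M.dvd_of_a_pow_mem hV h0
    exact ⟨y, by rw [← hy, zpow_natCast]⟩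
  · rintro ⟨x, rfl⟩
    exact M.zpow_a_mem_center (dvd_mul_right _ _)

/-- The argument for the centre, carried out modulo the centre: now only p^m | k results, and the
factor c^k, itself in Z₂, is removed before testing the power of a. -/
theorem mem_two (M : MaxMac p m r u a b c) {V : J} (hV : V ∈ Subgroup.upperCentralSeries J 2) :
    ∃ x y : ℤ, V = a ^ ((p : ℤ) ^ (2 * m) * x) * c ^ ((p : ℤ) ^ m * y) := by
  obtain ⟨i, j, k, rfl⟩ := M.nf V
  have h0 : ∀ V ∈ Subgroup.upperCentralSeries J 1,
      ∃ x : ℤ, V = a ^ ((p : ℤ) ^ (2 * m) * x) := by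
    intro V hV
    rw [Subgroup.upperCentralSeries_one] at hV
    exact M.mem_center_iff.1 hV
  obtain ⟨w, x, hw, hx, h1⟩ := M.comm_a (commutator_mem_of_mem_succ hV a)
  obtain ⟨y, hy⟩ := h0 _ h1
  have h1' : a ^ ((1 - r ^ k) * w - p ^ (2 * m) * y) * b ^ x * c ^ (-(j : ℤ)) = 1 := by
    rw [sub_eq_add_neg, add_comm, zpow_add, mul_assoc, mul_assoc, ← mul_assoc (a ^ ((1 - r ^ k) * w)),
      hy, zpow_neg, inv_mul_cancel]
  obtain ⟨h2, _, h3⟩ := (M.uniq _ _ _).1 h1'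
  rw [dvd_neg] at h3
  have hx' := hx (2 * m) (by exact_mod_cast h3)
  rw [show m + 2 * m = 3 * m by ring] at hx'
  have hk : p ^ m ∣ k := by
    refine M.dvd_k hw ?_
    rw [← two_mul]
    have h4 := (pow_dvd_pow (p : ℤ) (by omega : 2 * m ≤ 3 * m)).trans (dvd_add h2 hx')
    exact (dvd_add h4 (dvd_mul_right _ y)).trans (dvd_of_eq (by ring))
  obtain ⟨i', hi'⟩ := M.exists_a_c (i := i) h3 k
  rw [hi'] at hV ⊢
  have h5 := (Subgroup.mul_mem_cancel_right _ (M.c_pow_mem_two hk)).1 hV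
  obtain ⟨z, hz⟩ := M.dvd_of_a_pow_mem h5 h0
  obtain ⟨k', rfl⟩ := hk
  exact ⟨z, k', by rw [← hz, zpow_natCast, ← zpow_natCast c]; push_cast; rfl⟩

/-- The commutator with c lies in Z₂ only if p^m divides i and j; given this, the commutator with a
yields p^m | k. -/
theorem mem_three_iff (M : MaxMac p m r u a b c) {V : J} :
    V ∈ Subgroup.upperCentralSeries J 3 ↔
      ∃ i j k : ℕ, V = a ^ (p ^ m * i) * b ^ (p ^ m * j) * c ^ (p ^ m * k) := by
  constructor
  · intro hV
    obtain ⟨i, j, k, rfl⟩ := M.nf V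
    obtain ⟨w, hw, h1⟩ := M.comm_c (commutator_mem_of_mem_succ hV c)
    obtain ⟨x, y, hxy⟩ := M.mem_two h1
    obtain ⟨hi, hj⟩ := M.dvd_of_comm_c hw hxy
    obtain ⟨w, x, hw, hx, h1⟩ := M.comm_a (commutator_mem_of_mem_succ hV a)
    obtain ⟨y, z, hyz⟩ := M.mem_two h1
    have h1' : a ^ ((1 - r ^ k) * w - p ^ (2 * m) * y) * b ^ x * c ^ (-(j : ℤ) - p ^ m * z) = 1 := by
      have e1 : a ^ ((1 - r ^ k) * w - p ^ (2 * m) * y)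
          = (a ^ ((p : ℤ) ^ (2 * m) * y))⁻¹ * a ^ ((1 - r ^ k) * w) := by
        rw [← zpow_neg, ← zpow_add]; congr 1; ring
      rw [e1, zpow_sub]
      calc _ = (a ^ ((p : ℤ) ^ (2 * m) * y))⁻¹ *
            (a ^ ((1 - r ^ k) * w) * b ^ x * c ^ (-(j : ℤ))) * (c ^ ((p : ℤ) ^ m * z))⁻¹ := by
            simp only [mul_assoc]
        _ = 1 := by rw [hyz, ← mul_assoc, inv_mul_cancel, one_mul, mul_inv_cancel]
    obtain ⟨h2, _, _⟩ := (M.uniq _ _ _).1 h1'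
    have hx' := hx m hj
    rw [← two_mul] at hx'
    have hk : p ^ m ∣ k := by
      refine M.dvd_k hw ?_
      rw [← two_mul]
      have h4 := (pow_dvd_pow (p : ℤ) (by omega : 2 * m ≤ 3 * m)).trans h2
      exact (dvd_add (dvd_add h4 hx') (dvd_mul_right _ y)).trans (dvd_of_eq (by ring))
    obtain ⟨i, rfl⟩ := hi
    obtain ⟨j, rfl⟩ := hj
    obtain ⟨k, rfl⟩ := hk
    exact ⟨i, j, k, rfl⟩
  · rintro ⟨i, j, k, rfl⟩
    refine mul_mem (mul_mem (M.a_pow_mem_three (dvd_mul_right _ _))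
      (M.b_pow_mem_three (dvd_mul_right _ _))) ?_
    exact Subgroup.upperCentralSeries_mono J (by norm_num : 2 ≤ 3)
      (M.c_pow_mem_two (dvd_mul_right _ _))

theorem commute_a_c (M : MaxMac p m r u a b c) : Commute (a ^ p ^ m) (c ^ p ^ m) := by
  have h1 := M.H.conj_a_pow (p ^ m) (p ^ m : ℕ)
  have h2 : a ^ (r ^ p ^ m * ((p ^ m : ℕ) : ℤ)) = a ^ p ^ m := by
    obtain ⟨w, hw⟩ := pow_sub_one_close M.hodd M.hm M.pm_dvd (dvd_refl (p ^ m))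
    rw [sub_eq_iff_eq_add.1 hw, show ((p : ℤ) ^ (m + m) * w + 1) * ((p ^ m : ℕ) : ℤ)
      = p ^ (3 * m) * w + (p ^ m : ℕ) by push_cast; ring, zpow_add, M.zpow_a.2 (dvd_mul_right _ _),
      one_mul, zpow_natCast]
  rw [h2, zpow_natCast] at h1
  rw [commute_iff_eq]
  calc a ^ p ^ m * c ^ p ^ m = c ^ p ^ m * ((c ^ p ^ m)⁻¹ * a ^ p ^ m * c ^ p ^ m) := by group
    _ = _ := by rw [h1]

theorem commute_b_c (M : MaxMac p m r u a b c) : Commute (b ^ p ^ m) (c ^ p ^ m) := by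
  have h1 := M.H.conj_b_pow (p ^ m) (p ^ m : ℕ)
  have h2 : b ^ (r ^ p ^ m * ((p ^ m : ℕ) : ℤ)) = b ^ p ^ m := by
    obtain ⟨w, hw⟩ := pow_sub_one_close M.hodd M.hm M.pm_dvd (dvd_refl (p ^ m))
    rw [sub_eq_iff_eq_add.1 hw, show ((p : ℤ) ^ (m + m) * w + 1) * ((p ^ m : ℕ) : ℤ)
      = p ^ (3 * m) * w + (p ^ m : ℕ) by push_cast; ring, zpow_add,
      M.zpow_b_eq_one (dvd_mul_right _ _), one_mul, zpow_natCast]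
  rw [h2, zpow_natCast] at h1
  rw [commute_iff_eq, eq_comm]
  calc c ^ p ^ m * b ^ p ^ m = (c ^ p ^ m * b ^ p ^ m * (c ^ p ^ m)⁻¹) * c ^ p ^ m := by group
    _ = _ := by rw [h1]

/-- Conjugation by b multiplies a^(p^m) by c^(p^m) and a central factor, and multiplies c^(p^m) by a
central factor. After p^m conjugations every correction is trivial; for the last one p^m divides
C(p^m, 2), as p is odd. With the two preceding lemmas, Z₃ is abelian. -/
theorem commute_a_b (M : MaxMac p m r u a b c) : Commute (a ^ p ^ m) (b ^ p ^ m) := by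
  obtain ⟨w, hw⟩ := M.geo_sub_dvd (dvd_refl (p ^ m))
  obtain ⟨v, hv⟩ := pow_sub_one_close M.hodd M.hm M.pm_dvd (dvd_refl (p ^ m))
  rw [← two_mul] at hw hv
  have h1 : b⁻¹ * a ^ p ^ m * b = a ^ p ^ m * c ^ p ^ m * a ^ ((p : ℤ) ^ (2 * m) * w) := by
    rw [M.H.conj_a_by_b, sub_eq_iff_eq_add.1 hw, M.commute_a_c.eq, mul_assoc, add_comm, zpow_add,
      zpow_natCast]
  have h2 : b⁻¹ * c ^ p ^ m * b = c ^ p ^ m * b ^ ((p : ℤ) ^ (2 * m) * v) := by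
    have h3 := M.H.symm.conj_c_by_a (p ^ m)
    have h4 := congrArg (·⁻¹) h3
    simp only [inv_pow, mul_inv_rev, inv_inv, ← zpow_neg, neg_sub] at h4
    rw [hv] at h4
    rw [mul_assoc, h4]
    exact (Subgroup.mem_center_iff.1 (M.zpow_b_mem_center (dvd_mul_right _ v)) _).symm
  have h3 := conj_pow_class_two h1 h2 (M.zpow_a_mem_center (dvd_mul_right _ _))
    (M.zpow_b_mem_center (dvd_mul_right _ _)) (p ^ m)
  have e1 : (c ^ p ^ m) ^ p ^ m = 1 := by
    rw [← pow_mul, ← zpow_natCast, M.zpow_c, two_mul, pow_add]; push_cast; exact dvd_rfl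
  have e2 : (a ^ ((p : ℤ) ^ (2 * m) * w)) ^ p ^ m = 1 := by
    rw [← zpow_natCast, ← zpow_mul, M.zpow_a]
    exact ⟨w, by push_cast; ring⟩
  have e3 : (b ^ ((p : ℤ) ^ (2 * m) * v)) ^ (p ^ m).choose 2 = 1 := by
    rw [← zpow_natCast, ← zpow_mul]
    apply M.zpow_b_eq_one
    apply dvd_of_dvd_two_mul M.hodd
    have := two_mul_choose' (p ^ m)
    refine ⟨v * ((p ^ m : ℕ) - 1), ?_⟩
    calc 2 * ((p : ℤ) ^ (2 * m) * v * ((p ^ m).choose 2 : ℕ))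
        = (p : ℤ) ^ (2 * m) * v * (2 * ((p ^ m).choose 2 : ℕ)) := by ring
      _ = _ := by rw [this]; push_cast; ring
  rw [e1, e2, e3, mul_one, mul_one, mul_one] at h3
  rw [commute_iff_eq]
  calc a ^ p ^ m * b ^ p ^ m = b ^ p ^ m * ((b ^ p ^ m)⁻¹ * a ^ p ^ m * b ^ p ^ m) := by group
    _ = _ := by rw [h3]

theorem three_pow (M : MaxMac p m r u a b c) (i j k x : ℕ) :
    (a ^ (p ^ m * i) * b ^ (p ^ m * j) * c ^ (p ^ m * k)) ^ x
      = a ^ (p ^ m * i * x) * b ^ (p ^ m * j * x) * c ^ (p ^ m * k * x) := by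
  have h1 : Commute (a ^ (p ^ m * i)) (b ^ (p ^ m * j)) := by
    rw [pow_mul, pow_mul]; exact M.commute_a_b.pow_pow _ _
  have h2 : Commute (a ^ (p ^ m * i) * b ^ (p ^ m * j)) (c ^ (p ^ m * k)) := by
    rw [pow_mul, pow_mul, pow_mul]
    exact (M.commute_a_c.pow_pow _ _).mul_left (M.commute_b_c.pow_pow _ _)
  rw [h2.mul_pow, h1.mul_pow, ← pow_mul, ← pow_mul, ← pow_mul]

/-- The intersection of `Mset` and `Lset` in normal form. -/
theorem mem_Mset_inter_Lset_iff (M : MaxMac p m r u a b c) {h n : ℕ} (hmn : m = h + n) {V : J} :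
    V ∈ Mset J p n ∩ Lset J p (2 * n) ↔ ∃ i j k : ℕ, V = a ^ i * b ^ j * c ^ k ∧
      (p : ℤ) ^ (m + 2 * h) ∣ (i : ℤ) - j ∧ (p : ℤ) ^ (m + h) ∣ (j : ℤ) ∧
      (p : ℤ) ^ (m + h) ∣ (k : ℤ) := by
  have hp0 : (p : ℤ) ≠ 0 := by exact_mod_cast M.hp.ne_zero
  constructor
  · rintro ⟨⟨hV, hc⟩, -, h1⟩
    obtain ⟨i, j, k, rfl⟩ := M.mem_three_iff.1 hV
    rw [M.three_pow] at hc h1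
    obtain ⟨s, hs⟩ := M.mem_center_iff.1 hc
    have h2 : a ^ (((p ^ m * i * p ^ n : ℕ) : ℤ) - p ^ (2 * m) * s) * b ^ ((p ^ m * j * p ^ n : ℕ) : ℤ)
        * c ^ ((p ^ m * k * p ^ n : ℕ) : ℤ) = 1 := by
      rw [sub_eq_add_neg, add_comm, zpow_add, mul_assoc, mul_assoc, ← mul_assoc (a ^ ((_ : ℕ) : ℤ)),
        zpow_natCast, zpow_natCast, zpow_natCast, hs, zpow_neg, inv_mul_cancel]
    obtain ⟨-, h3, h4⟩ := (M.uniq _ _ _).1 h2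
    have h5 := (M.uniq (p ^ m * i * p ^ (2 * n) : ℕ) (p ^ m * j * p ^ (2 * n) : ℕ)
      (p ^ m * k * p ^ (2 * n) : ℕ)).1 (by rw [zpow_natCast, zpow_natCast, zpow_natCast]; exact h1)
    -- Triviality of the p^(2n)-th power gives the condition on i - j, and centrality of the p^n-th
    -- power gives those on j and k. Since m = h + n, 3m - 2n = m + 2h and 2m - n = m + h.
    refine ⟨_, _, _, rfl, ?_, ?_, ?_⟩
    · have h6 := h5.1
      rw [show 3 * m = 2 * n + (m + 2 * h) by omega, pow_add] at h6
      refine (mul_dvd_mul_iff_left (pow_ne_zero (2 * n) hp0)).1 (h6.trans (dvd_of_eq ?_))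
      push_cast; ring
    · rw [show 2 * m = n + (m + h) by omega, pow_add] at h3
      refine (mul_dvd_mul_iff_left (pow_ne_zero n hp0)).1 (h3.trans (dvd_of_eq ?_))
      push_cast; ring
    · rw [show 2 * m = n + (m + h) by omega, pow_add] at h4
      refine (mul_dvd_mul_iff_left (pow_ne_zero n hp0)).1 (h4.trans (dvd_of_eq ?_))
      push_cast; ring
  · rintro ⟨i, j, k, rfl, h1, h2, h3⟩
    have hi : (p : ℤ) ^ (m + h) ∣ i :=
      (dvd_add ((pow_dvd_pow (p : ℤ) (by omega : m + h ≤ m + 2 * h)).trans h1) h2).trans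
        (dvd_of_eq (by ring))
    have low : ∀ {x : ℕ}, (p : ℤ) ^ (m + h) ∣ x → p ^ m ∣ x := fun hx => by
      have := (pow_dvd_pow (p : ℤ) (by omega : m ≤ m + h)).trans hx
      exact_mod_cast this
    have up : ∀ {x : ℕ}, (p : ℤ) ^ (m + h) ∣ x → (p : ℤ) ^ (2 * m) ∣ ((x * p ^ n : ℕ) : ℤ) := by
      intro x hx
      rw [show 2 * m = (m + h) + n by omega, pow_add]; push_cast
      exact mul_dvd_mul_right hx _
    have hpow : ∀ x : ℕ, (a ^ i * b ^ j * c ^ k) ^ x = a ^ (i * x) * b ^ (j * x) * c ^ (k * x) := by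
      obtain ⟨i', rfl⟩ := low hi
      obtain ⟨j', rfl⟩ := low h2
      obtain ⟨k', rfl⟩ := low h3
      exact fun x => M.three_pow _ _ _ x
    have hZ : a ^ i * b ^ j * c ^ k ∈ Subgroup.upperCentralSeries J 3 := by
      obtain ⟨i', rfl⟩ := low hi
      obtain ⟨j', rfl⟩ := low h2
      obtain ⟨k', rfl⟩ := low h3
      exact M.mem_three_iff.2 ⟨_, _, _, rfl⟩
    refine ⟨⟨hZ, ?_⟩, hZ, ?_⟩
    · rw [hpow, ← zpow_natCast, ← zpow_natCast b, ← zpow_natCast c, M.zpow_c.2 (up h3), mul_one]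
      exact mul_mem (M.zpow_a_mem_center (up hi)) (M.zpow_b_mem_center (up h2))
    · rw [hpow, ← zpow_natCast, ← zpow_natCast b, ← zpow_natCast c, M.uniq]
      refine ⟨?_, ?_, ?_⟩
      · rw [show 3 * m = (m + 2 * h) + 2 * n by omega, pow_add]
        obtain ⟨w, hw⟩ := h1
        exact ⟨w, by push_cast; linear_combination (p : ℤ) ^ (2 * n) * hw⟩
      · refine (up h2).trans ⟨p ^ n, ?_⟩; push_cast; ring
      · refine (up h3).trans ⟨p ^ n, ?_⟩; push_cast; ring

end MaxMac

/-! ### Parameters and universal properties of the presented groups -/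

/-- The valuations of `α - 1` and `α ^ γ - 1` determine each other. -/
theorem exists_params {α : ℤ} {γ p m n h k : ℕ} (hα : α ^ γ ≠ 1) (hp : p.Prime)
    (hp_odd : Odd p) (hm : m = padicValInt p (α ^ γ - 1)) (hh : h = padicValInt p (α - 1))
    (hh_pos : 0 < h) (hk : γ = p ^ n * k) (hpk : ¬ p ∣ k) :
    m = h + n ∧ (∃ u : ℤ, α ^ γ = 1 + p ^ m * u ∧ ¬ (p : ℤ) ∣ u) ∧
      ∃ v : ℤ, α = 1 + p ^ h * v ∧ ¬ (p : ℤ) ∣ v := by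
  have := Fact.mk hp
  have key : ∀ {x : ℤ} {e : ℕ}, x ≠ 0 → e = padicValInt p x →
      emultiplicity (p : ℤ) x = e ∧ ∃ u : ℤ, x = p ^ e * u ∧ ¬ (p : ℤ) ∣ u := by
    intro x e hx he
    have h1 : (p : ℤ) ^ e ∣ x := he ▸ padicValInt_dvd x
    have h2 : ¬ (p : ℤ) ^ (e + 1) ∣ x := by
      rw [padicValInt_dvd_iff, ← he]; push Not; exact ⟨hx, by omega⟩
    refine ⟨emultiplicity_eq_coe.2 ⟨h1, h2⟩, ?_⟩
    obtain ⟨u, rfl⟩ := h1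
    exact ⟨u, rfl, fun hu => h2 (by rw [pow_succ]; exact mul_dvd_mul_left _ hu)⟩
  have hα1 : α - 1 ≠ 0 := fun h0 => hα (by rw [sub_eq_zero.1 h0, one_pow])
  obtain ⟨e1, u, hu, hu'⟩ := key (sub_ne_zero.2 hα) hm
  obtain ⟨e2, v, hv, hv'⟩ := key hα1 hh
  refine ⟨?_, ⟨u, by linear_combination hu, hu'⟩, ⟨v, by linear_combination hv, hv'⟩⟩
  have hd : (p : ℤ) ∣ α - 1 := hv ▸ (dvd_pow_self _ hh_pos.ne').mul_right _
  have hpz : Prime (p : ℤ) := Nat.prime_iff_prime_int.1 hp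
  have hnd : ¬ (p : ℤ) ∣ α := fun hd' => hpz.not_dvd_one (by simpa using dvd_sub hd' hd)
  have h3 := Int.emultiplicity_pow_sub_pow hp hp_odd hd hnd γ
  have h4 : emultiplicity p γ = n := by
    rw [hk, emultiplicity_eq_coe]
    refine ⟨dvd_mul_right _ _, fun hd => hpk ?_⟩
    rw [pow_succ] at hd
    exact Nat.dvd_of_mul_dvd_mul_left (pow_pos hp.pos n) hd
  rw [one_pow, e1, e2, h4] at h3
  exact_mod_cast h3

section
variable {T : Type*} [Group T]

theorem MacRel.of_comm {r : ℤ} {a b c : T} (h1 : c = comm a b) (h2 : conjR a c = a ^ r)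
    (h3 : conjL c b = b ^ r) : MacRel r a b c := ⟨comm_eq_iff.1 h1, h2, h3⟩

theorem macRel_MGroup (r : ℤ) : MacRel r (MA r r) (MB r r) (comm (MA r r) (MB r r)) := by
  refine MacRel.of_comm rfl ?_ ?_
  · have h := PresentedGroup.one_of_mem (rels := macdonaldRels r r) (Or.inl rfl)
    rw [map_mul, map_inv, mul_inv_eq_one, map_zpow] at h
    simp only [conjR, comm, map_mul, map_inv] at h
    exact h
  · have h := PresentedGroup.one_of_mem (rels := macdonaldRels r r) (Or.inr rfl)
    rw [map_mul, map_inv, mul_inv_eq_one, map_zpow] at h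
    simp only [conjL, comm, map_mul, map_inv] at h
    exact h

theorem closure_MGroup (r : ℤ) : Subgroup.closure {MA r r, MB r r} = ⊤ := by
  rw [← PresentedGroup.closure_range_of (macdonaldRels r r)]
  congr 1
  ext x
  simp [Fin.exists_fin_two, MA, MB, eq_comm]

theorem closure_WGroup (α : ℤ) (γ : ℕ) :
    Subgroup.closure {WX α α γ, WY α α γ, WZ α α γ} = ⊤ := by
  rw [← PresentedGroup.closure_range_of (wamsleyRels α α γ)]
  congr 1
  ext x
  simp [Fin.exists_fin_succ, WX, WY, WZ, eq_comm]

theorem MacRel.exists_hom {r : ℤ} {a b c : T} (H : MacRel r a b c) :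
    ∃ φ : MGroup r r →* T, φ (MA r r) = a ∧ φ (MB r r) = b := by
  have hc := H.c_eq
  suffices hrel : _ from ⟨PresentedGroup.toGroup (f := ![a, b]) hrel, by simp [MA], by simp [MB]⟩
  rintro s (rfl | rfl)
  · rw [map_mul, map_inv, mul_inv_eq_one, map_zpow]
    simpa [conjR, comm, ← mul_assoc, hc] using H.conj_a
  · rw [map_mul, map_inv, mul_inv_eq_one, map_zpow]
    simpa [conjL, comm, ← mul_assoc, hc] using H.conj_b

theorem exists_hom_WGroup {α : ℤ} {γ : ℕ} {x y z : T} (hx : z⁻¹ * x * z = x ^ α)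
    (hy : z * y * z⁻¹ = y ^ α) (hz : x * y = y * x * z ^ γ) :
    ∃ φ : WGroup α α γ →* T, φ (WX α α γ) = x ∧ φ (WY α α γ) = y ∧ φ (WZ α α γ) = z := by
  have hz' := comm_eq_iff.2 hz
  suffices hrel : _ from ⟨PresentedGroup.toGroup (f := ![x, y, z]) hrel, by simp [WX],
    by simp [WY], by simp [WZ]⟩
  rintro s (rfl | rfl | rfl)
  · rw [map_mul, map_inv, mul_inv_eq_one, map_zpow]
    simpa [conjR] using hx
  · rw [map_mul, map_inv, mul_inv_eq_one, map_zpow]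
    simpa [conjL] using hy
  · rw [map_mul, map_inv, mul_inv_eq_one, map_pow]
    simpa [comm] using hz'

theorem Omega_MA (α : ℤ) (γ : ℕ) : Omega α α γ (MA _ _) = WX α α γ := by simp [Omega, MA]

theorem Omega_MB (α : ℤ) (γ : ℕ) : Omega α α γ (MB _ _) = WY α α γ := by simp [Omega, MB]

theorem range_Omega (α : ℤ) (γ : ℕ) :
    (Omega α α γ).range = Subgroup.closure {WX α α γ, WY α α γ} := by
  rw [MonoidHom.range_eq_map, ← closure_MGroup, MonoidHom.map_closure, Set.image_pair, Omega_MA,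
    Omega_MB]

theorem finite_MGroup {r : ℤ} (hE : linkExp r (r ^ 2).toNat ≠ 0) (hr : r ≠ 1) :
    Finite (MGroup r r) := by
  have H := macRel_MGroup r
  have := H.finite_closure (H.isOfFinOrder_a hE hr) (H.symm.isOfFinOrder_a hE hr)
  rw [closure_MGroup] at this
  exact Finite.of_equiv _ (Subgroup.topEquiv (G := MGroup r r)).toEquiv

theorem isNilpotent_MGroup {r : ℤ} (hE : linkExp r (r ^ 2).toNat ≠ 0) (hr : r ≠ 1) :
    Group.IsNilpotent (MGroup r r) := by
  have H := macRel_MGroup r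
  exact H.isNilpotent (H.isOfFinOrder_a hE hr) (H.symm.isOfFinOrder_a hE hr) (closure_MGroup r)

/-- Normalizing requires both z and z⁻¹ to map the subgroup into itself; finite order turns the
given power actions into power actions of the inverses. -/
theorem mem_normalizer_closure {x y z : T} {α : ℤ} (hfx : IsOfFinOrder x) (hfy : IsOfFinOrder y)
    (hx : z⁻¹ * x * z = x ^ α) (hy : z * y * z⁻¹ = y ^ α) :
    z ∈ Subgroup.normalizer (Subgroup.closure {x, y} : Set T) := by
  obtain ⟨β, hβ⟩ := exists_conj_eq_zpow hfx hx
  obtain ⟨δ, hδ⟩ := exists_conj_eq_zpow (z := z⁻¹) hfy (by simpa using hy)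
  rw [inv_inv] at hδ
  have mx : x ∈ Subgroup.closure {x, y} := Subgroup.subset_closure (by simp)
  have my : y ∈ Subgroup.closure {x, y} := Subgroup.subset_closure (by simp)
  have h1 : Subgroup.closure {x, y} ≤
      (Subgroup.closure {x, y}).comap (MulAut.conj z).toMonoidHom := by
    rw [Subgroup.closure_le]
    rintro t (rfl | rfl)
    · simpa [hβ] using zpow_mem mx β
    · simpa [hy] using zpow_mem my α
  have h2 : Subgroup.closure {x, y} ≤
      (Subgroup.closure {x, y}).comap (MulAut.conj z⁻¹).toMonoidHom := by
    rw [Subgroup.closure_le]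
    rintro t (rfl | rfl)
    · simpa [hx] using zpow_mem mx α
    · simpa [hδ] using zpow_mem my δ
  rw [Subgroup.mem_normalizer_iff]
  intro t
  refine ⟨fun ht => by simpa using h1 ht, fun ht => ?_⟩
  have := h2 ht
  simpa [mul_assoc] using this

end

/-! ### Projection onto a Sylow subgroup of a nilpotent group -/

section
variable {G : Type*} [Group G] [Finite G] {p : ℕ} [Fact p.Prime]

/-- A retraction of a finite group onto a normal Sylow subgroup is a power map. -/
theorem exists_pow_eq_retraction (P : Sylow p G) [(P : Subgroup G).Normal] (π : G →* P)
    (hπ : ∀ g : P, π g = g) : ∃ τ : ℕ, ∀ g : G, (π g : G) = g ^ τ := by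
  have hco : Nat.Coprime (Nat.card P) (P : Subgroup G).index := P.card_coprime_index
  -- The group is the direct product of P and the kernel of π, whose order is the index of P. An
  -- exponent that is 1 modulo |P| and 0 modulo the index is the projection.
  obtain ⟨τ, h1, h2⟩ := Nat.chineseRemainder hco 1 0
  refine ⟨τ, fun g => ?_⟩
  have hsurj : Function.Surjective π := fun g => ⟨g, hπ g⟩
  have hk : (π g : G)⁻¹ * g ∈ π.ker := by
    rw [MonoidHom.mem_ker, map_mul, map_inv, hπ, inv_mul_cancel]
  have hcard : Nat.card π.ker = (P : Subgroup G).index := by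
    have e1 := π.ker.card_mul_index
    rw [Subgroup.index_ker, MonoidHom.range_eq_top.2 hsurj, Subgroup.card_top, mul_comm] at e1
    have e2 := (P : Subgroup G).card_mul_index
    exact Nat.eq_of_mul_eq_mul_left (Nat.card_pos (α := P)) (e1.trans e2.symm)
  have hcomm : Commute (π g : G) ((π g : G)⁻¹ * g) := by
    refine Subgroup.commute_of_normal_of_disjoint _ π.ker inferInstance inferInstance ?_ _ _
      (π g).2 hk
    rw [Subgroup.disjoint_def]
    intro x hx hx'
    have := hπ ⟨x, hx⟩
    rw [MonoidHom.mem_ker] at hx'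
    rw [hx'] at this
    exact (congrArg Subtype.val this).symm
  have e1 : (π g : G) ^ τ = π g := by
    have : (π g) ^ τ = π g := by
      conv_rhs => rw [← pow_one (π g)]
      rw [← pow_mod_natCard, h1, pow_mod_natCard]
    exact_mod_cast this
  have e2 : ((π g : G)⁻¹ * g) ^ τ = 1 := by
    obtain ⟨t, rfl⟩ := (Nat.modEq_zero_iff_dvd).1 h2
    rw [← hcard, pow_mul]
    have := pow_card_eq_one' (x := (⟨_, hk⟩ : π.ker))
    rw [Subtype.ext_iff] at this
    simp only [SubmonoidClass.coe_pow, OneMemClass.coe_one] at this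
    rw [this, one_pow]
  calc (π g : G) = (π g : G) ^ τ * ((π g : G)⁻¹ * g) ^ τ := by rw [e1, e2, mul_one]
    _ = g ^ τ := by rw [← hcomm.mul_pow, mul_inv_cancel_left]

/-- A finite nilpotent group is the product of its Sylow subgroups. The coordinate at p is injective
on P, and composing with the inverse of its restriction makes it the identity there. The product
runs over primes dividing the group order, so the remaining case, where P is trivial, is separate.
-/
theorem exists_retraction (hnil : Group.IsNilpotent G) (P : Sylow p G) :
    ∃ π : G →* P, ∀ g : P, π g = g := by
  have hN : (P : Subgroup G).Normal := inferInstance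
  by_cases hmem : p ∈ (Nat.card G).primeFactors
  · obtain ⟨e⟩ := (Group.isNilpotent_of_finite_tfae (G := G)).out 0 4 rfl rfl |>.1 hnil
    let ρ : G →* P :=
      { toFun := fun g => e.symm g ⟨p, hmem⟩ P
        map_one' := by simp
        map_mul' := by simp }
    have hρ : ∀ g, ρ g = e.symm g ⟨p, hmem⟩ P := fun g => rfl
    have hinj : Function.Injective (ρ.comp (P : Subgroup G).subtype) := by
      rw [injective_iff_map_eq_one]
      intro g hg
      rw [MonoidHom.comp_apply, hρ] at hg
      -- An element of P has p-power order, so its coordinates at other primes vanish; the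
      -- coordinate at p vanishes by assumption.
      have : e.symm (g : G) = 1 := by
        funext l Q
        have : Fact (l : ℕ).Prime := ⟨Nat.prime_of_mem_primeFactors l.2⟩
        by_cases hl : (l : ℕ) = p
        · obtain ⟨l, hl'⟩ := l
          change l = p at hl
          subst hl
          have := Sylow.unique_of_normal P hN
          rw [Subsingleton.elim Q P]
          exact hg
        · obtain ⟨s, hs⟩ := P.isPGroup' g
          obtain ⟨t, ht⟩ := Q.isPGroup' (e.symm (g : G) l Q)
          have h1 : (e.symm (g : G) l Q) ^ p ^ s = 1 := by
            have : e.symm (g : G) ^ p ^ s = 1 := by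
              rw [← map_pow]
              have : (g : G) ^ p ^ s = 1 := by exact_mod_cast hs
              rw [this, map_one]
            rw [← Pi.pow_apply, ← Pi.pow_apply, this]; rfl
          have h2 := Nat.Coprime.pow s t
            ((Nat.coprime_primes (Fact.out : p.Prime) (Fact.out : (l : ℕ).Prime)).2 (Ne.symm hl))
          rw [← orderOf_dvd_iff_pow_eq_one] at h1 ht
          have h3 := Nat.dvd_gcd h1 ht
          rw [h2.gcd_eq_one, Nat.dvd_one, orderOf_eq_one_iff] at h3
          exact h3
      rw [map_eq_one_iff _ e.symm.injective] at this
      exact_mod_cast this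
    let ε := MulEquiv.ofBijective _ (Finite.injective_iff_bijective.1 hinj)
    exact ⟨ε.symm.toMonoidHom.comp ρ, fun g => ε.symm_apply_apply g⟩
  · have h1 : ¬ p ∣ Nat.card G := fun hd => hmem
      (Nat.mem_primeFactors.2 ⟨Fact.out, hd, Nat.card_pos.ne'⟩)
    have h2 : ∀ g : P, g = 1 := by
      intro g
      obtain ⟨s, hs⟩ := P.isPGroup' g
      have h3 : orderOf g ∣ p ^ s := orderOf_dvd_of_pow_eq_one hs
      have h4 : orderOf g ∣ Nat.card G := (orderOf_dvd_natCard g).trans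
        (Subgroup.card_subgroup_dvd_card (P : Subgroup G))
      have h5 := Nat.dvd_gcd h3 h4
      rw [(((Nat.Prime.coprime_iff_not_dvd Fact.out).2 h1).pow_left s).gcd_eq_one, Nat.dvd_one,
        orderOf_eq_one_iff] at h5
      exact h5
    exact ⟨1, fun g => (h2 g).symm⟩

end

/-! ### Generators and structure of N_p from its normal form description -/

namespace MaxMac

variable {J : Type*} [Group J] {p m h n : ℕ} {r u : ℤ} {a b c : J} {K : Subgroup J}

theorem coe_eq_Mset_inter_Lset (M : MaxMac p m r u a b c) (hmn : m = h + n)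
    (hK : ∀ i j k : ℤ, a ^ i * b ^ j * c ^ k ∈ K ↔
      (p : ℤ) ^ (m + 2 * h) ∣ i - j ∧ (p : ℤ) ^ (m + h) ∣ j ∧ (p : ℤ) ^ (m + h) ∣ k) :
    (K : Set J) = Mset J p n ∩ Lset J p (2 * n) := by
  ext V
  rw [M.mem_Mset_inter_Lset_iff hmn, SetLike.mem_coe]
  have hK' : ∀ i j k : ℕ, a ^ i * b ^ j * c ^ k ∈ K ↔ (p : ℤ) ^ (m + 2 * h) ∣ (i : ℤ) - j ∧
      (p : ℤ) ^ (m + h) ∣ (j : ℤ) ∧ (p : ℤ) ^ (m + h) ∣ (k : ℤ) := fun i j k => by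
    rw [← hK, zpow_natCast, zpow_natCast, zpow_natCast]
  constructor
  · intro hV
    obtain ⟨i, j, k, rfl⟩ := M.nf V
    exact ⟨i, j, k, rfl, (hK' i j k).1 hV⟩
  · rintro ⟨i, j, k, rfl, hijk⟩
    exact (hK' i j k).2 hijk

theorem commute_a_b_of_le (M : MaxMac p m r u a b c) {s t : ℕ} (hs : m ≤ s) (ht : m ≤ t) :
    Commute (a ^ p ^ s) (b ^ p ^ t) := by
  obtain ⟨x, hx⟩ := pow_dvd_pow p hs
  obtain ⟨y, hy⟩ := pow_dvd_pow p ht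
  rw [hx, hy, pow_mul, pow_mul]
  exact M.commute_a_b.pow_pow _ _

theorem commute_a_c_of_le (M : MaxMac p m r u a b c) {s t : ℕ} (hs : m ≤ s) (ht : m ≤ t) :
    Commute (a ^ p ^ s) (c ^ p ^ t) := by
  obtain ⟨x, hx⟩ := pow_dvd_pow p hs
  obtain ⟨y, hy⟩ := pow_dvd_pow p ht
  rw [hx, hy, pow_mul, pow_mul]
  exact M.commute_a_c.pow_pow _ _

theorem commute_b_c_of_le (M : MaxMac p m r u a b c) {s t : ℕ} (hs : m ≤ s) (ht : m ≤ t) :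
    Commute (b ^ p ^ s) (c ^ p ^ t) := by
  obtain ⟨x, hx⟩ := pow_dvd_pow p hs
  obtain ⟨y, hy⟩ := pow_dvd_pow p ht
  rw [hx, hy, pow_mul, pow_mul]
  exact M.commute_b_c.pow_pow _ _

/-- The elements of `K` in terms of three commuting generators. -/
theorem zpow_gen (M : MaxMac p m r u a b c) (i j k : ℤ) :
    (a ^ p ^ (m + 2 * h)) ^ i * (a ^ p ^ (m + h) * b ^ p ^ (m + h)) ^ j * (c ^ p ^ (m + h)) ^ k
      = a ^ ((p : ℤ) ^ (m + 2 * h) * i + p ^ (m + h) * j) * b ^ ((p : ℤ) ^ (m + h) * j)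
        * c ^ ((p : ℤ) ^ (m + h) * k) := by
  rw [(M.commute_a_b_of_le (by omega) (by omega)).mul_zpow, zpow_add, zpow_mul, zpow_mul, zpow_mul,
    zpow_mul]
  simp only [← Nat.cast_pow, zpow_natCast, mul_assoc]

theorem gen_mem (hK : ∀ i j k : ℤ, a ^ i * b ^ j * c ^ k ∈ K ↔
      (p : ℤ) ^ (m + 2 * h) ∣ i - j ∧ (p : ℤ) ^ (m + h) ∣ j ∧ (p : ℤ) ^ (m + h) ∣ k) :
    a ^ p ^ (m + 2 * h) ∈ K ∧ b ^ p ^ (m + 2 * h) ∈ K ∧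
      a ^ p ^ (m + h) * b ^ p ^ (m + h) ∈ K ∧ c ^ p ^ (m + h) ∈ K := by
  have hd : (p : ℤ) ^ (m + h) ∣ p ^ (m + 2 * h) := pow_dvd_pow _ (by omega)
  refine ⟨?_, ?_, ?_, ?_⟩
  · have := (hK (p ^ (m + 2 * h) : ℕ) 0 0).2 (by simp)
    rwa [zpow_zero, zpow_zero, mul_one, mul_one, zpow_natCast] at this
  · have := (hK 0 (p ^ (m + 2 * h) : ℕ) 0).2 (by simp [hd])
    rwa [zpow_zero, zpow_zero, one_mul, mul_one, zpow_natCast] at this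
  · have := (hK (p ^ (m + h) : ℕ) (p ^ (m + h) : ℕ) 0).2 (by simp)
    rwa [zpow_zero, mul_one, zpow_natCast, zpow_natCast] at this
  · have := (hK 0 0 (p ^ (m + h) : ℕ)).2 (by simp)
    rwa [zpow_zero, zpow_zero, mul_one, one_mul, zpow_natCast] at this

theorem exists_zpow_gen (M : MaxMac p m r u a b c)
    (hK : ∀ i j k : ℤ, a ^ i * b ^ j * c ^ k ∈ K ↔
      (p : ℤ) ^ (m + 2 * h) ∣ i - j ∧ (p : ℤ) ^ (m + h) ∣ j ∧ (p : ℤ) ^ (m + h) ∣ k)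
    {V : J} (hV : V ∈ K) : ∃ i j k : ℤ, V = (a ^ p ^ (m + 2 * h)) ^ i *
      (a ^ p ^ (m + h) * b ^ p ^ (m + h)) ^ j * (c ^ p ^ (m + h)) ^ k := by
  obtain ⟨i, j, k, rfl⟩ := M.nf V
  rw [← zpow_natCast, ← zpow_natCast b, ← zpow_natCast c, hK] at hV
  obtain ⟨⟨x, hx⟩, ⟨y, hy⟩, ⟨z, hz⟩⟩ := hV
  refine ⟨x, y, z, ?_⟩
  rw [M.zpow_gen, ← zpow_natCast, ← zpow_natCast b, ← zpow_natCast c, ← hx, ← hy, ← hz,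
    sub_add_cancel]

theorem eq_closure_a (M : MaxMac p m r u a b c)
    (hK : ∀ i j k : ℤ, a ^ i * b ^ j * c ^ k ∈ K ↔
      (p : ℤ) ^ (m + 2 * h) ∣ i - j ∧ (p : ℤ) ^ (m + h) ∣ j ∧ (p : ℤ) ^ (m + h) ∣ k) :
    K = Subgroup.closure
      {a ^ p ^ (m + 2 * h), a ^ p ^ (m + h) * b ^ p ^ (m + h), c ^ p ^ (m + h)} := by
  obtain ⟨h1, h2, h3, h4⟩ := gen_mem hK
  apply le_antisymm
  · intro V hV
    obtain ⟨i, j, k, rfl⟩ := M.exists_zpow_gen hK hV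
    exact mul_mem (mul_mem (zpow_mem (Subgroup.subset_closure (by simp)) _)
      (zpow_mem (Subgroup.subset_closure (by simp)) _))
      (zpow_mem (Subgroup.subset_closure (by simp)) _)
  · rw [Subgroup.closure_le]
    rintro x (rfl | rfl | rfl)
    exacts [h1, h3, h4]

theorem eq_closure_b (M : MaxMac p m r u a b c)
    (hK : ∀ i j k : ℤ, a ^ i * b ^ j * c ^ k ∈ K ↔
      (p : ℤ) ^ (m + 2 * h) ∣ i - j ∧ (p : ℤ) ^ (m + h) ∣ j ∧ (p : ℤ) ^ (m + h) ∣ k) :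
    K = Subgroup.closure
      {b ^ p ^ (m + 2 * h), a ^ p ^ (m + h) * b ^ p ^ (m + h), c ^ p ^ (m + h)} := by
  obtain ⟨h1, h2, h3, h4⟩ := gen_mem hK
  apply le_antisymm
  · rw [M.eq_closure_a hK, Subgroup.closure_le]
    rintro x (rfl | rfl | rfl)
    · have h5 : a ^ p ^ (m + 2 * h)
          = (a ^ p ^ (m + h) * b ^ p ^ (m + h)) ^ p ^ h * (b ^ p ^ (m + 2 * h))⁻¹ := by
        rw [(M.commute_a_b_of_le (by omega) (by omega)).mul_pow, ← pow_mul, ← pow_mul, ← pow_add,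
          show m + h + h = m + 2 * h by ring, mul_inv_cancel_right]
      rw [SetLike.mem_coe, h5]
      exact mul_mem (pow_mem (Subgroup.subset_closure (by simp)) _)
        (inv_mem (Subgroup.subset_closure (by simp)))
    · exact Subgroup.subset_closure (by simp)
    · exact Subgroup.subset_closure (by simp)
  · rw [Subgroup.closure_le]
    rintro x (rfl | rfl | rfl)
    exacts [h2, h3, h4]

theorem zpow_gen_eq_one_iff (M : MaxMac p m r u a b c) (hmn : m = h + n) (i j k : ℤ) :
    (a ^ p ^ (m + 2 * h)) ^ i * (a ^ p ^ (m + h) * b ^ p ^ (m + h)) ^ j * (c ^ p ^ (m + h)) ^ k = 1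
      ↔ (p : ℤ) ^ (2 * n) ∣ i ∧ (p : ℤ) ^ n ∣ j ∧ (p : ℤ) ^ n ∣ k := by
  have hp0 : (p : ℤ) ≠ 0 := by exact_mod_cast M.hp.ne_zero
  rw [M.zpow_gen, M.uniq, add_sub_cancel_right, show 3 * m = (m + 2 * h) + 2 * n by omega,
    show 2 * m = (m + h) + n by omega, pow_add _ _ (2 * n), pow_add _ _ n,
    mul_dvd_mul_iff_left (pow_ne_zero _ hp0), mul_dvd_mul_iff_left (pow_ne_zero _ hp0),
    mul_dvd_mul_iff_left (pow_ne_zero _ hp0)]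

end MaxMac

/-- A group generated by three commuting elements that are independent of given orders. -/
theorem nonempty_mulEquiv_zmod {J : Type*} [Group J] {K : Subgroup J} {N₁ N₂ N₃ : ℕ} [NeZero N₁]
    [NeZero N₂] [NeZero N₃] {x y z : J} (hx : x ∈ K) (hy : y ∈ K) (hz : z ∈ K) (hxy : Commute x y)
    (hxz : Commute x z) (hyz : Commute y z)
    (hgen : ∀ V ∈ K, ∃ i j k : ℤ, V = x ^ i * y ^ j * z ^ k)
    (hone : ∀ i j k : ℤ, x ^ i * y ^ j * z ^ k = 1 ↔
      (N₁ : ℤ) ∣ i ∧ (N₂ : ℤ) ∣ j ∧ (N₃ : ℤ) ∣ k) :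
    Nonempty (K ≃* Multiplicative (ZMod N₁ × ZMod N₂ × ZMod N₃)) := by
  have hmul : ∀ i j k i' j' k' : ℤ, x ^ i * y ^ j * z ^ k * (x ^ i' * y ^ j' * z ^ k')
      = x ^ (i + i') * y ^ (j + j') * z ^ (k + k') := by
    intro i j k i' j' k'
    rw [zpow_add, zpow_add, zpow_add]
    have e1 := (hxy.zpow_zpow i' j).eq
    have e2 := (hxz.zpow_zpow i' k).eq
    have e3 := (hyz.zpow_zpow j' k).eq
    calc _ = x ^ i * y ^ j * (z ^ k * x ^ i') * y ^ j' * z ^ k' := by simp only [mul_assoc]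
      _ = x ^ i * (y ^ j * x ^ i') * (z ^ k * y ^ j') * z ^ k' := by
        rw [← e2]; simp only [mul_assoc]
      _ = _ := by rw [← e1, ← e3]; simp only [mul_assoc]
  have heq : ∀ i j k i' j' k' : ℤ, (N₁ : ℤ) ∣ i - i' → (N₂ : ℤ) ∣ j - j' → (N₃ : ℤ) ∣ k - k' →
      x ^ i * y ^ j * z ^ k = x ^ i' * y ^ j' * z ^ k' := by
    intro i j k i' j' k' h1 h2 h3
    have h4 := hmul i' j' k' (i - i') (j - j') (k - k')
    rw [(hone _ _ _).2 ⟨h1, h2, h3⟩, mul_one] at h4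
    rw [h4]; simp
  let F : Multiplicative (ZMod N₁ × ZMod N₂ × ZMod N₃) →* K := MonoidHom.mk'
    (fun t => ⟨x ^ ((t.toAdd.1.val : ℕ) : ℤ) * y ^ ((t.toAdd.2.1.val : ℕ) : ℤ)
        * z ^ ((t.toAdd.2.2.val : ℕ) : ℤ),
      mul_mem (mul_mem (zpow_mem hx _) (zpow_mem hy _)) (zpow_mem hz _)⟩) (by
    intro s t
    apply Subtype.ext
    simp only [Subgroup.coe_mul]
    rw [hmul]
    refine heq _ _ _ _ _ _ ?_ ?_ ?_ <;>
    · rw [← ZMod.intCast_zmod_eq_zero_iff_dvd]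
      simp)
  have hF : ∀ t, (F t : J) = x ^ ((t.toAdd.1.val : ℕ) : ℤ) * y ^ ((t.toAdd.2.1.val : ℕ) : ℤ)
        * z ^ ((t.toAdd.2.2.val : ℕ) : ℤ) := fun t => rfl
  refine ⟨(MulEquiv.ofBijective F ⟨?_, ?_⟩).symm⟩
  · rw [injective_iff_map_eq_one]
    intro t ht
    rw [Subtype.ext_iff, hF, Subgroup.coe_one, hone] at ht
    obtain ⟨h1, h2, h3⟩ := ht
    rw [← ZMod.intCast_zmod_eq_zero_iff_dvd] at h1 h2 h3
    rw [← toAdd_eq_zero]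
    ext
    · simpa using h1
    · simpa using h2
    · simpa using h3
  · rintro ⟨V, hV⟩
    obtain ⟨i, j, k, rfl⟩ := hgen V hV
    refine ⟨Multiplicative.ofAdd ((i : ZMod N₁), (j : ZMod N₂), (k : ZMod N₃)), ?_⟩
    apply Subtype.ext
    rw [hF]
    refine heq _ _ _ _ _ _ ?_ ?_ ?_ <;>
    · rw [← ZMod.intCast_zmod_eq_zero_iff_dvd]
      simp

namespace MaxMac

variable {J : Type*} [Group J] {p m h n : ℕ} {r u : ℤ} {a b c : J} {K : Subgroup J}

theorem nonempty_mulEquiv (M : MaxMac p m r u a b c) (hmn : m = h + n)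
    (hK : ∀ i j k : ℤ, a ^ i * b ^ j * c ^ k ∈ K ↔
      (p : ℤ) ^ (m + 2 * h) ∣ i - j ∧ (p : ℤ) ^ (m + h) ∣ j ∧ (p : ℤ) ^ (m + h) ∣ k) :
    Nonempty (K ≃* Multiplicative (ZMod (p ^ (2 * n)) × ZMod (p ^ n) × ZMod (p ^ n))) := by
  have : NeZero p := ⟨M.hp.ne_zero⟩
  obtain ⟨h1, -, h3, h4⟩ := gen_mem hK
  refine nonempty_mulEquiv_zmod h1 h3 h4 ?_ ?_ ?_ (fun V => M.exists_zpow_gen hK) ?_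
  · exact ((Commute.refl a).pow_pow _ _).mul_right (M.commute_a_b_of_le (by omega) (by omega))
  · exact M.commute_a_c_of_le (by omega) (by omega)
  · exact (M.commute_a_c_of_le (by omega) (by omega)).mul_left
      (M.commute_b_c_of_le (by omega) (by omega))
  · push_cast
    exact M.zpow_gen_eq_one_iff hmn

end MaxMac

/-! ### Presentations and normal forms by counting -/

/-- If a set parametrizes `S`, and `S` maps onto `S'` of at least the cardinality of that set, then
both maps are bijective. -/
theorem bijective_of_card_le {X S S' : Type*} [Finite X] {F : X → S} {φ : S → S'}
    (hF : Function.Surjective F) (hφ : Function.Surjective φ) (hcard : Nat.card X ≤ Nat.card S') :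
    Function.Bijective φ ∧ Function.Bijective (φ ∘ F) := by
  have := Finite.of_surjective F hF
  have := Finite.of_surjective φ hφ
  have h1 : Function.Bijective (φ ∘ F) := (Nat.bijective_iff_surjective_and_card _).2
    ⟨hφ.comp hF, le_antisymm hcard (Nat.card_le_card_of_surjective _ (hφ.comp hF))⟩
  refine ⟨⟨fun s t hst => ?_, hφ⟩, h1⟩
  obtain ⟨x, rfl⟩ := hF s
  obtain ⟨y, rfl⟩ := hF t
  rw [h1.1 hst]

section
variable {T : Type*} [Group T] {p m h n q : ℕ} {r s : ℤ}

theorem lift_relsABC {ι : Type*} {i j k : ι} {f : ι → T} (H : MacRel r (f i) (f j) (f k))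
    (h1 : f i ^ p ^ (m + 2 * h) = 1) (h2 : f i ^ p ^ (m + h) * f j ^ p ^ (m + h) = 1)
    (h3 : f j ^ p ^ (m + 2 * h) = 1) (h4 : f k ^ p ^ (m + h) = 1) :
    ∀ w ∈ relsABC p m h r (FreeGroup.of i) (FreeGroup.of j) (FreeGroup.of k),
      FreeGroup.lift f w = 1 := by
  rintro w (rfl | rfl | rfl | rfl | rfl | rfl | rfl)
  · rw [map_mul, map_inv, mul_inv_eq_one]
    simpa [comm] using H.c_eq
  · rw [map_mul, map_inv, mul_inv_eq_one]
    simpa [conjR] using H.conj_a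
  · rw [map_mul, map_inv, mul_inv_eq_one]
    simpa [conjL] using H.conj_b
  · simpa using h1
  · simpa using h2
  · simpa using h3
  · simpa using h4

theorem macRel_of_relsABC {ι : Type*} {i j k : ι} {rels : Set (FreeGroup ι)}
    (hrels : relsABC p m h r (FreeGroup.of i) (FreeGroup.of j) (FreeGroup.of k) ⊆ rels) :
    MacRel r (PresentedGroup.of (rels := rels) i) (PresentedGroup.of j) (PresentedGroup.of k) ∧
      PresentedGroup.of (rels := rels) i ^ p ^ (m + 2 * h) = 1 ∧
      PresentedGroup.of (rels := rels) i ^ p ^ (m + h) * PresentedGroup.of j ^ p ^ (m + h) = 1 ∧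
      PresentedGroup.of (rels := rels) j ^ p ^ (m + 2 * h) = 1 ∧
      PresentedGroup.of (rels := rels) k ^ p ^ (m + h) = 1 := by
  have key : ∀ w ∈ relsABC p m h r (FreeGroup.of i) (FreeGroup.of j) (FreeGroup.of k),
      PresentedGroup.mk rels w = 1 := fun w hw => PresentedGroup.one_of_mem (hrels hw)
  have hof : ∀ l : ι, PresentedGroup.mk rels (FreeGroup.of l) = PresentedGroup.of l :=
    fun l => rfl
  simp only [relsABC, Set.mem_insert_iff, Set.mem_singleton_iff, forall_eq_or_imp, forall_eq,
    conjR, conjL, comm, map_mul, map_inv, map_pow, map_zpow, mul_inv_eq_one, hof] at key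
  obtain ⟨k1, k2, k3, k4, k5, k6, k7⟩ := key
  exact ⟨MacRel.of_comm k1 k2 k3, k4, k5, k6, k7⟩

/-- The presentation and the normal form of a group with the given relations and order. -/
theorem exists_PresABC_equiv (hp : p.Prime) {a b c : T} (H : MacRel r a b c)
    (h1 : a ^ p ^ (m + 2 * h) = 1) (h2 : a ^ p ^ (m + h) * b ^ p ^ (m + h) = 1)
    (h3 : b ^ p ^ (m + 2 * h) = 1) (h4 : c ^ p ^ (m + h) = 1)
    (hgen : Subgroup.closure {a, b} = ⊤) (hcard : Nat.card T = p ^ (3 * m + 4 * h)) :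
    (∃ e : PresABC p m h r ≃* T, e (PresentedGroup.of 0) = a ∧ e (PresentedGroup.of 1) = b ∧
      e (PresentedGroup.of 2) = c) ∧
    ∀ g : T, ∃! e : Fin (p ^ (m + 2 * h)) × Fin (p ^ (m + h)) × Fin (p ^ (m + h)),
      g = a ^ (e.1 : ℕ) * b ^ (e.2.1 : ℕ) * c ^ (e.2.2 : ℕ) := by
  let φ : PresABC p m h r →* T := PresentedGroup.toGroup (f := ![a, b, c])
    (lift_relsABC (i := 0) (j := 1) (k := 2) H h1 h2 h3 h4)
  have φa : φ (PresentedGroup.of 0) = a := by simp [φ]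
  have φb : φ (PresentedGroup.of 1) = b := by simp [φ]
  have φc : φ (PresentedGroup.of 2) = c := by simp [φ]
  obtain ⟨H', k1, k2, k3, k4⟩ := macRel_of_relsABC (p := p) (m := m) (h := h) (r := r)
    (i := (0 : Fin 3)) (j := 1) (k := 2) (le_refl _)
  have hsurj : Function.Surjective φ := by
    rw [← MonoidHom.range_eq_top, eq_top_iff, ← hgen, Subgroup.closure_le]
    rintro x (rfl | rfl)
    exacts [⟨_, φa⟩, ⟨_, φb⟩]
  have hgen' : ∀ g : PresABC p m h r,
      g ∈ Subgroup.closure {PresentedGroup.of 0, PresentedGroup.of 1} := by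
    intro g
    refine PresentedGroup.generated_by _ _ (fun l => ?_) g
    fin_cases l
    · exact Subgroup.subset_closure (by simp)
    · exact Subgroup.subset_closure (by simp)
    · have ma : (PresentedGroup.of 0 : PresABC p m h r) ∈
        Subgroup.closure {PresentedGroup.of 0, PresentedGroup.of 1} :=
        Subgroup.subset_closure (by simp)
      have mb : (PresentedGroup.of 1 : PresABC p m h r) ∈
        Subgroup.closure {PresentedGroup.of 0, PresentedGroup.of 1} :=
        Subgroup.subset_closure (by simp)
      have := H'.c_eq
      change (PresentedGroup.of 2 : PresABC p m h r) ∈ _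
      rw [this]
      exact mul_mem (mul_mem (mul_mem (inv_mem ma) (inv_mem mb)) ma) mb
  let F : Fin (p ^ (m + 2 * h)) × Fin (p ^ (m + h)) × Fin (p ^ (m + h)) → PresABC p m h r :=
    fun e => PresentedGroup.of 0 ^ (e.1 : ℕ) * PresentedGroup.of 1 ^ (e.2.1 : ℕ)
      * PresentedGroup.of 2 ^ (e.2.2 : ℕ)
  have hF : Function.Surjective F := fun g => by
    obtain ⟨x, hx⟩ := H'.exists_bounded_normal_form (pow_pos hp.pos _) (pow_pos hp.pos _) k1 k2 k4
      (hgen' g)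
    exact ⟨x, hx.symm⟩
  -- The presented group has at most as many elements as there are normal forms and surjects onto T,
  -- whose order is exactly that number.
  obtain ⟨hb, hb'⟩ := bijective_of_card_le hF hsurj (by
    rw [hcard]; simp only [Nat.card_eq_fintype_card, Fintype.card_prod, Fintype.card_fin]
    rw [← pow_add, ← pow_add]
    exact (congrArg _ (by ring)).le)
  refine ⟨⟨MulEquiv.ofBijective φ hb, φa, φb, φc⟩, fun g => ?_⟩
  obtain ⟨x, hx, hx'⟩ := hb'.existsUnique g
  have hval : ∀ x, (φ ∘ F) x = a ^ (x.1 : ℕ) * b ^ (x.2.1 : ℕ) * c ^ (x.2.2 : ℕ) := fun x => by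
    simp only [Function.comp, F, map_mul, map_pow, φa, φb, φc]
  exact ⟨x, hx.symm.trans (hval x), fun y hy => hx' y ((hval y).trans hy.symm)⟩

end

section
variable {T : Type*} [Group T] {p m h n q : ℕ} {r s : ℤ}

theorem MacRel.c_mem_closure {a b c : T} (H : MacRel r a b c) : c ∈ Subgroup.closure {a, b} := by
  have ma : a ∈ Subgroup.closure {a, b} := Subgroup.subset_closure (by simp)
  have mb : b ∈ Subgroup.closure {a, b} := Subgroup.subset_closure (by simp)
  rw [H.c_eq]
  exact mul_mem (mul_mem (mul_mem (inv_mem ma) (inv_mem mb)) ma) mb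

theorem closure_normal_of_conj {a b d : T} (hfa : IsOfFinOrder a) (hfb : IsOfFinOrder b)
    (hda : d⁻¹ * a * d = a ^ s) (hdb : d * b * d⁻¹ = b ^ s)
    (hgen : Subgroup.closure {a, b, d} = ⊤) : (Subgroup.closure {a, b}).Normal := by
  rw [← Subgroup.normalizer_eq_top_iff, eq_top_iff, ← hgen, Subgroup.closure_le]
  rintro x (rfl | rfl | rfl)
  · exact Subgroup.le_normalizer (Subgroup.subset_closure (by simp))
  · exact Subgroup.le_normalizer (Subgroup.subset_closure (by simp))
  · exact mem_normalizer_closure hfa hfb hda hdb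

/-- Elements are products of an element of `⟨a, b⟩` and a bounded power of `d`. -/
theorem exists_eq_mul_pow {a b d : T} {N : ℕ} (hN : 0 < N) (hfa : IsOfFinOrder a)
    (hfb : IsOfFinOrder b) (hda : d⁻¹ * a * d = a ^ s) (hdb : d * b * d⁻¹ = b ^ s)
    (hgen : Subgroup.closure {a, b, d} = ⊤) (hd : d ^ N ∈ Subgroup.closure {a, b}) (g : T) :
    ∃ t ∈ Subgroup.closure {a, b}, ∃ e : Fin N, g = t * d ^ (e : ℕ) := by
  have hle : Subgroup.closure {a, b, d} ≤ Subgroup.closure {a, b} ⊔ Subgroup.zpowers d := by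
    rw [Subgroup.closure_le]
    rintro x (rfl | rfl | rfl)
    · exact Subgroup.mem_sup_left (Subgroup.subset_closure (by simp))
    · exact Subgroup.mem_sup_left (Subgroup.subset_closure (by simp))
    · exact Subgroup.mem_sup_right (Subgroup.mem_zpowers _)
  have := closure_normal_of_conj hfa hfb hda hdb hgen
  obtain ⟨t, ht, _, ⟨i, rfl⟩, rfl⟩ :=
    Subgroup.mem_sup_of_normal_left.1 (hle (hgen ▸ Subgroup.mem_top g))
  have hN' : (0 : ℤ) < N := by exact_mod_cast hN
  have h1 := Int.emod_nonneg i hN'.ne'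
  have h2 := Int.emod_lt_of_pos i hN'
  refine ⟨t * (d ^ N) ^ (i / N), mul_mem ht (zpow_mem hd _), ⟨(i % N).toNat, by omega⟩, ?_⟩
  simp only
  rw [← zpow_natCast d (i % N).toNat, Int.toNat_of_nonneg h1, mul_assoc, ← zpow_natCast,
    ← zpow_mul, ← zpow_add, Int.mul_ediv_add_emod]

theorem conj_of_relsD {ι : Type*} {i j k l : ι} {rels : Set (FreeGroup ι)}
    (hrels : relsD p n q s (FreeGroup.of i) (FreeGroup.of j) (FreeGroup.of k) (FreeGroup.of l) ⊆
      rels) :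
    (PresentedGroup.of (rels := rels) l)⁻¹ * PresentedGroup.of i * PresentedGroup.of l =
        PresentedGroup.of i ^ s ∧
      PresentedGroup.of (rels := rels) l * PresentedGroup.of j * (PresentedGroup.of l)⁻¹ =
        PresentedGroup.of j ^ s ∧
      PresentedGroup.of (rels := rels) l ^ p ^ n = PresentedGroup.of k ^ q := by
  have key : ∀ w ∈ relsD p n q s (FreeGroup.of i) (FreeGroup.of j) (FreeGroup.of k)
      (FreeGroup.of l), PresentedGroup.mk rels w = 1 :=
    fun w hw => PresentedGroup.one_of_mem (hrels hw)
  have hof : ∀ l : ι, PresentedGroup.mk rels (FreeGroup.of l) = PresentedGroup.of l :=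
    fun l => rfl
  simp only [relsD, Set.mem_insert_iff, Set.mem_singleton_iff, forall_eq_or_imp, forall_eq,
    conjR, conjL, map_mul, map_inv, map_pow, map_zpow, mul_inv_eq_one, hof] at key
  exact key

/-- Distinct normal forms and the upper bound for |T| together make the normal form bijective in T.
In the presented group ⟨a, b⟩ is normal and contains d^(p^n) = c^q, so normal forms exhaust it and
its map onto T cannot have a kernel. -/
theorem exists_PresABCD_equiv [Finite T] (hp : p.Prime) {a b c d : T} (H : MacRel r a b c)
    (h1 : a ^ p ^ (m + 2 * h) = 1) (h2 : a ^ p ^ (m + h) * b ^ p ^ (m + h) = 1)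
    (h3 : b ^ p ^ (m + 2 * h) = 1) (h4 : c ^ p ^ (m + h) = 1)
    (hda : d⁻¹ * a * d = a ^ s) (hdb : d * b * d⁻¹ = b ^ s) (hdn : d ^ p ^ n = c ^ q)
    (hinj : Function.Injective fun e : Fin (p ^ (m + 2 * h)) × Fin (p ^ (m + h)) ×
      Fin (p ^ (m + h)) × Fin (p ^ n) => a ^ (e.1 : ℕ) * b ^ (e.2.1 : ℕ) * c ^ (e.2.2.1 : ℕ) *
        d ^ (e.2.2.2 : ℕ))
    (hcard : Nat.card T ≤ p ^ (3 * m + 4 * h + n)) :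
    Nat.card T = p ^ (3 * m + 4 * h + n) ∧
    (∃ e : PresABCD p m h n q r s ≃* T, e (PresentedGroup.of 0) = a ∧
      e (PresentedGroup.of 1) = b ∧ e (PresentedGroup.of 2) = c ∧ e (PresentedGroup.of 3) = d) ∧
    ∀ g : T, ∃! e : Fin (p ^ (m + 2 * h)) × Fin (p ^ (m + h)) × Fin (p ^ (m + h)) × Fin (p ^ n),
      g = a ^ (e.1 : ℕ) * b ^ (e.2.1 : ℕ) * c ^ (e.2.2.1 : ℕ) * d ^ (e.2.2.2 : ℕ) := by
  have hX : Nat.card (Fin (p ^ (m + 2 * h)) × Fin (p ^ (m + h)) × Fin (p ^ (m + h)) ×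
      Fin (p ^ n)) = p ^ (3 * m + 4 * h + n) := by
    simp only [Nat.card_eq_fintype_card, Fintype.card_prod, Fintype.card_fin]
    rw [← pow_add, ← pow_add, ← pow_add]
    exact congrArg _ (by ring)
  have hcard' : Nat.card T = p ^ (3 * m + 4 * h + n) :=
    le_antisymm hcard (hX ▸ Nat.card_le_card_of_injective _ hinj)
  have hbij := (Nat.bijective_iff_injective_and_card _).2 ⟨hinj, hX.trans hcard'.symm⟩
  have hrel : ∀ w ∈ relsABC p m h r (FreeGroup.of (0 : Fin 4)) (FreeGroup.of 1) (FreeGroup.of 2) ∪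
      relsD p n q s (FreeGroup.of (0 : Fin 4)) (FreeGroup.of 1) (FreeGroup.of 2) (FreeGroup.of 3),
      FreeGroup.lift ![a, b, c, d] w = 1 := by
    rintro w (hw | hw)
    · exact lift_relsABC (i := (0 : Fin 4)) (j := 1) (k := 2) H h1 h2 h3 h4 w hw
    · rcases hw with rfl | rfl | rfl
      · rw [map_mul, map_inv, mul_inv_eq_one]
        simpa [conjR] using hda
      · rw [map_mul, map_inv, mul_inv_eq_one]
        simpa [conjL] using hdb
      · rw [map_mul, map_inv, mul_inv_eq_one]
        simpa using hdn
  let φ : PresABCD p m h n q r s →* T := PresentedGroup.toGroup (f := ![a, b, c, d]) hrel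
  have φa : φ (PresentedGroup.of 0) = a := by simp [φ]
  have φb : φ (PresentedGroup.of 1) = b := by simp [φ]
  have φc : φ (PresentedGroup.of 2) = c := by simp [φ]
  have φd : φ (PresentedGroup.of 3) = d := by simp [φ]
  obtain ⟨H', k1, k2, k3, k4⟩ := macRel_of_relsABC (p := p) (m := m) (h := h) (r := r)
    (i := (0 : Fin 4)) (j := 1) (k := 2) (rels := _ ∪ relsD p n q s (FreeGroup.of (0 : Fin 4))
      (FreeGroup.of 1) (FreeGroup.of 2) (FreeGroup.of 3)) Set.subset_union_left
  obtain ⟨k5, k6, k7⟩ := conj_of_relsD (p := p) (n := n) (q := q) (s := s) (i := (0 : Fin 4))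
    (j := 1) (k := 2) (l := 3) (rels := relsABC p m h r (FreeGroup.of (0 : Fin 4))
      (FreeGroup.of 1) (FreeGroup.of 2) ∪ _) Set.subset_union_right
  let F : Fin (p ^ (m + 2 * h)) × Fin (p ^ (m + h)) × Fin (p ^ (m + h)) × Fin (p ^ n) →
      PresABCD p m h n q r s := fun e => PresentedGroup.of 0 ^ (e.1 : ℕ) *
      PresentedGroup.of 1 ^ (e.2.1 : ℕ) * PresentedGroup.of 2 ^ (e.2.2.1 : ℕ) *
      PresentedGroup.of 3 ^ (e.2.2.2 : ℕ)
  have hval : ∀ x, φ (F x) = a ^ (x.1 : ℕ) * b ^ (x.2.1 : ℕ) * c ^ (x.2.2.1 : ℕ) *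
      d ^ (x.2.2.2 : ℕ) := fun x => by
    simp only [F, map_mul, map_pow, φa, φb, φc, φd]
  have hsurj : Function.Surjective φ := fun g => by
    obtain ⟨x, hx⟩ := hbij.2 g
    exact ⟨F x, (hval x).trans hx⟩
  have hfin : ∀ {x : PresABCD p m h n q r s} {e : ℕ}, x ^ p ^ e = 1 → IsOfFinOrder x :=
    fun hx => isOfFinOrder_iff_pow_eq_one.2 ⟨_, pow_pos hp.pos _, hx⟩
  have hgen : Subgroup.closure {PresentedGroup.of 0, PresentedGroup.of 1, PresentedGroup.of 3} =
      (⊤ : Subgroup (PresABCD p m h n q r s)) := by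
    refine eq_top_iff.2 fun g _ => PresentedGroup.generated_by _ _ (fun l => ?_) g
    fin_cases l
    · exact Subgroup.subset_closure (by simp)
    · exact Subgroup.subset_closure (by simp)
    · exact Subgroup.closure_mono (by intro x; simp; tauto) H'.c_mem_closure
    · exact Subgroup.subset_closure (by simp)
  have hF : Function.Surjective F := fun g => by
    obtain ⟨t, ht, e, rfl⟩ := exists_eq_mul_pow (pow_pos hp.pos n) (hfin k1) (hfin k3) k5 k6 hgen
      (by rw [k7]; exact pow_mem H'.c_mem_closure _) g
    obtain ⟨x, rfl⟩ := H'.exists_bounded_normal_form (pow_pos hp.pos _) (pow_pos hp.pos _) k1 k2 k4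
      ht
    exact ⟨(x.1, x.2.1, x.2.2, e), rfl⟩
  obtain ⟨hb, -⟩ := bijective_of_card_le hF hsurj (hX.trans hcard'.symm).le
  refine ⟨hcard', ⟨MulEquiv.ofBijective φ hb, φa, φb, φc, φd⟩, fun g => ?_⟩
  obtain ⟨x, hx, hx'⟩ := hbij.existsUnique g
  exact ⟨x, hx.symm, fun y hy => hx' y hy.symm⟩

end

theorem map_comm_eq {T T' : Type*} [Group T] [Group T'] (φ : T →* T') (x y : T) :
    φ (comm x y) = comm (φ x) (φ y) := by simp [comm]

theorem MacRel.card_closure_le {T : Type*} [Group T] {r : ℤ} {a b c : T} {N P : ℕ} (hP0 : 0 < P)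
    (hN0 : 0 < N) (H : MacRel r a b c) (ha : a ^ N = 1) (hab : a ^ P * b ^ P = 1) (hc : c ^ P = 1) :
    Nat.card (Subgroup.closure {a, b}) ≤ N * P * P := by
  choose F hF using fun g : Subgroup.closure {a, b} =>
    H.exists_bounded_normal_form hP0 hN0 ha hab hc g.2
  refine (Nat.card_le_card_of_injective F fun x y hxy => ?_).trans (le_of_eq (by simp [mul_assoc]))
  rw [Subtype.ext_iff, hF x, hF y, hxy]

/-! ### The order of the Sylow subgroup of the Macdonald group -/

section
variable {p m : ℕ} {r u : ℤ}

/-- The Sylow `p`-subgroup of the Macdonald group has the largest possible order. -/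
theorem maxMac_sylow [hp : Fact p.Prime] (hodd : Odd p) (hm : 0 < m) (hr : r = 1 + p ^ m * u)
    (hu : ¬ (p : ℤ) ∣ u) (hp3 : p = 3 → ¬ r ≡ 7 [ZMOD 9]) [Finite (MGroup r r)]
    (P : Sylow p (MGroup r r)) (π : MGroup r r →* P) (hπ : Function.Surjective π) :
    MaxMac p m r u (π (MA r r)) (π (MB r r)) (comm (π (MA r r)) (π (MB r r))) ∧
      Nat.card P = p ^ (7 * m) := by
  have H := (macRel_MGroup r).map π
  rw [map_comm_eq] at H
  generalize hc : comm (π (MA r r)) (π (MB r r)) = c at H ⊢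
  have hgen : Subgroup.closure {π (MA r r), π (MB r r)} = ⊤ := by
    rw [← Set.image_pair, ← MonoidHom.map_closure, closure_MGroup,
      Subgroup.map_top_of_surjective _ hπ]
  obtain ⟨e, he⟩ := P.isPGroup'.exists_card_eq
  have hpow : ∀ x : P, x ^ p ^ e = 1 := fun x => he ▸ pow_card_eq_one'
  -- Here c itself serves as z, with α = r and h = m.
  obtain ⟨h1, -, h2, h3⟩ := H.pow_relations hp.out hodd hm le_rfl hr hu hr hu hp3 H.conj_a H.conj_b
    (Commute.refl c) (hpow _) (hpow _)
  rw [show m + 2 * m = 3 * m by ring] at h1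
  rw [← two_mul] at h2 h3
  have hnf : ∀ g : P, ∃ x : Fin (p ^ (3 * m)) × Fin (p ^ (2 * m)) × Fin (p ^ (2 * m)),
      g = π (MA r r) ^ (x.1 : ℕ) * π (MB r r) ^ (x.2.1 : ℕ) * c ^ (x.2.2 : ℕ) := fun g =>
    H.exists_bounded_normal_form (pow_pos hp.out.pos _) (pow_pos hp.out.pos _) h1 h2 h3
      (hgen ▸ Subgroup.mem_top g)
  have hle : Nat.card P ≤ p ^ (7 * m) := by
    refine (Nat.card_le_card_of_surjective (fun x : Fin (p ^ (3 * m)) × Fin (p ^ (2 * m)) ×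
      Fin (p ^ (2 * m)) => π (MA r r) ^ (x.1 : ℕ) * π (MB r r) ^ (x.2.1 : ℕ) * c ^ (x.2.2 : ℕ))
      fun g => (hnf g).imp fun x hx => hx.symm).trans (le_of_eq ?_)
    simp only [Nat.card_eq_fintype_card, Fintype.card_prod, Fintype.card_fin]
    rw [← pow_add, ← pow_add]; congr 1; ring
  have hdr : (p : ℤ) ^ m ∣ r - 1 := ⟨u, by rw [hr]; ring⟩
  -- For γ = 1 the Wamsley relations are the Macdonald relations with Z = [X, Y], so the model is a
  -- quotient of G and gives the lower bound p^(7m).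
  obtain ⟨X, Y, Z, hX, hY, hZ, hd⟩ := exists_model (γ := 1) hp.out hodd hm le_rfl one_pos hdr
    (by rwa [pow_one])
  rw [pow_one] at hZ
  obtain ⟨φ, φA, φB⟩ := MacRel.exists_hom (MacRel.mk hZ hX hY)
  have hrange : φ.range = Subgroup.closure {X, Y} := by
    rw [MonoidHom.range_eq_map, ← closure_MGroup, MonoidHom.map_closure, Set.image_pair, φA, φB]
  have hdvd : p ^ (7 * m) ∣ Nat.card P := by
    refine P.pow_dvd_card_of_pow_dvd_card ?_
    rw [show 7 * m = 3 * m + 4 * m by ring]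
    exact hd.trans (hrange ▸ Subgroup.card_range_dvd φ)
  have hcard := le_antisymm hle (Nat.le_of_dvd Nat.card_pos hdvd)
  refine ⟨⟨hp.out, hodd, hm, hr, hu, H, hgen, fun i j k => ?_, fun V => ?_⟩, hcard⟩
  · have := H.normal_form_eq_one_iff (pow_pos hp.out.pos _) (pow_pos hp.out.pos _) h1 h2 h3 (by
      rw [hgen, Subgroup.card_top, hcard, ← pow_add, ← pow_add]; congr 1; ring) i j k
    push_cast at this
    exact this
  · obtain ⟨x, hx⟩ := hnf V
    exact ⟨_, _, _, hx⟩

end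

/-! ### Finiteness of the Wamsley group and the image of Omega -/

section
variable {α : ℤ} {γ : ℕ}

theorem WX_conj (α : ℤ) (γ : ℕ) :
    (WZ α α γ)⁻¹ * WX α α γ * WZ α α γ = WX α α γ ^ α := WX_rel α α γ

theorem WY_conj (α : ℤ) (γ : ℕ) :
    WZ α α γ * WY α α γ * (WZ α α γ)⁻¹ = WY α α γ ^ α := WY_rel α α γ

theorem conj_inv_mul_pow {T : Type*} [Group T] {x z : T} {s : ℤ} (h : z⁻¹ * x * z = x ^ s)
    (n : ℕ) : z⁻¹ * x ^ n * z = (x ^ n) ^ s := by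
  have := conj_inv_pow_zpow h 1 n
  rw [pow_one, pow_one, zpow_natCast] at this
  rw [this, mul_comm, zpow_mul, zpow_natCast]

theorem conj_mul_pow {T : Type*} [Group T] {x z : T} {s : ℤ} (h : z * x * z⁻¹ = x ^ s)
    (n : ℕ) : z * x ^ n * z⁻¹ = (x ^ n) ^ s := by
  have := conj_inv_mul_pow (z := z⁻¹) (by simpa using h) n
  simpa using this

theorem WZ_pow_mem_range (α : ℤ) (γ : ℕ) : WZ α α γ ^ γ ∈ (Omega α α γ).range := by
  rw [WZ_rel, ← Omega_MA, ← Omega_MB, ← map_comm_eq]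
  exact ⟨_, rfl⟩

variable [Finite (MGroup (α ^ γ) (α ^ γ))]

theorem isOfFinOrder_WX : IsOfFinOrder (WX α α γ) := by
  rw [← Omega_MA]; exact (Omega α α γ).isOfFinOrder (isOfFinOrder_of_finite _)

theorem isOfFinOrder_WY : IsOfFinOrder (WY α α γ) := by
  rw [← Omega_MB]; exact (Omega α α γ).isOfFinOrder (isOfFinOrder_of_finite _)

/-- The subgroup ⟨X, Y⟩ is the image of the finite group G. It is normal because X and Y have finite
order, and it contains Z^γ. -/
theorem finite_WGroup (hγ : 0 < γ) : Finite (WGroup α α γ) := by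
  have hfin : Finite (Subgroup.closure {WX α α γ, WY α α γ}) := by
    rw [← range_Omega]; exact Finite.of_surjective _ (Omega α α γ).rangeRestrict_surjective
  refine Finite.of_surjective (fun x : Subgroup.closure {WX α α γ, WY α α γ} × Fin γ =>
    (x.1 : WGroup α α γ) * WZ α α γ ^ (x.2 : ℕ)) fun g => ?_
  obtain ⟨t, ht, e, rfl⟩ := exists_eq_mul_pow hγ isOfFinOrder_WX isOfFinOrder_WY (WX_conj α γ)
    (WY_conj α γ) (closure_WGroup α γ) (by rw [← range_Omega]; exact WZ_pow_mem_range α γ) g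
  exact ⟨(⟨t, ht⟩, e), rfl⟩

theorem range_Omega_normal : (Omega α α γ).range.Normal := by
  rw [range_Omega]
  exact closure_normal_of_conj isOfFinOrder_WX isOfFinOrder_WY (WX_conj α γ) (WY_conj α γ)
    (closure_WGroup α γ)

/-- Modulo the image of G, the group W is cyclic, generated by Z, and Z^γ is trivial there. -/
theorem index_range_Omega_dvd : (Omega α α γ).range.index ∣ γ := by
  have := range_Omega_normal (α := α) (γ := γ)
  have htop : Subgroup.zpowers (QuotientGroup.mk' (Omega α α γ).range (WZ α α γ)) = ⊤ := by
    have h1 := congrArg (Subgroup.map (QuotientGroup.mk' (Omega α α γ).range))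
      (closure_WGroup α γ)
    rw [Subgroup.map_top_of_surjective _ (QuotientGroup.mk'_surjective _),
      MonoidHom.map_closure] at h1
    rw [eq_top_iff, ← h1, Subgroup.closure_le]
    rintro _ ⟨x, hx | hx | hx, rfl⟩
    · have : QuotientGroup.mk' (Omega α α γ).range x = 1 :=
        (QuotientGroup.eq_one_iff x).2 (hx ▸ ⟨_, Omega_MA α γ⟩)
      rw [this]; exact one_mem _
    · have : QuotientGroup.mk' (Omega α α γ).range x = 1 :=
        (QuotientGroup.eq_one_iff x).2 (hx ▸ ⟨_, Omega_MB α γ⟩)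
      rw [this]; exact one_mem _
    · rw [Set.mem_singleton_iff.1 hx]; exact Subgroup.mem_zpowers _
  rw [Subgroup.index, ← Subgroup.card_top, ← htop, Nat.card_zpowers]
  refine orderOf_dvd_of_pow_eq_one ?_
  rw [← map_pow]
  exact (QuotientGroup.eq_one_iff _).2 (WZ_pow_mem_range α γ)

end

section
variable {α : ℤ} {γ p m n h k : ℕ} {u v : ℤ} [hp : Fact p.Prime]

theorem map_sylow_eq_closure {P : Subgroup (MGroup (α ^ γ) (α ^ γ))} {a b : P}
    (hgen : Subgroup.closure {a, b} = ⊤) :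
    P.map (Omega α α γ) = Subgroup.closure {Omega α α γ a, Omega α α γ b} := by
  have h1 := congrArg (Subgroup.map ((Omega α α γ).comp P.subtype)) hgen
  rw [MonoidHom.map_closure, Set.image_pair, ← MonoidHom.range_eq_map, MonoidHom.range_comp,
    Subgroup.range_subtype] at h1
  exact h1.symm

/-- The image of the Sylow subgroup in the Wamsley group: relations and order. -/
theorem Omega_sylow (hodd : Odd p) (hh : 0 < h) (hhm : h ≤ m) (hγ : 0 < γ)
    (hr : α ^ γ = 1 + p ^ m * u) (hu : ¬ (p : ℤ) ∣ u) (hα : α = 1 + p ^ h * v)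
    (hv : ¬ (p : ℤ) ∣ v) (hp3 : p = 3 → ¬ α ^ γ ≡ 7 [ZMOD 9])
    [Finite (MGroup (α ^ γ) (α ^ γ))]
    (P : Sylow p (MGroup (α ^ γ) (α ^ γ))) {a b c : P} {τ : ℕ}
    (haτ : (a : MGroup (α ^ γ) (α ^ γ)) = MA _ _ ^ τ)
    (hbτ : (b : MGroup (α ^ γ) (α ^ γ)) = MB _ _ ^ τ)
    (hcτ : (c : MGroup (α ^ γ) (α ^ γ)) = comm (MA _ _) (MB _ _) ^ τ)
    (H : MacRel (α ^ γ) a b c) (hgen : Subgroup.closure {a, b} = ⊤) :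
    (Omega α α γ a ^ p ^ (m + 2 * h) = 1 ∧ Omega α α γ b ^ p ^ (m + 2 * h) = 1 ∧
      Omega α α γ a ^ p ^ (m + h) * Omega α α γ b ^ p ^ (m + h) = 1 ∧
      Omega α α γ c ^ p ^ (m + h) = 1) ∧
    Nat.card ((P : Subgroup _).map (Omega α α γ)) = p ^ (3 * m + 4 * h) := by
  have H' : MacRel (α ^ γ) (Omega α α γ a) (Omega α α γ b) (Omega α α γ c) :=
    H.map ((Omega α α γ).comp (P : Subgroup _).subtype)
  have ha : Omega α α γ a = WX α α γ ^ τ := by rw [haτ, map_pow, Omega_MA]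
  have hb : Omega α α γ b = WY α α γ ^ τ := by rw [hbτ, map_pow, Omega_MB]
  have hc : Omega α α γ c = (WZ α α γ ^ γ) ^ τ := by
    rw [hcτ, map_pow, map_comm_eq, Omega_MA, Omega_MB, WZ_rel]
  obtain ⟨e, he⟩ := P.isPGroup'.exists_card_eq
  have hpow : ∀ x : P, Omega α α γ x ^ p ^ e = 1 := fun x => by
    have h1 : x ^ p ^ e = 1 := he ▸ pow_card_eq_one'
    have h2 : (x : MGroup (α ^ γ) (α ^ γ)) ^ p ^ e = 1 := by exact_mod_cast h1
    rw [← map_pow, h2, map_one]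
  -- The projection is a power map, so the images of a, b, c are the τ-th powers of X, Y, Z^γ;
  -- therefore Z acts on the first two by α and commutes with the third.
  have hrel := H'.pow_relations hp.out hodd hh hhm hr hu hα hv hp3 (z := WZ α α γ)
    (by rw [ha]; exact conj_inv_mul_pow (WX_conj α γ) τ)
    (by rw [hb]; exact conj_mul_pow (WY_conj α γ) τ)
    (by rw [hc]; exact ((Commute.refl _).pow_right _).pow_right _) (hpow a) (hpow b)
  refine ⟨hrel, ?_⟩
  obtain ⟨h1, -, h2, h3⟩ := hrel
  have hmap := map_sylow_eq_closure (α := α) (γ := γ) (P := (P : Subgroup _)) (a := a) (b := b) hgen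
  apply le_antisymm
  · rw [hmap]
    refine (H'.card_closure_le (pow_pos hp.out.pos _) (pow_pos hp.out.pos _) h1 h2 h3).trans
      (le_of_eq ?_)
    rw [← pow_add, ← pow_add]; congr 1; ring
  -- By the model p^(3m+4h) divides the order of the image of G, and the image of P is a Sylow
  -- p-subgroup of that image.
  · obtain ⟨X, Y, Z, hX, hY, hZ, hd⟩ := exists_model hp.out hodd hh hhm hγ
      (α := α) ⟨v, by linear_combination hα⟩ ⟨u, by linear_combination hr⟩
    obtain ⟨φ, φX, φY, -⟩ := exists_hom_WGroup hX hY hZ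
    have hrange : (Omega α α γ).range.map φ = Subgroup.closure {X, Y} := by
      rw [range_Omega, MonoidHom.map_closure, Set.image_pair, φX, φY]
    have hd' := hd.trans (hrange ▸ Subgroup.card_map_dvd (Omega α α γ).range φ)
    have hs := (Omega α α γ).rangeRestrict_surjective
    have : Finite (Omega α α γ).range := Finite.of_surjective _ hs
    have h5 := (P.mapSurjective hs).pow_dvd_card_of_pow_dvd_card hd'
    have h6 : Nat.card (P.mapSurjective hs) = Nat.card ((P : Subgroup _).map (Omega α α γ)) := by
      have e1 : (P : Subgroup _).map (Omega α α γ) =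
          ((P : Subgroup _).map (Omega α α γ).rangeRestrict).map (Omega α α γ).range.subtype := by
        rw [Subgroup.map_map, MonoidHom.subtype_comp_rangeRestrict]
      rw [e1, Subgroup.card_map_of_injective (Subgroup.subtype_injective _)]
      rfl
    rw [← h6]
    exact Nat.le_of_dvd Nat.card_pos h5

end

/-! ### Symmetries, and a homomorphism detecting powers of Z -/

theorem exists_swap_MGroup (r : ℤ) :
    ∃ S : MGroup r r ≃* MGroup r r, S (MA r r) = MB r r ∧ S (MB r r) = MA r r := by
  obtain ⟨φ, hA, hB⟩ := (macRel_MGroup r).symm.exists_hom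
  have hφ : φ.comp φ = MonoidHom.id _ := by
    refine PresentedGroup.ext fun i => ?_
    fin_cases i
    · change φ (φ (MA r r)) = MA r r
      rw [hA, hB]
    · change φ (φ (MB r r)) = MB r r
      rw [hB, hA]
  exact ⟨φ.toMulEquiv φ hφ hφ, hA, hB⟩

theorem exists_swap_WGroup (α : ℤ) (γ : ℕ) :
    ∃ S : WGroup α α γ ≃* WGroup α α γ, S (WX α α γ) = WY α α γ ∧ S (WY α α γ) = WX α α γ ∧
      S (WZ α α γ) = (WZ α α γ)⁻¹ := by
  have h1 := comm_eq_iff.1 (WZ_rel α α γ)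
  obtain ⟨φ, hX, hY, hZ⟩ := exists_hom_WGroup (γ := γ) (x := WY α α γ) (y := WX α α γ)
    (z := (WZ α α γ)⁻¹) (by simpa using WY_conj α γ) (by simpa using WX_conj α γ)
    (by rw [h1]; simp)
  have hφ : φ.comp φ = MonoidHom.id _ := by
    refine PresentedGroup.ext fun i => ?_
    fin_cases i
    · change φ (φ (WX α α γ)) = WX α α γ
      rw [hX, hY]
    · change φ (φ (WY α α γ)) = WY α α γ
      rw [hY, hX]
    · change φ (φ (WZ α α γ)) = WZ α α γ
      rw [hZ, map_inv, hZ, inv_inv]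
  exact ⟨φ.toMulEquiv φ hφ hφ, hX, hY, hZ⟩

theorem Omega_swap {α : ℤ} {γ : ℕ} {S : MGroup (α ^ γ) (α ^ γ) ≃* MGroup (α ^ γ) (α ^ γ)}
    {S' : WGroup α α γ ≃* WGroup α α γ} (hA : S (MA _ _) = MB _ _) (hB : S (MB _ _) = MA _ _)
    (hX : S' (WX α α γ) = WY α α γ) (hY : S' (WY α α γ) = WX α α γ)
    (g : MGroup (α ^ γ) (α ^ γ)) : Omega α α γ (S g) = S' (Omega α α γ g) := by
  have : (Omega α α γ).comp S.toMonoidHom = S'.toMonoidHom.comp (Omega α α γ) := by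
    refine PresentedGroup.ext fun i => ?_
    fin_cases i
    · change Omega α α γ (S (MA _ _)) = S' (Omega α α γ (MA _ _))
      rw [hA, Omega_MA, Omega_MB, hX]
    · change Omega α α γ (S (MB _ _)) = S' (Omega α α γ (MB _ _))
      rw [hB, Omega_MA, Omega_MB, hY]
  exact DFunLike.congr_fun this g

/-- A hom from the Wamsley group to `ZMod γ` that kills `X` and `Y`. -/
theorem exists_hom_ZMod (α : ℤ) (γ : ℕ) :
    ∃ ν : WGroup α α γ →* Multiplicative (ZMod γ), (∀ g, ν (Omega α α γ g) = 1) ∧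
      ν (WZ α α γ) = Multiplicative.ofAdd 1 := by
  obtain ⟨ν, hX, hY, hZ⟩ := exists_hom_WGroup (α := α) (γ := γ)
    (x := (1 : Multiplicative (ZMod γ))) (y := 1) (z := Multiplicative.ofAdd 1) (by simp) (by simp)
    (by rw [← ofAdd_nsmul]; simp)
  refine ⟨ν, fun g => ?_, hZ⟩
  have : ν.comp (Omega α α γ) = 1 := by
    refine PresentedGroup.ext fun i => ?_
    fin_cases i
    · change ν (Omega α α γ (MA _ _)) = 1
      rw [Omega_MA, hX]
    · change ν (Omega α α γ (MB _ _)) = 1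
      rw [Omega_MB, hY]
  exact DFunLike.congr_fun this g

/-! ### Sylow subgroups of the Wamsley group -/

/-- Up to conjugation a Sylow subgroup contains a given `p`-subgroup together with a `p`-element
normalizing it. -/
theorem exists_conj_mem_sylow {W : Type*} [Group W] [Finite W] {p : ℕ} [Fact p.Prime]
    {K : Subgroup W} (hK : IsPGroup p K) {d : W} (hd : d ∈ Subgroup.normalizer (K : Set W))
    {n : ℕ} (hdn : d ^ p ^ n ∈ K) (Q : Sylow p W) :
    ∃ w : W, (∀ t ∈ K, w * t * w⁻¹ ∈ Q) ∧ w * d * w⁻¹ ∈ Q := by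
  have hz : IsPGroup p (Subgroup.zpowers d) := by
    rintro ⟨_, i, rfl⟩
    obtain ⟨e, he⟩ := hK ⟨_, hdn⟩
    refine ⟨n + e, ?_⟩
    have he' : (d ^ p ^ n) ^ p ^ e = 1 := by simpa [Subtype.ext_iff] using he
    apply Subtype.ext
    simp only [SubmonoidClass.coe_pow, OneMemClass.coe_one]
    rw [← zpow_natCast, zpow_comm, zpow_natCast, pow_add, pow_mul, he', one_zpow]
  have hsup := hK.to_sup_of_normal_left' hz (by rwa [Subgroup.zpowers_le])
  obtain ⟨Q', hQ'⟩ := hsup.exists_le_sylow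
  obtain ⟨w, rfl⟩ := MulAction.exists_smul_eq W Q' Q
  have key : ∀ t ∈ K ⊔ Subgroup.zpowers d, w * t * w⁻¹ ∈ w • Q' := fun t ht => by
    have := Subgroup.smul_mem_pointwise_smul t (MulAut.conj w) (Q' : Subgroup W) (hQ' ht)
    rw [MulAut.smul_def, MulAut.conj_apply] at this
    exact this
  exact ⟨w, fun t ht => key t (Subgroup.mem_sup_left ht),
    key d (Subgroup.mem_sup_right (Subgroup.mem_zpowers d))⟩

section
variable {α : ℤ} {γ p m n h k q : ℕ} [hp : Fact p.Prime]

/-- Factor |W| as |Ω(P)| [Ω(G):Ω(P)] [W:Ω(G)]. The second factor divides the index of P and the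
third divides γ = p^n k, so apart from p^(3m+4h+n) only numbers prime to p occur. -/
theorem card_sylow_WGroup_le [Finite (MGroup (α ^ γ) (α ^ γ))] [Finite (WGroup α α γ)]
    {P : Subgroup (MGroup (α ^ γ) (α ^ γ))} (hq : ¬ p ∣ P.index)
    (hcard : Nat.card (P.map (Omega α α γ)) = p ^ (3 * m + 4 * h)) (hk : γ = p ^ n * k)
    (hpk : ¬ p ∣ k) (Q : Sylow p (WGroup α α γ)) :
    Nat.card Q ≤ p ^ (3 * m + 4 * h + n) := by
  have hs := (Omega α α γ).rangeRestrict_surjective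
  have e1 : P.map (Omega α α γ) =
      (P.map (Omega α α γ).rangeRestrict).map (Omega α α γ).range.subtype := by
    rw [Subgroup.map_map, MonoidHom.subtype_comp_rangeRestrict]
  rw [e1, Subgroup.card_map_of_injective (Subgroup.subtype_injective _)] at hcard
  obtain ⟨i, hi⟩ := P.index_map_dvd hs
  obtain ⟨j, hj⟩ := index_range_Omega_dvd (α := α) (γ := γ)
  have h1 := (P.map (Omega α α γ).rangeRestrict).card_mul_index
  have h2 := (Omega α α γ).range.card_mul_index
  obtain ⟨e, he⟩ := Q.isPGroup'.exists_card_eq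
  have h3 : p ^ e ∣ p ^ (3 * m + 4 * h + n) * (P.index * k) := by
    have h4 : p ^ e ∣ Nat.card (WGroup α α γ) := he ▸ Subgroup.card_subgroup_dvd_card _
    refine h4.trans ⟨i * j, ?_⟩
    rw [← h2, ← h1, hcard]
    calc p ^ (3 * m + 4 * h + n) * (P.index * k)
        = p ^ (3 * m + 4 * h) * P.index * (p ^ n * k) := by rw [pow_add]; ring
      _ = p ^ (3 * m + 4 * h) * P.index * ((Omega α α γ).range.index * j) := by rw [← hk, ← hj]
      _ = _ := by rw [hi]; ring
  have h5 : Nat.Coprime (p ^ e) (P.index * k) :=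
    (hp.out.coprime_iff_not_dvd.2 (hp.out.not_dvd_mul hq hpk)).pow_left e
  change Nat.card Q = p ^ e at he
  rw [he]
  exact Nat.le_of_dvd (pow_pos hp.out.pos _) (h5.dvd_of_dvd_mul_right h3)

end

section
variable {α : ℤ} {γ p m n h k q : ℕ} [hp : Fact p.Prime]

/-- The Sylow `p`-subgroups of the Wamsley group in terms of the image of a normal `p`-subgroup
of the Macdonald group. -/
theorem sylow_WGroup [Finite (WGroup α α γ)] {P : Subgroup (MGroup (α ^ γ) (α ^ γ))}
    (hP : IsPGroup p P) {a b c : P} (hgen : Subgroup.closure {a, b} = ⊤)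
    (H : MacRel (α ^ γ) a b c)
    (h1 : Omega α α γ a ^ p ^ (m + 2 * h) = 1) (h2 : Omega α α γ b ^ p ^ (m + 2 * h) = 1)
    (h3 : Omega α α γ a ^ p ^ (m + h) * Omega α α γ b ^ p ^ (m + h) = 1)
    (h4 : Omega α α γ c ^ p ^ (m + h) = 1)
    (hda : (WZ α α γ)⁻¹ * Omega α α γ a * WZ α α γ = Omega α α γ a ^ α)
    (hdb : WZ α α γ * Omega α α γ b * (WZ α α γ)⁻¹ = Omega α α γ b ^ α)
    (hdc : (WZ α α γ ^ γ) ^ q = Omega α α γ c ^ q) (hγ : 0 < γ) (hk : γ = p ^ n * k)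
    (hpq : ¬ p ∣ q)
    (hnf : ∀ g : P ⧸ Np α α γ P,
      ∃! e : Fin (p ^ (m + 2 * h)) × Fin (p ^ (m + h)) × Fin (p ^ (m + h)),
        g = (a : P ⧸ Np α α γ P) ^ (e.1 : ℕ) * (b : P ⧸ Np α α γ P) ^ (e.2.1 : ℕ) *
          (c : P ⧸ Np α α γ P) ^ (e.2.2 : ℕ))
    {σ : P ≃* P} {τ : (P ⧸ Np α α γ P) ≃* (P ⧸ Np α α γ P)} {S : WGroup α α γ ≃* WGroup α α γ}
    (hσ : ∀ g : P, Omega α α γ (σ g) = S (Omega α α γ g)) (hS : S (WZ α α γ) = (WZ α α γ)⁻¹)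
    (hτ : ∀ g : P, τ (QuotientGroup.mk g) = QuotientGroup.mk (σ g))
    (Q : Sylow p (WGroup α α γ)) (hQ : Nat.card Q ≤ p ^ (3 * m + 4 * h + n)) :
    Nat.card Q = p ^ (3 * m + 4 * h + n) ∧
    ∃ (ι : (P ⧸ Np α α γ P) →* Q) (d₀ : Q) (w : WGroup α α γ),
      Function.Injective ι ∧
      (∀ g : P, (ι (QuotientGroup.mk g) : WGroup α α γ) = w * Omega α α γ g * w⁻¹) ∧
      (d₀ : WGroup α α γ) = w * WZ α α γ ^ (q * k) * w⁻¹ ∧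
      (∃ e : PresABCD p m h n q (α ^ γ) (α ^ (q * k)) ≃* Q,
        e (PresentedGroup.of 0) = ι a ∧ e (PresentedGroup.of 1) = ι b ∧
        e (PresentedGroup.of 2) = ι c ∧ e (PresentedGroup.of 3) = d₀) ∧
      (∀ g : Q, ∃! e : Fin (p ^ (m + 2 * h)) × Fin (p ^ (m + h)) × Fin (p ^ (m + h)) ×
          Fin (p ^ n),
        g = ι a ^ (e.1 : ℕ) * ι b ^ (e.2.1 : ℕ) * ι c ^ (e.2.2.1 : ℕ) * d₀ ^ (e.2.2.2 : ℕ)) ∧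
      ∃ ρ : Q ≃* Q, (∀ x, ρ (ι x) = ι (τ x)) ∧ ρ d₀ = d₀⁻¹ := by
  have hfa : IsOfFinOrder (Omega α α γ a) := isOfFinOrder_of_finite _
  have hfb : IsOfFinOrder (Omega α α γ b) := isOfFinOrder_of_finite _
  have hd : WZ α α γ ^ (q * k) ∈ Subgroup.normalizer (P.map (Omega α α γ) : Set (WGroup α α γ)) := by
    refine pow_mem ?_ _
    rw [map_sylow_eq_closure (α := α) (γ := γ) (P := P) (a := a) (b := b) hgen]
    exact mem_normalizer_closure hfa hfb hda hdb
  -- The exponent qk is chosen so that the p^n-th power is Z^(γq) = c^q, which lies in the image of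
  -- P. So Z^(qk) can be joined to that image inside one p-subgroup.
  have hdn : (WZ α α γ ^ (q * k)) ^ p ^ n = Omega α α γ c ^ q := by
    rw [← hdc, ← pow_mul, ← pow_mul]
    congr 1
    calc q * k * p ^ n = p ^ n * k * q := by ring
      _ = γ * q := by rw [← hk]
  obtain ⟨w, hw, hwd⟩ := exists_conj_mem_sylow (hP.map (Omega α α γ)) hd (n := n)
    (by rw [hdn]; exact pow_mem (Subgroup.mem_map_of_mem _ c.2) _) Q
  let f : P →* Q :=
    { toFun := fun g => ⟨w * Omega α α γ g * w⁻¹, hw _ (Subgroup.mem_map_of_mem _ g.2)⟩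
      map_one' := Subtype.ext (by simp)
      map_mul' := fun x y => Subtype.ext (by simp [mul_assoc]) }
  have hf : ∀ g : P, (f g : WGroup α α γ) = w * Omega α α γ g * w⁻¹ := fun g => rfl
  have hker : f.ker = Np α α γ P := by
    ext g
    rw [MonoidHom.mem_ker, Subgroup.mem_subgroupOf, MonoidHom.mem_ker, Subtype.ext_iff, hf,
      OneMemClass.coe_one, conj_eq_one_iff]
  let ι : (P ⧸ Np α α γ P) →* Q := QuotientGroup.lift _ f hker.ge
  have hι : ∀ g : P, ι (QuotientGroup.mk g) = f g := fun g => rfl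
  have hιinj : Function.Injective ι := by
    rw [injective_iff_map_eq_one]
    intro x
    obtain ⟨g, rfl⟩ := QuotientGroup.mk_surjective x
    intro hx
    rw [hι, ← MonoidHom.mem_ker, hker] at hx
    exact (QuotientGroup.eq_one_iff g).2 hx
  let d₀ : Q := ⟨_, hwd⟩
  have hd₀ : (d₀ : WGroup α α γ) = w * WZ α α γ ^ (q * k) * w⁻¹ := rfl
  obtain ⟨ν, hνΩ, hνZ⟩ := exists_hom_ZMod α γ
  have hνι : ∀ x, ν (ι x) = 1 := by
    intro x
    obtain ⟨g, rfl⟩ := QuotientGroup.mk_surjective x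
    rw [hι, hf, map_mul, map_mul, hνΩ, mul_one, ← map_mul, mul_inv_cancel, map_one]
  have hνd : ∀ e : ℕ, ν ((d₀ : WGroup α α γ) ^ e) =
      Multiplicative.ofAdd ((q * k * e : ℕ) : ZMod γ) := by
    intro e
    rw [hd₀, map_pow, map_mul, map_mul, mul_right_comm, ← map_mul, mul_inv_cancel, map_one, one_mul,
      map_pow, hνZ, ← pow_mul, ← ofAdd_nsmul]
    simp
  have hνmul : ∀ x (e : ℕ), ν ((ι x * d₀ ^ e : Q) : WGroup α α γ) =
      Multiplicative.ofAdd ((q * k * e : ℕ) : ZMod γ) := by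
    intro x e
    change ν ((ι x : WGroup α α γ) * (d₀ : WGroup α α γ) ^ e) = _
    rw [map_mul, hνι, one_mul, hνd]
  -- Applying ν leaves qke modulo γ = p^n k, and p does not divide q, so e is determined modulo p^n.
  -- Cancelling the power of d₀ reduces to the normal form in G_p/N_p.
  have hinj : Function.Injective fun e : Fin (p ^ (m + 2 * h)) × Fin (p ^ (m + h)) ×
      Fin (p ^ (m + h)) × Fin (p ^ n) => ι a ^ (e.1 : ℕ) * ι b ^ (e.2.1 : ℕ) *
        ι c ^ (e.2.2.1 : ℕ) * d₀ ^ (e.2.2.2 : ℕ) := by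
    rintro ⟨i, j, l, e⟩ ⟨i', j', l', e'⟩ heq
    simp only [← map_pow, ← map_mul] at heq
    have h5 := congrArg (fun g : Q => ν (g : WGroup α α γ)) heq
    simp only [hνmul] at h5
    have h6 := (ZMod.natCast_eq_natCast_iff _ _ _).1 (Multiplicative.ofAdd.injective h5)
    have hk0 : k ≠ 0 := fun h0 => hγ.ne' (by rw [hk, h0, mul_zero])
    rw [hk, mul_comm q k, mul_assoc, mul_assoc, mul_comm (p ^ n) k,
      Nat.ModEq.mul_left_cancel_iff' hk0] at h6
    have h7 : (e : ℕ) ≡ e' [MOD p ^ n] := Nat.ModEq.cancel_left_of_coprime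
      ((hp.out.coprime_iff_not_dvd.2 hpq).pow_left n) h6
    have h8 : e = e' := Fin.ext (Nat.ModEq.eq_of_lt_of_lt h7 e.2 e'.2)
    subst h8
    have h9 := hιinj (mul_right_cancel heq)
    obtain ⟨x, -, hx⟩ := hnf (a ^ (i : ℕ) * b ^ (j : ℕ) * c ^ (l : ℕ))
    have e1 := hx (i, j, l) rfl
    have e2 := hx (i', j', l') h9
    rw [← e2] at e1
    simp only [Prod.mk.injEq] at e1 ⊢
    tauto
  have hfpow : ∀ {x : P} {e : ℕ}, Omega α α γ x ^ e = 1 → f x ^ e = 1 := fun {x e} hx => by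
    apply Subtype.ext
    change (w * Omega α α γ x * w⁻¹) ^ e = 1
    rw [conj_pow, hx, mul_one, mul_inv_cancel]
  obtain ⟨hcard, hpres, hnf'⟩ := exists_PresABCD_equiv (T := Q) (p := p) (m := m) (h := h) (n := n)
    (q := q) (r := α ^ γ) (s := α ^ (q * k)) (a := ι a) (b := ι b) (c := ι c) (d := d₀) hp.out
    (H.map f) (hfpow h1)
    (Subtype.ext (by
      change (w * Omega α α γ a * w⁻¹) ^ p ^ (m + h) * (w * Omega α α γ b * w⁻¹) ^ p ^ (m + h) = 1
      rw [conj_pow, conj_pow, conj_mul, h3, mul_one, mul_inv_cancel]))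
    (hfpow h2) (hfpow h4)
    (Subtype.ext (by
      change (w * WZ α α γ ^ (q * k) * w⁻¹)⁻¹ * (w * Omega α α γ a * w⁻¹) *
        (w * WZ α α γ ^ (q * k) * w⁻¹) = (w * Omega α α γ a * w⁻¹) ^ (α ^ (q * k))
      have e1 := conj_inv_pow_zpow hda (q * k) 1
      rw [zpow_one, mul_one] at e1
      rw [conj_zpow, ← e1]; group))
    (Subtype.ext (by
      change (w * WZ α α γ ^ (q * k) * w⁻¹) * (w * Omega α α γ b * w⁻¹) *
        (w * WZ α α γ ^ (q * k) * w⁻¹)⁻¹ = (w * Omega α α γ b * w⁻¹) ^ (α ^ (q * k))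
      have e1 := conj_pow_zpow hdb (q * k) 1
      rw [zpow_one, mul_one] at e1
      rw [conj_zpow, ← e1]; group))
    (Subtype.ext (by
      change (w * WZ α α γ ^ (q * k) * w⁻¹) ^ p ^ n = (w * Omega α α γ c * w⁻¹) ^ q
      rw [conj_pow, conj_pow, hdn])) hinj hQ
  refine ⟨hcard, ι, d₀, w, hιinj, hf, hd₀, hpres, hnf', ?_⟩
  -- The swap of W is transported by conjugation with w to match the embedding ι. It preserves Q
  -- because every element of Q is an element of the image of ι times a power of d₀, and d₀ is
  -- inverted.
  let Φ : WGroup α α γ ≃* WGroup α α γ := ((MulAut.conj w⁻¹).trans S).trans (MulAut.conj w)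
  have hΦ : ∀ t, Φ (w * t * w⁻¹) = w * S t * w⁻¹ := fun t => by
    change w * S (w⁻¹ * (w * t * w⁻¹) * w⁻¹⁻¹) * w⁻¹ = _
    congr 3; group
  have hΦι : ∀ x, Φ (ι x) = ι (τ x) := fun x => by
    obtain ⟨g, rfl⟩ := QuotientGroup.mk_surjective x
    rw [hτ, hι, hι, hf, hf, hΦ, hσ]
  have hΦd : Φ d₀ = (d₀⁻¹ : Q) := by
    rw [hd₀, hΦ, map_pow, hS]
    change _ = (w * WZ α α γ ^ (q * k) * w⁻¹)⁻¹
    group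
  have hmem : ∀ g : Q, Φ g ∈ Q := fun g => by
    obtain ⟨x, hx, -⟩ := hnf' g
    simp only [← map_pow, ← map_mul] at hx
    rw [hx]
    change Φ ((ι _ : WGroup α α γ) * (d₀ : WGroup α α γ) ^ _) ∈ Q
    rw [map_mul, map_pow, hΦι, hΦd]
    exact mul_mem (SetLike.coe_mem _) (pow_mem (SetLike.coe_mem _) _)
  let ρ : Q →* Q :=
    { toFun := fun g => ⟨Φ g, hmem g⟩
      map_one' := Subtype.ext (map_one Φ)
      map_mul' := fun x y => Subtype.ext (map_mul Φ _ _) }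
  have hρ : Function.Injective ρ := fun x y hxy =>
    Subtype.ext (Φ.injective (congrArg Subtype.val hxy))
  exact ⟨MulEquiv.ofBijective ρ (Finite.injective_iff_bijective.1 hρ),
    fun x => Subtype.ext (hΦι x), Subtype.ext hΦd⟩

/-- Membership in the kernel of `Omega` in terms of the normal form. -/
theorem mem_Np_iff {r : ℤ} {P : Subgroup (MGroup (α ^ γ) (α ^ γ))} {a b c : P}
    (hgen : Subgroup.closure {a, b} = ⊤) (H : MacRel r a b c)
    (h1 : Omega α α γ a ^ p ^ (m + 2 * h) = 1)
    (h3 : Omega α α γ a ^ p ^ (m + h) * Omega α α γ b ^ p ^ (m + h) = 1)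
    (h4 : Omega α α γ c ^ p ^ (m + h) = 1)
    (hcard : Nat.card (P.map (Omega α α γ)) = p ^ (3 * m + 4 * h)) (i j l : ℤ) :
    a ^ i * b ^ j * c ^ l ∈ Np α α γ P ↔
      (p : ℤ) ^ (m + 2 * h) ∣ i - j ∧ (p : ℤ) ^ (m + h) ∣ j ∧ (p : ℤ) ^ (m + h) ∣ l := by
  rw [map_sylow_eq_closure (α := α) (γ := γ) (P := P) (a := a) (b := b) hgen] at hcard
  have key := (H.map ((Omega α α γ).comp P.subtype)).normal_form_eq_one_iff
    (pow_pos hp.out.pos _) (pow_pos hp.out.pos _) h1 h3 h4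
    (by
      refine hcard.trans ?_
      rw [← pow_add, ← pow_add]; congr 1; ring) i j l
  push_cast at key
  rw [← key, Subgroup.mem_subgroupOf, MonoidHom.mem_ker]
  simp

/-- A subgroup that is stable under the exchange of the generators inherits an automorphism. -/
theorem exists_swap_subgroup {P : Subgroup (MGroup (α ^ γ) (α ^ γ))} (hP : P.Characteristic)
    {a b : P} {t : ℕ} (hat : (a : MGroup (α ^ γ) (α ^ γ)) = MA _ _ ^ t)
    (hbt : (b : MGroup (α ^ γ) (α ^ γ)) = MB _ _ ^ t) :
    ∃ (σ : P ≃* P) (τ : (P ⧸ Np α α γ P) ≃* (P ⧸ Np α α γ P))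
      (S : WGroup α α γ ≃* WGroup α α γ), σ a = b ∧ σ b = a ∧
      (∀ g : P, τ (QuotientGroup.mk g) = QuotientGroup.mk (σ g)) ∧
      (∀ g : P, Omega α α γ (σ g) = S (Omega α α γ g)) ∧ S (WZ α α γ) = (WZ α α γ)⁻¹ := by
  obtain ⟨S, hA, hB⟩ := exists_swap_MGroup (α ^ γ)
  obtain ⟨S', hX, hY, hZ⟩ := exists_swap_WGroup α γ
  have hmap : P.map S.toMonoidHom = P := Subgroup.characteristic_iff_map_eq.1 hP S
  let σ : P ≃* P := (S.subgroupMap P).trans (MulEquiv.subgroupCongr hmap)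
  have hσ : ∀ g : P, (σ g : MGroup (α ^ γ) (α ^ γ)) = S g := fun g => rfl
  have hΩ : ∀ g : P, Omega α α γ (σ g) = S' (Omega α α γ g) := fun g => by
    rw [hσ, Omega_swap hA hB hX hY]
  have hN : (Np α α γ P).map σ.toMonoidHom = Np α α γ P := by
    have h1 : ∀ g, σ g ∈ Np α α γ P ↔ g ∈ Np α α γ P := fun g => by
      rw [Subgroup.mem_subgroupOf, Subgroup.mem_subgroupOf, MonoidHom.mem_ker, MonoidHom.mem_ker,
        hΩ, map_eq_one_iff _ S'.injective]
    ext g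
    constructor
    · rintro ⟨g, hg, rfl⟩
      exact (h1 g).2 hg
    · intro hg
      exact ⟨σ.symm g, (h1 _).1 (by simpa using hg), by simp⟩
  refine ⟨σ, QuotientGroup.congr _ _ σ hN, S', ?_, ?_, fun g => rfl, hΩ, hZ⟩
  · exact Subtype.ext (by rw [hσ, hat, hbt, map_pow, hA])
  · exact Subtype.ext (by rw [hσ, hat, hbt, map_pow, hB])

end
end Wamsley
-- The main theorem
theorem theorem4p1 (α : ℤ) (γ p m n h k : ℕ) (hγ : 0 < γ) (hα : α ^ γ ≠ 1)
    (hp : p.Prime) (hp_odd : Odd p) (hp3 : p = 3 → ¬ α ^ γ ≡ 7 [ZMOD 9])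
    (hm : m = padicValInt p (α ^ γ - 1)) (hh : h = padicValInt p (α - 1)) (hh_pos : 0 < h)
    (hk : γ = p ^ n * k) (hpk : ¬ p ∣ k) :
    Finite (Wamsley.MGroup (α ^ γ) (α ^ γ)) ∧ Finite (Wamsley.WGroup α α γ) ∧
    ∀ P : Sylow p (Wamsley.MGroup (α ^ γ) (α ^ γ)),
      (P : Subgroup (Wamsley.MGroup (α ^ γ) (α ^ γ))).Normal ∧
      -- the canonical projection onto the Sylow `p`-subgroup `P`
      (∃ π : Wamsley.MGroup (α ^ γ) (α ^ γ) →* P, ∀ g : P, π g = g) ∧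
      ∀ π : Wamsley.MGroup (α ^ γ) (α ^ γ) →* P, (∀ g : P, π g = g) →
      ∀ a b c : P, a = π (Wamsley.MA _ _) → b = π (Wamsley.MB _ _) → c = Wamsley.comm a b →
      ∀ a₀ b₀ c₀ : P ⧸ Wamsley.Np α α γ P,
      a₀ = QuotientGroup.mk a → b₀ = QuotientGroup.mk b → c₀ = QuotientGroup.mk c →
      ∀ q : ℕ, q = Nat.card (Wamsley.MGroup (α ^ γ) (α ^ γ) ⧸
        (P : Subgroup (Wamsley.MGroup (α ^ γ) (α ^ γ)))) →
      -- the subgroup `N_p`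
      (Wamsley.Np α α γ P : Set P) = Wamsley.Mset P p n ∩ Wamsley.Lset P p (2 * n) ∧
      Wamsley.Np α α γ P = Subgroup.closure
        {a ^ p ^ (m + 2 * h), a ^ p ^ (m + h) * b ^ p ^ (m + h), c ^ p ^ (m + h)} ∧
      Wamsley.Np α α γ P = Subgroup.closure
        {b ^ p ^ (m + 2 * h), a ^ p ^ (m + h) * b ^ p ^ (m + h), c ^ p ^ (m + h)} ∧
      Nonempty (Wamsley.Np α α γ P ≃*
        Multiplicative (ZMod (p ^ (2 * n)) × ZMod (p ^ n) × ZMod (p ^ n))) ∧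
      Nat.card (Wamsley.Np α α γ P) = p ^ (4 * n) ∧
      -- the quotient `G_p / N_p`: order, presentation, normal form
      Nat.card (P ⧸ Wamsley.Np α α γ P) = p ^ (7 * h + 3 * n) ∧
      (∃ e : Wamsley.PresABC p m h (α ^ γ) ≃* P ⧸ Wamsley.Np α α γ P,
        e (PresentedGroup.of 0) = a₀ ∧ e (PresentedGroup.of 1) = b₀ ∧
        e (PresentedGroup.of 2) = c₀) ∧
      (∀ g : P ⧸ Wamsley.Np α α γ P,
        ∃! e : Fin (p ^ (m + 2 * h)) × Fin (p ^ (m + h)) × Fin (p ^ (m + h)),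
          g = a₀ ^ (e.1 : ℕ) * b₀ ^ (e.2.1 : ℕ) * c₀ ^ (e.2.2 : ℕ)) ∧
      -- the automorphism of `G_p` and the one it induces on `G_p / N_p`
      ∃ σ : P ≃* P, σ a = b ∧ σ b = a ∧ σ c = c⁻¹ ∧
      ∃ τ : (P ⧸ Wamsley.Np α α γ P) ≃* (P ⧸ Wamsley.Np α α γ P),
        (∀ g : P, τ (QuotientGroup.mk g) = QuotientGroup.mk (σ g)) ∧
        τ a₀ = b₀ ∧ τ b₀ = a₀ ∧ τ c₀ = c₀⁻¹ ∧
      -- a Sylow `p`-subgroup `W_p`: order, presentation, normal form, automorphism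
      ∀ Q : Sylow p (Wamsley.WGroup α α γ),
        Nat.card Q = p ^ (7 * h + 4 * n) ∧ Nat.card Q = p ^ (7 * m - 3 * n) ∧
        ∃ (ι : (P ⧸ Wamsley.Np α α γ P) →* Q) (d₀ : Q) (w : Wamsley.WGroup α α γ),
          -- up to conjugation in `W`, `ι` is induced by `Omega` and `d₀` is `Z ^ (q k)`
          Function.Injective ι ∧
          (∀ g : P, (ι (QuotientGroup.mk g) : Wamsley.WGroup α α γ) =
            w * Wamsley.Omega α α γ g * w⁻¹) ∧
          (d₀ : Wamsley.WGroup α α γ) = w * Wamsley.WZ α α γ ^ (q * k) * w⁻¹ ∧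
          (∃ e : Wamsley.PresABCD p m h n q (α ^ γ) (α ^ (q * k)) ≃* Q,
            e (PresentedGroup.of 0) = ι a₀ ∧ e (PresentedGroup.of 1) = ι b₀ ∧
            e (PresentedGroup.of 2) = ι c₀ ∧ e (PresentedGroup.of 3) = d₀) ∧
          (∀ g : Q, ∃! e : Fin (p ^ (m + 2 * h)) × Fin (p ^ (m + h)) × Fin (p ^ (m + h)) ×
              Fin (p ^ n),
            g = ι a₀ ^ (e.1 : ℕ) * ι b₀ ^ (e.2.1 : ℕ) * ι c₀ ^ (e.2.2.1 : ℕ) *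
              d₀ ^ (e.2.2.2 : ℕ)) ∧
          ∃ ρ : Q ≃* Q, (∀ x, ρ (ι x) = ι (τ x)) ∧ ρ d₀ = d₀⁻¹ := by
  have hpF : Fact p.Prime := ⟨hp⟩
  obtain ⟨hmn, ⟨u, hr, hu⟩, v, hv, hv'⟩ :=
    Wamsley.exists_params hα hp hp_odd hm hh hh_pos hk hpk
  clear hm hh
  have hm0 : 0 < m := by omega
  have hE := Wamsley.linkExp_sq_ne_zero hp hp_odd hm0 hr hu hp3
  have hfin := Wamsley.finite_MGroup hE hα
  have hnil := Wamsley.isNilpotent_MGroup hE hα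
  have hfinW := Wamsley.finite_WGroup (α := α) hγ
  refine ⟨hfin, hfinW, fun P => ?_⟩
  have hN : (P : Subgroup (Wamsley.MGroup (α ^ γ) (α ^ γ))).Normal := inferInstance
  refine ⟨hN, Wamsley.exists_retraction hnil P, ?_⟩
  intro π hπ a b c ha hb hc a₀ b₀ c₀ ha₀ hb₀ hc₀ q hq
  have hsurj : Function.Surjective π := fun g => ⟨g, hπ g⟩
  obtain ⟨M, hcardP⟩ := Wamsley.maxMac_sylow hp_odd hm0 hr hu hp3 P π hsurj
  rw [← ha, ← hb, ← hc] at M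
  obtain ⟨t, ht⟩ := Wamsley.exists_pow_eq_retraction P π hπ
  have hcπ : c = π (Wamsley.comm (Wamsley.MA _ _) (Wamsley.MB _ _)) := by
    rw [Wamsley.map_comm_eq, ← ha, ← hb, hc]
  have hat := ha ▸ ht (Wamsley.MA _ _)
  have hbt := hb ▸ ht (Wamsley.MB _ _)
  have hct := hcπ ▸ ht (Wamsley.comm (Wamsley.MA _ _) (Wamsley.MB _ _))
  obtain ⟨⟨h1, h2, h3, h4⟩, hcardΩ⟩ := Wamsley.Omega_sylow hp_odd hh_pos (by omega) hγ hr hu hv hv'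
    hp3 P hat hbt hct M.H M.gen
  have hK := Wamsley.mem_Np_iff (p := p) M.gen M.H h1 h3 h4 hcardΩ
  obtain ⟨iso⟩ := M.nonempty_mulEquiv hmn hK
  have hcardN : Nat.card (Wamsley.Np α α γ P) = p ^ (4 * n) := by
    rw [Nat.card_congr iso.toEquiv]
    change Nat.card (ZMod (p ^ (2 * n)) × ZMod (p ^ n) × ZMod (p ^ n)) = _
    rw [Nat.card_prod, Nat.card_prod, Nat.card_zmod, Nat.card_zmod, ← pow_add, ← pow_add]
    congr 1; ring
  have hcardQ : Nat.card (P ⧸ Wamsley.Np α α γ P) = p ^ (7 * h + 3 * n) := by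
    have e1 := (Wamsley.Np α α γ P).card_eq_card_quotient_mul_card_subgroup
    rw [hcardN] at e1
    refine Nat.eq_of_mul_eq_mul_right (pow_pos hp.pos (4 * n)) ?_
    rw [← e1, ← pow_add]
    refine hcardP.trans (congrArg _ ?_)
    omega
  obtain ⟨k1, k2, k3, k4⟩ := Wamsley.MaxMac.gen_mem hK
  obtain ⟨hpres, hnf⟩ := Wamsley.exists_PresABC_equiv (p := p) (m := m) (h := h) hp
    (M.H.map (QuotientGroup.mk' (Wamsley.Np α α γ P)))
    ((QuotientGroup.eq_one_iff _).2 k1) ((QuotientGroup.eq_one_iff _).2 k3)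
    ((QuotientGroup.eq_one_iff _).2 k2) ((QuotientGroup.eq_one_iff _).2 k4)
    (by
      have := congrArg (Subgroup.map (QuotientGroup.mk' (Wamsley.Np α α γ P))) M.gen
      rwa [MonoidHom.map_closure, Set.image_pair,
        Subgroup.map_top_of_surjective _ (QuotientGroup.mk'_surjective _)] at this)
    (hcardQ.trans (congrArg _ (by omega)))
  obtain ⟨σ, τ, S, hσa, hσb, hτ, hΩ, hS⟩ := Wamsley.exists_swap_subgroup (α := α) (γ := γ)
    (P.characteristic_of_normal hN) hat hbt
  have hσc : σ c = c⁻¹ := by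
    have e1 := Wamsley.map_comm_eq σ.toMonoidHom a b
    rw [← hc] at e1
    refine e1.trans ?_
    change Wamsley.comm (σ a) (σ b) = _
    rw [hσa, hσb, hc]
    simp [Wamsley.comm, mul_assoc]
  have hpq : ¬ p ∣ q := hq ▸ P.not_dvd_index
  -- Since q is the index of P, the q-th power of [A, B] lies in P and is fixed by π. Hence it
  -- equals c^q, although c is only the projection of [A, B].
  have hdc : (Wamsley.WZ α α γ ^ γ) ^ q = Wamsley.Omega α α γ c ^ q := by
    have e1 : Wamsley.comm (Wamsley.MA (α ^ γ) (α ^ γ)) (Wamsley.MB _ _) ^ q ∈ P := by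
      rw [hq]
      exact Subgroup.pow_index_mem (P : Subgroup (Wamsley.MGroup (α ^ γ) (α ^ γ))) _
    have e2 := hπ ⟨_, e1⟩
    rw [map_pow, ← hcπ] at e2
    have e3 : (c : Wamsley.MGroup (α ^ γ) (α ^ γ)) ^ q =
        Wamsley.comm (Wamsley.MA (α ^ γ) (α ^ γ)) (Wamsley.MB _ _) ^ q :=
      congrArg Subtype.val e2
    rw [← map_pow, e3, map_pow, Wamsley.map_comm_eq, Wamsley.Omega_MA, Wamsley.Omega_MB,
      Wamsley.WZ_rel]
  subst ha₀ hb₀ hc₀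
  refine ⟨M.coe_eq_Mset_inter_Lset hmn hK, M.eq_closure_a hK, M.eq_closure_b hK, ⟨iso⟩, hcardN,
    hcardQ, hpres, hnf, σ, hσa, hσb, hσc, τ, hτ, (hτ a).trans (congrArg _ hσa),
    (hτ b).trans (congrArg _ hσb), (hτ c).trans (congrArg _ hσc), fun Q => ?_⟩
  obtain ⟨hcQ, hrest⟩ := Wamsley.sylow_WGroup P.isPGroup' M.gen M.H h1 h2 h3 h4
    (by
      rw [hat, map_pow, Wamsley.Omega_MA]
      exact Wamsley.conj_inv_mul_pow (Wamsley.WX_conj α γ) t)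
    (by
      rw [hbt, map_pow, Wamsley.Omega_MB]
      exact Wamsley.conj_mul_pow (Wamsley.WY_conj α γ) t)
    hdc hγ hk hpq hnf hΩ hS hτ Q
    (Wamsley.card_sylow_WGroup_le P.not_dvd_index hcardΩ hk hpk Q)
  exact ⟨hcQ.trans (congrArg _ (by omega)), hcQ.trans (congrArg _ (by omega)), hrest⟩
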